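/- Let $\mathcal A$ be a unital complex $\ast$-algebra with two states (positive unital linear functionals) $\varphi,\psi$. For $a\in\mathcal A$ the free cumulants $R^\psi_n(a)$ and the two-state free cumulants $R^{\varphi,\psi}_n(a)$ are defined by $$\psi[a^n]=\sum_{\pi\in NC(n)}\prod_{V\in\pi}R^\psi_{|V|}(a),\qquad \varphi[a^n]=\sum_{\pi\in NC(n)}\ \prod_{V\ \mathrm{outer}}R^{\varphi,\psi}_{|V|}(a)\prod_{V\ \mathrm{inner}}R^{\psi}_{|V|}(a)\qquad(n\ge1),$$ where a block of a non-crossing partition is inner if it lies strictly between two elements of another block, and outer otherwise. Subalgebras $(\mathcal A_i)$ are two-state freely independent if $\psi[a_1\cdots a_n]=0$ and $\varphi[a_1\cdots a_n]=\varphi[a_1]\cdots\varphi[a_n]$ whenever $n\ge1$, $a_j\in\mathcal A_{i(j)}$, $i(j)\ne i(j+1)$ and $\psi[a_j]=0$ for all $j$. Let $\alpha\in\mathbb R$, $T>0$, and let $\{X(t):0\le t\le T\}\subset\mathcal A$ be a two-state free Brownian motion with parameter $\alpha$: the $X(t)$ are self-adjoint, $X(0)=0$, the increments over disjoint intervals are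 two-state freely independent and are stationary with respect to both $\varphi$ and $\psi$, they satisfy $\varphi[X(t)]=0$, $\varphi[(X(t)-X(s))^2]=t-s$ and $R^{\varphi,\psi}_n(X(t)-X(s))=0$ for $n>2$, and $R^\psi_1(X(t))=\alpha t$, $R^\psi_2(X(t))=t$, $R^\psi_n(X(t))=0$ for $n>2$. Then each $X(t)$ has distributions $\mu_t$ with respect to $\varphi$ and $\nu_t$ with respect to $\psi$, that is, probability measures on $\mathbb R$ with $\int x^n\,d\mu_t=\varphi[X(t)^n]$ and $\int x^n\,d\nu_t=\psi[X(t)^n]$ for all $n\geq 0$. The process has a classical version which is a Markov process: there are transition functions $\mathcal K_{s,t}$, $0\le s<t\le T$ (Markov kernels on $\mathbb R$ satisfying the Chapman--Kolmogorov equations) such that the Markov process $Z$ with these transition functions and $Z_0=0$ satisfies $$\mathbb E[Z_{t_1}^{k_1}\cdots Z_{t_n}^{k_n}]=\varphi[X(t_1)^{k_1}\cdots X(t_n)^{k_n}]\qquad\text{for all }0<t_1<\dots<t_n\le T,\ k_i\ge0,$$ with all these moments finite. Moreover, for every such family of transition functions and every $0\le t<T$, on the polynomial functions, which form a dense domain in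 $L^2(\mathbb R,\mu_t)$, the generator of the process at time $t$ is $$A_t=\alpha(\partial_x-L_{\mu_t})+\partial_xL_{\nu_t},\qquad L_\nu[f](x)=\int_{\mathbb R}\frac{f(x)-f(y)}{x-y}\,d\nu(y),$$ where the difference quotient is read as $f'(x)$ for $y=x$. That is, for every polynomial $f$, $$\lim_{h\downarrow0}\frac{\mathcal K_{t,t+h}(f)-f}{h}=A_tf\quad\text{in }L^2(\mathbb R,\mu_t),\qquad \mathcal K_{t,t+h}(f)(x)=\int f(y)\,\mathcal K_{t,t+h}(x,dy).$$ -/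

import Mathlib

open MeasureTheory ProbabilityTheory Filter Topology

noncomputable section

namespace TwoStateFree

/-! ### Non-crossing partitions and cumulants -/

/-- A partition of `{0, …, n-1}` is non-crossing. -/
def NonCrossing {n : ℕ} (π : Finpartition (Finset.univ : Finset (Fin n))) : Prop :=
  ∀ U ∈ π.parts, ∀ V ∈ π.parts, ∀ x₁ y₁ x₂ y₂ : Fin n,
    x₁ < y₁ → y₁ < x₂ → x₂ < y₂ → x₁ ∈ U → x₂ ∈ U → y₁ ∈ V → y₂ ∈ V → U = V

/-- A block `V` of `π` is inner if it lies strictly between two elements of another block;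
a block which is not inner is outer. -/
def IsInner {n : ℕ} (π : Finpartition (Finset.univ : Finset (Fin n))) (V : Finset (Fin n)) : Prop :=
  ∃ W ∈ π.parts, W ≠ V ∧ ∃ y₁ ∈ W, ∃ y₂ ∈ W, ∀ x ∈ V, y₁ < x ∧ x < y₂

/-- The non-crossing partitions of `{0, …, n-1}`, except for the one-block partition. -/
def ProperNC (n : ℕ) : Type :=
  {π : Finpartition (Finset.univ : Finset (Fin n)) //
    NonCrossing π ∧ ∀ V ∈ π.parts, V.card < n}

instance (n : ℕ) : Fintype (ProperNC n) := by
  classical exact Subtype.fintype _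

open Classical in
/-- The free cumulants `R n` of a moment sequence `m`: for `1 ≤ n`,
`m n = ∑ π ∈ NC(n), ∏ V ∈ π, R |V|`, solved for the term of the one-block partition. -/
def freeCumulant (m : ℕ → ℂ) (n : ℕ) : ℂ :=
  m n - ∑ π : ProperNC n, ∏ V : {V // V ∈ π.1.parts}, freeCumulant m V.1.card
termination_by n
decreasing_by exact π.2.2 V.1 V.2

open Classical in
/-- The two-state free cumulants `R n` of a pair of moment sequences (`m` for `φ`, `m'` for `ψ`):
for `1 ≤ n`,
`m n = ∑ π ∈ NC(n), (∏ V ∈ π outer, R |V|) * (∏ V ∈ π inner, freeCumulant m' |V|)`,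
solved for the term of the one-block partition. -/
def twoStateCumulant (m m' : ℕ → ℂ) (n : ℕ) : ℂ :=
  m n - ∑ π : ProperNC n, ∏ V : {V // V ∈ π.1.parts},
    if IsInner π.1 V.1 then freeCumulant m' V.1.card else twoStateCumulant m m' V.1.card
termination_by n
decreasing_by exact π.2.2 V.1 V.2

/-! ### Two-state non-commutative probability spaces -/

section Algebra

variable {A : Type*} [Ring A] [StarRing A] [Algebra ℂ A]

/-- A state on a unital star-algebra: a positive unital linear functional. -/
structure IsState (φ : A →ₗ[ℂ] ℂ) : Prop where
  map_one : φ 1 = 1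
  nonneg : ∀ a : A, 0 ≤ (φ (star a * a)).re ∧ (φ (star a * a)).im = 0

/-- The free cumulants `R^ψ_n(a)` of an element. -/
def elemFreeCumulant (ψ : A →ₗ[ℂ] ℂ) (a : A) (n : ℕ) : ℂ :=
  freeCumulant (fun k => ψ (a ^ k)) n

/-- The two-state free cumulants `R^{φ,ψ}_n(a)` of an element. -/
def elemTwoStateCumulant (φ ψ : A →ₗ[ℂ] ℂ) (a : A) (n : ℕ) : ℂ :=
  twoStateCumulant (fun k => φ (a ^ k)) (fun k => ψ (a ^ k)) n

/-- Two-state free independence of a family of unital subalgebras: an alternating product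
`a₀ a₁ ⋯ aₙ` of `ψ`-centered elements is `ψ`-centered, and `φ` is multiplicative on it. -/
def TwoStateFreelyIndependent (φ ψ : A →ₗ[ℂ] ℂ) {ι : Type*} (S : ι → Subalgebra ℂ A) : Prop :=
  ∀ (n : ℕ) (i : Fin (n + 1) → ι) (a : Fin (n + 1) → A),
    (∀ j : Fin n, i j.castSucc ≠ i j.succ) → (∀ j, a j ∈ S (i j)) → (∀ j, ψ (a j) = 0) →
      ψ (List.ofFn a).prod = 0 ∧ φ (List.ofFn a).prod = ∏ j, φ (a j)

/-- `X(t)`, `0 ≤ t ≤ T`, is a process of self-adjoint elements with two-state freely independent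
stationary increments, started at `0` and `φ`-centered. -/
structure HasTwoStateFreeIncrements (φ ψ : A →ₗ[ℂ] ℂ) (T : ℝ) (X : ℝ → A) : Prop where
  selfAdjoint : ∀ t ∈ Set.Icc 0 T, IsSelfAdjoint (X t)
  zero : X 0 = 0
  centered : ∀ t ∈ Set.Icc 0 T, φ (X t) = 0
  free : ∀ (k : ℕ) (s t : Fin k → ℝ), (∀ i, 0 ≤ s i ∧ s i < t i ∧ t i ≤ T) →
    (∀ i j, i ≠ j → Disjoint (Set.Ico (s i) (t i)) (Set.Ico (s j) (t j))) →
    TwoStateFreelyIndependent φ ψ fun i => Algebra.adjoin ℂ {X (t i) - X (s i)}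
  stationary : ∀ s t : ℝ, 0 ≤ s → s ≤ t → t ≤ T → ∀ n : ℕ,
    φ ((X t - X s) ^ n) = φ (X (t - s) ^ n) ∧ ψ ((X t - X s) ^ n) = ψ (X (t - s) ^ n)

/-- An algebraic two-state free Brownian motion: the increments have two-state normal
distributions with `φ`-variance equal to the length of the time interval. -/
structure IsAlgebraicTwoStateFBM (φ ψ : A →ₗ[ℂ] ℂ) (T : ℝ) (X : ℝ → A) : Prop
    extends HasTwoStateFreeIncrements φ ψ T X where
  normal : ∀ s t : ℝ, 0 ≤ s → s ≤ t → t ≤ T → ∀ n : ℕ, 2 < n →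
    elemTwoStateCumulant φ ψ (X t - X s) n = 0
  variance : ∀ s t : ℝ, 0 ≤ s → s ≤ t → t ≤ T → φ ((X t - X s) ^ 2) = ((t - s : ℝ) : ℂ)

/-- A two-state free Brownian motion with parameter `α`: the free cumulant generating function of
`X(t)` with respect to `ψ` is `α t z + t z ^ 2`. -/
structure IsTwoStateFBM (φ ψ : A →ₗ[ℂ] ℂ) (α T : ℝ) (X : ℝ → A) : Prop
    extends IsAlgebraicTwoStateFBM φ ψ T X where
  psi_one : ∀ t ∈ Set.Icc 0 T, elemFreeCumulant ψ (X t) 1 = ((α * t : ℝ) : ℂ)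
  psi_two : ∀ t ∈ Set.Icc 0 T, elemFreeCumulant ψ (X t) 2 = (t : ℂ)
  psi_higher : ∀ t ∈ Set.Icc 0 T, ∀ n : ℕ, 2 < n → elemFreeCumulant ψ (X t) n = 0

/-- The probability measure `μ` is the distribution of `a` with respect to the functional `χ`. -/
structure IsDistribution (χ : A →ₗ[ℂ] ℂ) (a : A) (μ : Measure ℝ) : Prop where
  prob : IsProbabilityMeasure μ
  integrable : ∀ n : ℕ, Integrable (fun x : ℝ => x ^ n) μ
  moment : ∀ n : ℕ, ((∫ x, x ^ n ∂μ : ℝ) : ℂ) = χ (a ^ n)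

end Algebra

/-! ### The classical version -/

/-- The joint law of the positions at the times `τ 0 < τ 1 < ⋯`, given the position at the earlier
time `s`, of a Markov process with transition functions `K`. -/
def pathKernel (K : ℝ → ℝ → Kernel ℝ ℝ) : (n : ℕ) → ℝ → (Fin n → ℝ) → Kernel ℝ (Fin n → ℝ)
  | 0, _, _ => Kernel.const ℝ (Measure.dirac Fin.elim0)
  | n + 1, s, τ =>
    (K s (τ 0) ⊗ₖ Kernel.prodMkLeft ℝ (pathKernel K n (τ 0) (Fin.tail τ))).map
      fun p => (Fin.cons p.1 p.2 : Fin (n + 1) → ℝ)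

/-- `K` is the family of transition functions of a classical version of the process `X(t)`,
`0 ≤ t ≤ T`, which is a Markov process: the Markov process started at `0` at time `0` with
transition functions `K s t`, `0 ≤ s < t ≤ T`, has the time-ordered joint moments
`φ[X(t₁)^{k₁} ⋯ X(tₙ)^{kₙ}]`, `t₁ < ⋯ < tₙ`. -/
structure IsClassicalMarkovVersion {A : Type*} [Ring A] [Algebra ℂ A] (φ : A →ₗ[ℂ] ℂ)
    (T : ℝ) (X : ℝ → A) (K : ℝ → ℝ → Kernel ℝ ℝ) : Prop where
  markov : ∀ s t, IsMarkovKernel (K s t)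
  chapman_kolmogorov : ∀ r s t : ℝ, 0 ≤ r → r < s → s < t → t ≤ T → K s t ∘ₖ K r s = K r t
  integrable : ∀ (n : ℕ) (τ : Fin n → ℝ) (k : Fin n → ℕ), StrictMono τ →
    (∀ i, τ i ∈ Set.Ioc 0 T) → Integrable (fun x => ∏ i, x i ^ k i) (pathKernel K n 0 τ 0)
  moment : ∀ (n : ℕ) (τ : Fin n → ℝ) (k : Fin n → ℕ), StrictMono τ →
    (∀ i, τ i ∈ Set.Ioc 0 T) →
    ((∫ x, ∏ i, x i ^ k i ∂(pathKernel K n 0 τ 0) : ℝ) : ℂ) =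
      φ (List.ofFn fun i => X (τ i) ^ k i).prod

/-! ### The generator -/

/-- `L_ν[f](x) = ∫ (f(x) - f(y)) / (x - y) dν(y)`, where the difference quotient is `f'(x)` on the
diagonal. -/
def diffQuot (ν : Measure ℝ) (f : ℝ → ℝ) (x : ℝ) : ℝ := ∫ y, dslope f x y ∂ν

/-- The operator `α (∂_x - L_μ) + ∂_x L_ν`. -/
def genOp (α : ℝ) (μ ν : Measure ℝ) (f : ℝ → ℝ) (x : ℝ) : ℝ :=
  α * (deriv f x - diffQuot μ f x) + deriv (diffQuot ν f) x

/-- The polynomial functions on the real line. -/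
def polynomialFunctions : Set (ℝ → ℝ) := Set.range fun (p : Polynomial ℝ) (x : ℝ) => p.eval x

/-- `G` is, on the dense domain `D` of `L²(μ)`, the generator at time `t` of the process with
transition functions `K`: the right derivative at `h = 0`, in `L²(μ)`, of
`x ↦ ∫ f(y) K_{t,t+h}(x, dy)` is `G f`, for `f ∈ D`. -/
structure IsGeneratorAt (K : ℝ → ℝ → Kernel ℝ ℝ) (t : ℝ) (μ : Measure ℝ) (D : Set (ℝ → ℝ))
    (G : (ℝ → ℝ) → ℝ → ℝ) : Prop where
  memLp : ∀ f ∈ D, MemLp f 2 μ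
  dense : ∀ g : ℝ → ℝ, MemLp g 2 μ → ∀ ε : ENNReal, 0 < ε → ∃ f ∈ D, eLpNorm (g - f) 2 μ < ε
  memLp_image : ∀ f ∈ D, MemLp (G f) 2 μ
  integrable : ∀ f ∈ D, ∀ᶠ h in 𝓝[>] (0 : ℝ),
    (∀ᵐ x ∂μ, Integrable f (K t (t + h) x)) ∧ MemLp (fun x => ∫ y, f y ∂(K t (t + h) x)) 2 μ
  tendsto : ∀ f ∈ D, Tendsto
    (fun h : ℝ => eLpNorm (fun x => h⁻¹ * ((∫ y, f y ∂(K t (t + h) x)) - f x) - G f x) 2 μ)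
    (𝓝[>] 0) (𝓝 0)

end TwoStateFree

end

namespace TwoStateFree

/-! ### Small-time asymptotics of moments with small cumulants -/

lemma isBigO_one_finset_prod {ι : Type*} (s : Finset ι) (f : ι → ℝ → ℂ)
    (hf : ∀ i ∈ s, f i =O[𝓝[>] 0] (id : ℝ → ℝ)) :
    (fun h => ∏ i ∈ s, f i h) =O[𝓝[>] 0] (fun _ => (1 : ℝ)) := by
  classical
  have hid : (id : ℝ → ℝ) =O[𝓝[>] 0] (fun _ => (1 : ℝ)) :=
    (tendsto_nhdsWithin_of_tendsto_nhds tendsto_id).isBigO_one ℝ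
  induction s using Finset.induction_on with
  | empty => simpa using Asymptotics.isBigO_const_const (1 : ℂ) (one_ne_zero : (1 : ℝ) ≠ 0) _
  | insert a s ha ih =>
    simp only [Finset.prod_insert ha]
    simpa using ((hf a (by simp)).trans hid).mul (ih fun i hi => hf i (by simp [hi]))

lemma isLittleO_id_finset_prod {ι : Type*} [DecidableEq ι] (s : Finset ι) (f : ι → ℝ → ℂ)
    (hf : ∀ i ∈ s, f i =O[𝓝[>] 0] (id : ℝ → ℝ)) (hs : 1 < s.card) :
    (fun h => ∏ i ∈ s, f i h) =o[𝓝[>] 0] (id : ℝ → ℝ) := by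
  obtain ⟨a, ha, b, hb, hab⟩ := Finset.one_lt_card.1 hs
  have hid : (id : ℝ → ℝ) =o[𝓝[>] 0] (fun _ => (1 : ℝ)) :=
    (Asymptotics.isLittleO_one_iff ℝ).2 (tendsto_nhdsWithin_of_tendsto_nhds tendsto_id)
  have e : (fun h => ∏ i ∈ s, f i h) =
      fun h => f a h * (f b h * ∏ i ∈ (s.erase a).erase b, f i h) := by
    funext h
    rw [Finset.mul_prod_erase _ (fun i => f i h) (by simp [hb, hab.symm]),
      Finset.mul_prod_erase _ (fun i => f i h) ha]
  rw [e]
  have h1 : (fun h => f b h * ∏ i ∈ (s.erase a).erase b, f i h) =o[𝓝[>] 0]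
      (fun _ => (1 : ℝ)) := by
    simpa using ((hf b hb).trans_isLittleO hid).mul_isBigO
      (isBigO_one_finset_prod ((s.erase a).erase b) f
        fun i hi => hf i (Finset.mem_of_mem_erase (Finset.mem_of_mem_erase hi)))
  simpa [Function.id_def] using (hf a ha).mul_isLittleO h1

lemma one_lt_card_parts {n : ℕ} (hn : 1 ≤ n) (π : ProperNC n) : 1 < π.1.parts.card := by
  by_contra hc
  have hne : (Finset.univ : Finset (Fin n)).Nonempty := ⟨⟨0, hn⟩, by simp⟩
  have h1 : π.1.parts.card = 1 := by
    have := Finset.card_pos.2 (π.1.parts_nonempty (by simpa using hne.ne_empty))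
    omega
  obtain ⟨V, hV⟩ := Finset.card_eq_one.1 h1
  have h2 := π.1.sup_parts
  rw [hV, Finset.sup_singleton] at h2
  have h3 := π.2.2 V (by simp [hV])
  simp only [id] at h2
  rw [h2] at h3
  simp at h3

lemma one_le_card_part {n : ℕ} (π : ProperNC n) (V : {V // V ∈ π.1.parts}) : 1 ≤ V.1.card :=
  Finset.card_pos.2 (π.1.nonempty_of_mem_parts V.2)

lemma properNC_sum_isLittleO {n : ℕ} (hn : 1 ≤ n)
    (f : (π : ProperNC n) → {V // V ∈ π.1.parts} → ℝ → ℂ)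
    (hf : ∀ π V, f π V =O[𝓝[>] 0] (id : ℝ → ℝ)) :
    (fun h => ∑ π : ProperNC n, ∏ V : {V // V ∈ π.1.parts}, f π V h) =o[𝓝[>] 0]
      (id : ℝ → ℝ) := by
  classical
  refine Asymptotics.IsLittleO.fun_sum fun π _ =>
    isLittleO_id_finset_prod Finset.univ (f π) (fun V _ => hf π V) ?_
  simpa using one_lt_card_parts hn π

/-- The difference is the sum over the non-crossing partitions with at least two blocks, and each
product there contains two factors that are O(h). -/
lemma moment_sub_freeCumulant_isLittleO (m : ℝ → ℕ → ℂ) {n : ℕ} (hn : 1 ≤ n)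
    (hm : ∀ k, 1 ≤ k → (fun h => freeCumulant (m h) k) =O[𝓝[>] 0] (id : ℝ → ℝ)) :
    (fun h => m h n - freeCumulant (m h) n) =o[𝓝[>] 0] (id : ℝ → ℝ) := by
  classical
  have e : (fun h => m h n - freeCumulant (m h) n) = fun h =>
      ∑ π : ProperNC n, ∏ V : {V // V ∈ π.1.parts}, freeCumulant (m h) V.1.card := by
    funext h
    rw [freeCumulant]
    rw [sub_sub_cancel]
  rw [e]
  exact properNC_sum_isLittleO hn (fun π V h => freeCumulant (m h) V.1.card)
    fun π V => hm _ (one_le_card_part π V)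

/-- Only two-state cumulants of order below n enter the sum, so the orders one and two can be
treated in turn when their bounds are not given in advance. -/
lemma moment_sub_twoStateCumulant_isLittleO (m m' : ℝ → ℕ → ℂ) {n : ℕ} (hn : 1 ≤ n)
    (hm : ∀ k, 1 ≤ k → k < n →
      (fun h => twoStateCumulant (m h) (m' h) k) =O[𝓝[>] 0] (id : ℝ → ℝ))
    (hm' : ∀ k, 1 ≤ k → (fun h => freeCumulant (m' h) k) =O[𝓝[>] 0] (id : ℝ → ℝ)) :
    (fun h => m h n - twoStateCumulant (m h) (m' h) n) =o[𝓝[>] 0] (id : ℝ → ℝ) := by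
  classical
  have e : (fun h => m h n - twoStateCumulant (m h) (m' h) n) = fun h =>
      ∑ π : ProperNC n, ∏ V : {V // V ∈ π.1.parts},
        if IsInner π.1 V.1 then freeCumulant (m' h) V.1.card
        else twoStateCumulant (m h) (m' h) V.1.card := by
    funext h
    rw [twoStateCumulant]
    rw [sub_sub_cancel]
  rw [e]
  refine properNC_sum_isLittleO hn (fun π V h => if IsInner π.1 V.1 then
    freeCumulant (m' h) V.1.card else twoStateCumulant (m h) (m' h) V.1.card) fun π V => ?_
  by_cases hV : IsInner π.1 V.1
  · simpa only [hV, if_true] using hm' _ (one_le_card_part π V)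
  · simpa only [hV, if_false] using hm _ (one_le_card_part π V) (π.2.2 _ V.2)

/-! ### Moments of the process at small times -/

section

variable {A : Type*} [Ring A] [StarRing A] [Algebra ℂ A] {φ ψ : A →ₗ[ℂ] ℂ} {α T : ℝ} {X : ℝ → A}

lemma eventually_mem_Ioc {T : ℝ} (hT : 0 < T) : ∀ᶠ h in 𝓝[>] (0 : ℝ), h ∈ Set.Ioc 0 T :=
  Ioc_mem_nhdsGT hT

lemma ofReal_mul_isBigO (c : ℝ) :
    (fun h : ℝ => ((c * h : ℝ) : ℂ)) =O[𝓝[>] 0] (id : ℝ → ℝ) := by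
  refine Asymptotics.IsBigO.of_bound |c| (Eventually.of_forall fun h => ?_)
  simp

/-- The first-order behaviour at `h = 0` of the moments of a two-state normal increment. -/
structure SmallMoments (χ : A →ₗ[ℂ] ℂ) (X : ℝ → A) (c : ℝ) : Prop where
  one : (fun h => χ (X h) - ((c * h : ℝ) : ℂ)) =o[𝓝[>] 0] (id : ℝ → ℝ)
  two : (fun h => χ (X h ^ 2) - (h : ℂ)) =o[𝓝[>] 0] (id : ℝ → ℝ)
  higher : ∀ n, 2 < n → (fun h => χ (X h ^ n)) =o[𝓝[>] 0] (id : ℝ → ℝ)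

lemma IsTwoStateFBM.freeCumulant_isBigO (hT : 0 < T) (hX : IsTwoStateFBM φ ψ α T X) {k : ℕ}
    (hk : 1 ≤ k) :
    (fun h => freeCumulant (fun n => ψ (X h ^ n)) k) =O[𝓝[>] 0] (id : ℝ → ℝ) := by
  have hev := eventually_mem_Ioc hT
  rcases lt_trichotomy k 2 with h | rfl | h
  · obtain rfl : k = 1 := by omega
    refine (ofReal_mul_isBigO α).congr' ?_ EventuallyEq.rfl
    filter_upwards [hev] with h hh using (hX.psi_one h ⟨hh.1.le, hh.2⟩).symm
  · refine (ofReal_mul_isBigO 1).congr' ?_ EventuallyEq.rfl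
    filter_upwards [hev] with h hh
    have := hX.psi_two h ⟨hh.1.le, hh.2⟩
    simp only [elemFreeCumulant] at this
    simp [this]
  · refine (Asymptotics.isBigO_zero (id : ℝ → ℝ) _).congr' ?_ EventuallyEq.rfl
    filter_upwards [hev] with t ht using (hX.psi_higher t ⟨ht.1.le, ht.2⟩ k h).symm

lemma IsTwoStateFBM.smallMoments_psi (hT : 0 < T) (hX : IsTwoStateFBM φ ψ α T X) :
    SmallMoments ψ X α := by
  have hev := eventually_mem_Ioc hT
  have key : ∀ n, 1 ≤ n → _ := fun n hn => moment_sub_freeCumulant_isLittleO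
    (fun h k => ψ (X h ^ k)) hn fun k hk => hX.freeCumulant_isBigO hT hk
  refine ⟨(key 1 le_rfl).congr' ?_ EventuallyEq.rfl, (key 2 (by norm_num)).congr' ?_
    EventuallyEq.rfl, fun n hn => (key n (by omega)).congr' ?_ EventuallyEq.rfl⟩
  · filter_upwards [hev] with h hh
    have := hX.psi_one h ⟨hh.1.le, hh.2⟩
    simp only [elemFreeCumulant] at this
    simp [this]
  · filter_upwards [hev] with h hh
    have := hX.psi_two h ⟨hh.1.le, hh.2⟩
    simp only [elemFreeCumulant] at this
    simp [this]
  · filter_upwards [hev] with h hh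
    have := hX.psi_higher h ⟨hh.1.le, hh.2⟩ n hn
    simp only [elemFreeCumulant] at this
    simp [this]

lemma IsTwoStateFBM.smallMoments_phi (hT : 0 < T) (hX : IsTwoStateFBM φ ψ α T X) :
    SmallMoments φ X 0 := by
  have hev := eventually_mem_Ioc hT
  have h1 : ∀ᶠ h in 𝓝[>] (0 : ℝ), φ (X h) = 0 := by
    filter_upwards [hev] with h hh using hX.centered h ⟨hh.1.le, hh.2⟩
  have h2 : ∀ᶠ h in 𝓝[>] (0 : ℝ), φ (X h ^ 2) = (h : ℂ) := by
    filter_upwards [hev] with h hh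
    simpa [hX.zero] using hX.variance 0 h le_rfl hh.1.le hh.2
  have h3 : ∀ n, 2 < n → ∀ᶠ h in 𝓝[>] (0 : ℝ),
      twoStateCumulant (fun k => φ (X h ^ k)) (fun k => ψ (X h ^ k)) n = 0 := fun n hn => by
    filter_upwards [hev] with h hh
    simpa [hX.zero, elemTwoStateCumulant] using hX.normal 0 h le_rfl hh.1.le hh.2 n hn
  have key : ∀ n, 1 ≤ n → _ := fun n hn => moment_sub_twoStateCumulant_isLittleO
    (fun h k => φ (X h ^ k)) (fun h k => ψ (X h ^ k)) hn (hm' := fun k hk =>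
      hX.freeCumulant_isBigO hT hk)
  -- For φ the first two orders are given as moments (mean 0, variance h), not as cumulants, so the
  -- bounds on those two cumulants are read off backwards.
  have r1 : (fun h => twoStateCumulant (fun k => φ (X h ^ k)) (fun k => ψ (X h ^ k)) 1)
      =O[𝓝[>] 0] (id : ℝ → ℝ) := by
    refine ((key 1 le_rfl fun k hk hk' => by omega).isBigO.neg_left).congr' ?_ EventuallyEq.rfl
    filter_upwards [h1] with h hh
    simp [hh]
  have r2 : (fun h => twoStateCumulant (fun k => φ (X h ^ k)) (fun k => ψ (X h ^ k)) 2)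
      =O[𝓝[>] 0] (id : ℝ → ℝ) := by
    refine ((ofReal_mul_isBigO 1).sub (key 2 (by norm_num) fun k hk hk' => ?_).isBigO).congr' ?_
      EventuallyEq.rfl
    · obtain rfl : k = 1 := by omega
      exact r1
    · filter_upwards [h2] with h hh
      simp [hh]
  have r : ∀ k, 1 ≤ k →
      (fun h => twoStateCumulant (fun k => φ (X h ^ k)) (fun k => ψ (X h ^ k)) k)
        =O[𝓝[>] 0] (id : ℝ → ℝ) := fun k hk => by
    rcases lt_trichotomy k 2 with h | rfl | h
    · obtain rfl : k = 1 := by omega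
      exact r1
    · exact r2
    · refine (Asymptotics.isBigO_zero (id : ℝ → ℝ) _).congr' ?_ EventuallyEq.rfl
      filter_upwards [h3 k h] with t ht using ht.symm
  refine ⟨(Asymptotics.isLittleO_zero (id : ℝ → ℝ) _).congr' ?_ EventuallyEq.rfl,
    (Asymptotics.isLittleO_zero (id : ℝ → ℝ) _).congr' ?_ EventuallyEq.rfl,
    fun n hn => (key n (by omega) fun k hk _ => r k hk).congr' ?_ EventuallyEq.rfl⟩
  · filter_upwards [h1] with h hh
    simp [hh]
  · filter_upwards [h2] with h hh
    simp [hh]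
  · filter_upwards [h3 n hn] with h hh
    simp [hh]

end

/-! ### The orthogonal polynomials -/

open Polynomial in
/-- The monic polynomials with constant Jacobi parameters `a`, `b`. -/
noncomputable def polyU (a b : ℝ) : ℕ → ℝ[X]
  | 0 => 1
  | 1 => X - C a
  | n + 2 => (X - C a) * polyU a b (n + 1) - C b * polyU a b n

open Polynomial in
/-- The monic polynomials with Jacobi parameters `0, a, a, …` and `b, b, …`. -/
noncomputable def polyQ (a b : ℝ) : ℕ → ℝ[X]
  | 0 => 1
  | 1 => X
  | n + 2 => (X - C a) * polyQ a b (n + 1) - C b * polyQ a b n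

/-- Both sides obey the same recursion. In generating functions this says that passing from `polyU`
to `polyQ` is multiplication by 1 + az, the normalization that produces martingales. -/
lemma polyQ_succ (a b : ℝ) (n : ℕ) :
    polyQ a b (n + 1) = polyU a b (n + 1) + Polynomial.C a * polyU a b n := by
  induction n using Nat.strong_induction_on with
  | _ n ih =>
    match n with
    | 0 => simp [polyQ, polyU]
    | 1 => simp [polyQ, polyU]; ring
    | n + 2 =>
      have h3 : polyU a b (n + 3) = (Polynomial.X - Polynomial.C a) * polyU a b (n + 2)
          - Polynomial.C b * polyU a b (n + 1) := by rw [polyU]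
      have h2 : polyU a b (n + 2) = (Polynomial.X - Polynomial.C a) * polyU a b (n + 1)
          - Polynomial.C b * polyU a b n := by rw [polyU]
      rw [polyQ, ih (n + 1) (by omega), ih n (by omega), h3, h2]
      ring

lemma polyQ_monic_degree (a b : ℝ) (n : ℕ) :
    (polyQ a b n).Monic ∧ (polyQ a b n).natDegree = n := by
  induction n using Nat.strong_induction_on with
  | _ n ih =>
    match n with
    | 0 => simp [polyQ]
    | 1 => simp [polyQ, Polynomial.monic_X]
    | n + 2 =>
      obtain ⟨h1, h1'⟩ := ih (n + 1) (by omega)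
      obtain ⟨h2, h2'⟩ := ih n (by omega)
      have h3 : ((Polynomial.X - Polynomial.C a) * polyQ a b (n + 1)).Monic :=
        (Polynomial.monic_X_sub_C a).mul h1
      have h4 : ((Polynomial.X - Polynomial.C a) * polyQ a b (n + 1)).natDegree = n + 2 := by
        rw [(Polynomial.monic_X_sub_C a).natDegree_mul h1, h1', Polynomial.natDegree_X_sub_C]
        omega
      have h5 : (Polynomial.C b * polyQ a b n).degree <
          ((Polynomial.X - Polynomial.C a) * polyQ a b (n + 1)).degree := by
        rw [Polynomial.degree_eq_natDegree h3.ne_zero, h4]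
        rw [← Polynomial.smul_eq_C_mul]
        refine (Polynomial.degree_smul_le b _).trans_lt ?_
        rw [Polynomial.degree_eq_natDegree h2.ne_zero, h2']
        exact_mod_cast (by omega : n < n + 2)
      rw [polyQ]
      exact ⟨h3.sub_of_left h5, (Polynomial.natDegree_eq_of_degree_eq
        (Polynomial.degree_sub_eq_left_of_degree_lt h5)).trans h4⟩

/-- The polynomials `polyQ` form a sequence of increasing degrees. -/
noncomputable def seqQ (a b : ℝ) : Polynomial.Sequence ℝ where
  elems' := polyQ a b
  degree_eq' n := by
    obtain ⟨h1, h2⟩ := polyQ_monic_degree a b n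
    rw [Polynomial.degree_eq_natDegree h1.ne_zero, h2]

/-- The basis of the space of polynomials which consists of the `polyQ`. -/
noncomputable def basisQ (a b : ℝ) : Module.Basis ℕ ℝ (Polynomial ℝ) :=
  (seqQ a b).basis fun i => by
    have : (seqQ a b i) = polyQ a b i := rfl
    rw [this, (polyQ_monic_degree a b i).1.leadingCoeff]
    exact isUnit_one

lemma basisQ_apply (a b : ℝ) (n : ℕ) : basisQ a b n = polyQ a b n :=
  Polynomial.Sequence.basis_eq_self _ _ n

/-- The transition operator from time `t` to time `s` on polynomials. -/
noncomputable def transOp (α s t : ℝ) : Polynomial ℝ →ₗ[ℝ] Polynomial ℝ :=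
  (basisQ (α * t) t).constr ℝ fun n => polyQ (α * s) s n

lemma transOp_polyQ (α s t : ℝ) (n : ℕ) :
    transOp α s t (polyQ (α * t) t n) = polyQ (α * s) s n := by
  rw [← basisQ_apply, transOp, Module.Basis.constr_basis]

lemma polyQ_ext {M : Type*} [AddCommGroup M] [Module ℝ M] (a b : ℝ)
    {f g : Polynomial ℝ →ₗ[ℝ] M} (h : ∀ n, f (polyQ a b n) = g (polyQ a b n)) : f = g :=
  (basisQ a b).ext fun n => by rw [basisQ_apply, h]

lemma transOp_comp (α r s t : ℝ) (p : Polynomial ℝ) :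
    transOp α r s (transOp α s t p) = transOp α r t p := by
  have : transOp α r s ∘ₗ transOp α s t = transOp α r t :=
    polyQ_ext (α * t) t fun n => by simp [transOp_polyQ]
  exact LinearMap.congr_fun this p

/-! ### Generating functions -/

section Series

variable {R : Type*} [Ring R] [Algebra ℝ R]

/-- The generating function of the `polyU`. -/
noncomputable def serU (a b : ℝ) (x : R) : PowerSeries R :=
  PowerSeries.mk fun n => Polynomial.aeval x (polyU a b n)

/-- The inverse of the generating function of the `polyU`. -/
noncomputable def serE (a b : ℝ) (x : R) : PowerSeries R :=
  1 - PowerSeries.X * (PowerSeries.C (x - algebraMap ℝ R a)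
    - PowerSeries.X * PowerSeries.C (algebraMap ℝ R b))

lemma coeff_serU (a b : ℝ) (x : R) (n : ℕ) :
    PowerSeries.coeff n (serU a b x) = Polynomial.aeval x (polyU a b n) := by
  simp [serU]

lemma serE_mul (a b : ℝ) (x : R) (f : PowerSeries R) :
    serE a b x * f = f - PowerSeries.X * (PowerSeries.C (x - algebraMap ℝ R a) * f)
      + PowerSeries.X * (PowerSeries.X * (PowerSeries.C (algebraMap ℝ R b) * f)) := by
  rw [serE]
  noncomm_ring

lemma mul_serE (a b : ℝ) (x : R) (f : PowerSeries R) :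
    f * serE a b x = f - PowerSeries.X * (f * PowerSeries.C (x - algebraMap ℝ R a))
      + PowerSeries.X * (PowerSeries.X * (f * PowerSeries.C (algebraMap ℝ R b))) := by
  rw [serE, mul_sub, mul_one, ← mul_assoc, ← PowerSeries.X_mul, mul_sub, mul_assoc,
    mul_assoc PowerSeries.X f, ← mul_assoc f PowerSeries.X, ← PowerSeries.X_mul]
  noncomm_ring

lemma serE_mul_serU (a b : ℝ) (x : R) : serE a b x * serU a b x = 1 := by
  rw [serE_mul]
  ext n
  match n with
  | 0 => simp [serU, polyU]
  | 1 => simp [serU, polyU, PowerSeries.coeff_one, PowerSeries.coeff_succ_X_mul]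
  | n + 2 =>
    rw [map_add, map_sub, PowerSeries.coeff_succ_X_mul, PowerSeries.coeff_C_mul,
      PowerSeries.coeff_succ_X_mul, PowerSeries.coeff_succ_X_mul, PowerSeries.coeff_C_mul]
    simp only [coeff_serU]
    simp [polyU, PowerSeries.coeff_one]

lemma serU_mul_serE (a b : ℝ) (x : R) : serU a b x * serE a b x = 1 := by
  have hc : ∀ n, Polynomial.aeval x (polyU a b n) * (x - algebraMap ℝ R a) =
      (x - algebraMap ℝ R a) * Polynomial.aeval x (polyU a b n) := fun n => by
    have : x - algebraMap ℝ R a = Polynomial.aeval x (Polynomial.X - Polynomial.C a) := by simp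
    rw [this, ← map_mul, ← map_mul, mul_comm]
  have hb : ∀ n, Polynomial.aeval x (polyU a b n) * algebraMap ℝ R b =
      algebraMap ℝ R b * Polynomial.aeval x (polyU a b n) := fun n =>
    (Algebra.commutes b _).symm
  rw [← serE_mul_serU a b x, serE_mul, mul_serE]
  congr 2
  · congr 1
    ext n
    rw [PowerSeries.coeff_mul_C, PowerSeries.coeff_C_mul, coeff_serU, hc]
  · congr 1
    ext n
    rw [PowerSeries.coeff_mul_C, PowerSeries.coeff_C_mul, coeff_serU, hb]

/-- The reciprocal of the generating function is affine in the parameters and the variable, which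
linearizes the addition of noncommuting elements. -/
lemma serE_add (a b a' b' : ℝ) (x y : R) :
    serE (a + a') (b + b') (x + y) = serE a b x + serE a' b' y - 1 := by
  simp only [serE, map_add, map_sub]
  noncomm_ring

/-- The part of the generating function of the `polyU` at `x + y` which starts with `y`. -/
noncomputable def serT (a b a' b' : ℝ) (x y : R) : PowerSeries R :=
  serE a b x * serU (a + a') (b + b') (x + y) - 1

lemma serU_add (a b a' b' : ℝ) (x y : R) :
    serU (a + a') (b + b') (x + y) = serU a b x * (1 + serT a b a' b' x y) := by
  rw [serT, add_sub_cancel, ← mul_assoc, serU_mul_serE, one_mul]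

/-- Iterating this fixed-point equation expands `serT` into products alternating between `serU a' b'
y - 1` and `serU a b x - 1`. Both have zero constant term, so each coefficient depends only on
earlier ones. -/
lemma serT_eq (a b a' b' : ℝ) (x y : R) :
    serT a b a' b' x y =
      (serU a' b' y - 1) * (1 + (serU a b x - 1) * (1 + serT a b a' b' x y)) := by
  have h := serE_mul_serU (a + a') (b + b') (x + y)
  rw [serE_add] at h
  set D := serU (a + a') (b + b') (x + y)
  have hT : serT a b a' b' x y = serE a b x * D - 1 := rfl
  have h1 : serE a b x * D = 1 - serE a' b' y * D + D := by
    rw [← h]; noncomm_ring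
  have h2 : (serU a b x - 1) * (1 + serT a b a' b' x y) = D - serE a b x * D := by
    rw [hT, add_sub_cancel, sub_mul, ← mul_assoc, serU_mul_serE, one_mul, one_mul]
  rw [h2]
  have h3 : 1 + (D - serE a b x * D) = serE a' b' y * D := by rw [h1]; noncomm_ring
  rw [h3, sub_mul, ← mul_assoc, serU_mul_serE, one_mul, one_mul, hT, h1]
  noncomm_ring

end Series

/-! ### Small-time asymptotics of the polynomials -/

section Small

variable {A : Type*} [Ring A] [Algebra ℂ A] {χ : A →ₗ[ℂ] ℂ} {α c : ℝ} {X : ℝ → A}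

lemma map_algebraMap_mul (χ : A →ₗ[ℂ] ℂ) (r : ℝ) (a : A) :
    χ (algebraMap ℝ A r * a) = (r : ℂ) * χ a := by
  rw [IsScalarTower.algebraMap_apply ℝ ℂ A, ← Algebra.smul_def, map_smul]
  simp

lemma map_aeval_polyU_step (χ : A →ₗ[ℂ] ℂ) (a b : ℝ) (x : A) (k n : ℕ) :
    χ (x ^ k * Polynomial.aeval x (polyU a b (n + 2))) =
      χ (x ^ (k + 1) * Polynomial.aeval x (polyU a b (n + 1)))
        - a * χ (x ^ k * Polynomial.aeval x (polyU a b (n + 1)))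
        - b * χ (x ^ k * Polynomial.aeval x (polyU a b n)) := by
  have e : x ^ k * Polynomial.aeval x (polyU a b (n + 2)) =
      x ^ (k + 1) * Polynomial.aeval x (polyU a b (n + 1))
        - algebraMap ℝ A a * (x ^ k * Polynomial.aeval x (polyU a b (n + 1)))
        - algebraMap ℝ A b * (x ^ k * Polynomial.aeval x (polyU a b n)) := by
    rw [polyU]
    simp only [map_sub, map_mul, Polynomial.aeval_X, Polynomial.aeval_C]
    simp only [mul_sub, sub_mul, mul_assoc, pow_succ, Algebra.left_comm]
  rw [e, map_sub, map_sub, map_algebraMap_mul, map_algebraMap_mul]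

lemma ofReal_isBigO : (fun h : ℝ => (h : ℂ)) =O[𝓝[>] 0] (id : ℝ → ℝ) := by
  simpa using ofReal_mul_isBigO 1

lemma tendsto_of_isBigO_id {f : ℝ → ℂ} (hf : f =O[𝓝[>] 0] (id : ℝ → ℝ)) :
    f =o[𝓝[>] 0] (fun _ => (1 : ℝ)) :=
  hf.trans_isLittleO
    ((Asymptotics.isLittleO_one_iff ℝ).2 (tendsto_nhdsWithin_of_tendsto_nhds tendsto_id))

lemma isBigO_mul_isLittleO_one {f g : ℝ → ℂ} (hf : f =O[𝓝[>] 0] (id : ℝ → ℝ))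
    (hg : g =o[𝓝[>] 0] (fun _ => (1 : ℝ))) :
    (fun h => f h * g h) =o[𝓝[>] 0] (id : ℝ → ℝ) := by
  simpa [Function.id_def] using hf.mul_isLittleO hg

lemma id_isLittleO_one : (id : ℝ → ℝ) =o[𝓝[>] 0] (fun _ => (1 : ℝ)) :=
  (Asymptotics.isLittleO_one_iff ℝ).2 (tendsto_nhdsWithin_of_tendsto_nhds tendsto_id)

lemma SmallMoments.isBigO (hχ : SmallMoments χ X c) {n : ℕ} (hn : 1 ≤ n) :
    (fun h => χ (X h ^ n)) =O[𝓝[>] 0] (id : ℝ → ℝ) := by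
  rcases lt_trichotomy n 2 with h | rfl | h
  · obtain rfl : n = 1 := by omega
    simpa using hχ.one.isBigO.add (ofReal_mul_isBigO c)
  · simpa using hχ.two.isBigO.add ofReal_isBigO
  · exact (hχ.higher n h).isBigO

/-- Each correction to the leading power carries a factor αh or h. The factor `X h ^ k` with k ≥ 1
makes the accompanying expectation O(h) as well. -/
lemma SmallMoments.pow_mul_polyU (hχ : SmallMoments χ X c) (n : ℕ) :
    ∀ k, 1 ≤ k →
      (fun h => χ (X h ^ k * Polynomial.aeval (X h) (polyU (α * h) h n)) - χ (X h ^ (k + n)))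
        =o[𝓝[>] 0] (id : ℝ → ℝ) := by
  induction n using Nat.strong_induction_on with
  | _ n ih =>
    intro k hk
    have hO : ∀ m, m < n → (fun h => χ (X h ^ k * Polynomial.aeval (X h) (polyU (α * h) h m)))
        =O[𝓝[>] 0] (id : ℝ → ℝ) := fun m hm => by
      simpa using (ih m hm k hk).isBigO.add (hχ.isBigO (n := k + m) (by omega))
    match n with
    | 0 => simp [polyU]
    | 1 =>
      have h1 := (isBigO_mul_isLittleO_one (ofReal_mul_isBigO α)
        (tendsto_of_isBigO_id (hO 0 (by omega)))).neg_left
      refine h1.congr_left fun h => ?_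
      have e : X h ^ k * Polynomial.aeval (X h) (polyU (α * h) h 1) =
          X h ^ (k + 1) - algebraMap ℝ A (α * h) * X h ^ k := by
        rw [polyU, Algebra.commutes]
        simp only [map_sub, Polynomial.aeval_X, Polynomial.aeval_C, mul_sub, pow_succ]
      rw [e, map_sub, map_algebraMap_mul]
      simp [polyU]
    | n + 2 =>
      have h1 := isBigO_mul_isLittleO_one (ofReal_mul_isBigO α)
        (tendsto_of_isBigO_id (hO (n + 1) (by omega)))
      have h2 := isBigO_mul_isLittleO_one ofReal_isBigO
        (tendsto_of_isBigO_id (hO n (by omega)))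
      have h3 := ih (n + 1) (by omega) (k + 1) (by omega)
      refine ((h3.sub h1).sub h2).congr_left fun h => ?_
      rw [map_aeval_polyU_step, show k + 1 + (n + 1) = k + (n + 2) by ring]
      ring

lemma SmallMoments.polyU_one (hχ : SmallMoments χ X c) (h1 : χ 1 = 1) :
    (fun h => χ (Polynomial.aeval (X h) (polyU (α * h) h 1)) - (((c - α) * h : ℝ) : ℂ))
      =o[𝓝[>] 0] (id : ℝ → ℝ) := by
  refine hχ.one.congr_left fun h => ?_
  have : χ (algebraMap ℝ A (α * h)) = ((α * h : ℝ) : ℂ) := by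
    simpa [h1] using map_algebraMap_mul χ (α * h) 1
  simp only [polyU, map_sub, Polynomial.aeval_X, Polynomial.aeval_C, this]
  push_cast
  ring

lemma SmallMoments.polyU_add_two (hχ : SmallMoments χ X c) (h1 : χ 1 = 1) (n : ℕ) :
    (fun h => χ (Polynomial.aeval (X h) (polyU (α * h) h (n + 2))))
      =o[𝓝[>] 0] (id : ℝ → ℝ) := by
  have hstep : ∀ m h, χ (Polynomial.aeval (X h) (polyU (α * h) h (m + 2))) =
      χ (X h ^ 1 * Polynomial.aeval (X h) (polyU (α * h) h (m + 1)))
        - (α * h : ℝ) * χ (Polynomial.aeval (X h) (polyU (α * h) h (m + 1)))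
        - (h : ℝ) * χ (Polynomial.aeval (X h) (polyU (α * h) h m)) := fun m h => by
    simpa using map_aeval_polyU_step χ (α * h) h (X h) 0 m
  have hU1 : (fun h => χ (Polynomial.aeval (X h) (polyU (α * h) h 1)))
      =o[𝓝[>] 0] (fun _ => (1 : ℝ)) := by
    have := (hχ.polyU_one (α := α) h1).isBigO.add (ofReal_mul_isBigO (c - α))
    exact tendsto_of_isBigO_id (by simpa using this)
  induction n using Nat.strong_induction_on with
  | _ n ih =>
    have hprev : (fun h => χ (Polynomial.aeval (X h) (polyU (α * h) h (n + 1))))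
        =o[𝓝[>] 0] (fun _ => (1 : ℝ)) := by
      match n with
      | 0 => exact hU1
      | n + 1 => exact (ih n (by omega)).trans id_isLittleO_one
    have h2 := isBigO_mul_isLittleO_one (ofReal_mul_isBigO α) hprev
    have h3 := hχ.pow_mul_polyU (α := α) (n + 1) 1 le_rfl
    match n with
    | 0 =>
      -- The degree-two polynomial is the only one needing a cancellation: the second moment, h up
      -- to o(h), against the term h · χ 1. In higher degrees every term is already o(h).
      refine ((h3.add hχ.two).sub h2).congr_left fun h => ?_
      rw [hstep]
      simp [polyU, h1]
      ring
    | n + 1 =>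
      have hprev' : (fun h => χ (Polynomial.aeval (X h) (polyU (α * h) h (n + 1))))
          =o[𝓝[>] 0] (fun _ => (1 : ℝ)) := by
        match n with
        | 0 => exact hU1
        | n + 1 => exact (ih n (by omega)).trans id_isLittleO_one
      have h4 := isBigO_mul_isLittleO_one ofReal_isBigO hprev'
      refine (((h3.add (hχ.higher (1 + (n + 1 + 1)) (by omega))).sub h2).sub h4).congr_left
        fun h => ?_
      rw [hstep (n + 1)]
      ring

end Small

/-! ### Alternating words in two-state free subalgebras -/

section Words

variable {A : Type*} [Ring A] [Algebra ℂ A] {ι : Type*}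

/-- Alternating products of centered elements of the subalgebras `S i` with `p i`; the index is
that of the first factor. -/
inductive AltWord (ψ : A →ₗ[ℂ] ℂ) (S : ι → Subalgebra ℂ A) (p : ι → Prop) : ι → A → Prop
  | single {i : ι} {a : A} : p i → a ∈ S i → ψ a = 0 → AltWord ψ S p i a
  | cons {i j : ι} {a w : A} : p i → a ∈ S i → ψ a = 0 → i ≠ j → AltWord ψ S p j w →
      AltWord ψ S p i (a * w)

variable {φ ψ : A →ₗ[ℂ] ℂ} {S : ι → Subalgebra ℂ A} {p q : ι → Prop} {ℓ : ι}

lemma AltWord.letter {i : ι} {w : A} (h : AltWord ψ S p i w) : p i := by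
  cases h <;> assumption

lemma AltWord.mono (hpq : ∀ i, p i → q i) {i : ι} {w : A} (h : AltWord ψ S p i w) :
    AltWord ψ S q i w := by
  induction h with
  | single h1 h2 h3 => exact .single (hpq _ h1) h2 h3
  | cons h1 h2 h3 h4 _ ih => exact .cons (hpq _ h1) h2 h3 h4 ih

lemma AltWord.exists_list {i : ι} {w : A} (h : AltWord ψ S p i w) :
    ∃ (n : ℕ) (k : Fin (n + 1) → ι) (a : Fin (n + 1) → A), k 0 = i ∧
      (∀ j : Fin n, k j.castSucc ≠ k j.succ) ∧ (∀ j, a j ∈ S (k j)) ∧ (∀ j, ψ (a j) = 0) ∧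
      (List.ofFn a).prod = w := by
  induction h with
  | @single i a h1 h2 h3 =>
    exact ⟨0, fun _ => i, fun _ => a, rfl, fun j => j.elim0, fun _ => h2, fun _ => h3, by simp⟩
  | @cons i j a w h1 h2 h3 h4 _ ih =>
    obtain ⟨n, k, b, hk, halt, hmem, hcen, hprod⟩ := ih
    refine ⟨n + 1, Fin.cons i k, Fin.cons a b, rfl, fun j => ?_, fun j => ?_, fun j => ?_, ?_⟩
    · refine Fin.cases ?_ (fun j => ?_) j
      · simpa [hk] using h4
      · simpa using halt j
    · refine Fin.cases ?_ (fun j => ?_) j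
      · simpa using h2
      · simpa using hmem j
    · refine Fin.cases ?_ (fun j => ?_) j
      · simpa using h3
      · simpa using hcen j
    · rw [List.ofFn_cons, List.prod_cons, hprod]

lemma AltWord.psi_eq_zero (hS : TwoStateFreelyIndependent φ ψ S) {i : ι} {w : A}
    (h : AltWord ψ S p i w) : ψ w = 0 := by
  obtain ⟨n, k, a, -, h1, h2, h3, rfl⟩ := h.exists_list
  exact (hS n k a h1 h2 h3).1

/-- Freeness factorizes both the word and its tail completely; comparing the two factorizations
splits off the first letter. -/
lemma AltWord.phi_mul (hS : TwoStateFreelyIndependent φ ψ S) {i j : ι} {a w : A} (ha : a ∈ S i)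
    (ha0 : ψ a = 0) (hij : i ≠ j) (h : AltWord ψ S p j w) : φ (a * w) = φ a * φ w := by
  obtain ⟨n, k, b, hk, h1, h2, h3, rfl⟩ := h.exists_list
  have := (hS (n + 1) (Fin.cons i k) (Fin.cons a b)
    (fun j => Fin.cases (by simpa [hk] using hij) (fun j => by simpa using h1 j) j)
    (fun j => Fin.cases (by simpa using ha) (fun j => by simpa using h2 j) j)
    (fun j => Fin.cases (by simpa using ha0) (fun j => by simpa using h3 j) j)).2
  rw [List.ofFn_cons, List.prod_cons, Fin.prod_univ_succ] at this
  rw [this, (hS n k b h1 h2 h3).2]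
  simp

/-- The span of the alternating words whose first index satisfies `q`. -/
def wordSpan (ψ : A →ₗ[ℂ] ℂ) (S : ι → Subalgebra ℂ A) (p q : ι → Prop) : Submodule ℂ A :=
  Submodule.span ℂ {w | ∃ i, q i ∧ AltWord ψ S p i w}

lemma AltWord.mem_wordSpan {i : ι} {w : A} (hi : q i) (h : AltWord ψ S p i w) :
    w ∈ wordSpan ψ S p q :=
  Submodule.subset_span ⟨i, hi, h⟩

lemma psi_of_mem_wordSpan (hS : TwoStateFreelyIndependent φ ψ S) {w : A}
    (h : w ∈ wordSpan ψ S p q) : ψ w = 0 := by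
  have : wordSpan ψ S p q ≤ LinearMap.ker ψ :=
    Submodule.span_le.2 fun w ⟨i, _, hw⟩ => hw.psi_eq_zero hS
  exact this h

/-- A word without letters from `S ℓ` ends outside `S ℓ`, so the product remains alternating at the
junction. -/
lemma AltWord.mul_of_ne (hS : TwoStateFreelyIndependent φ ψ S) {i : ι} {w r : A}
    (h : AltWord ψ S (· ≠ ℓ) i w) (hr : AltWord ψ S (fun _ => True) ℓ r) :
    AltWord ψ S (fun _ => True) i (w * r) ∧ φ (w * r) = φ w * φ r := by
  induction h with
  | single h1 h2 h3 => exact ⟨.cons trivial h2 h3 h1 hr, AltWord.phi_mul hS h2 h3 h1 hr⟩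
  | cons h1 h2 h3 h4 h5 ih =>
    rw [mul_assoc]
    refine ⟨.cons trivial h2 h3 h4 ih.1, ?_⟩
    rw [AltWord.phi_mul hS h2 h3 h4 ih.1, AltWord.phi_mul hS h2 h3 h4 h5, ih.2, mul_assoc]

lemma mul_mem_wordSpan_aux {P Q R : Submodule ℂ A} {s t : Set A}
    (hP : P = Submodule.span ℂ s) (hQ : Q = Submodule.span ℂ t)
    (h : ∀ a ∈ s, ∀ b ∈ t, a * b ∈ R ∧ φ (a * b) = φ a * φ b) {a b : A} (ha : a ∈ P)
    (hb : b ∈ Q) : a * b ∈ R ∧ φ (a * b) = φ a * φ b := by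
  subst hP hQ
  induction ha, hb using Submodule.span_induction₂ with
  | mem_mem x y hx hy => exact h x hx y hy
  | zero_left y hy => simp
  | zero_right x hx => simp
  | add_left x y z _ _ _ h1 h2 =>
    rw [add_mul, map_add, map_add, add_mul, h1.2, h2.2]
    exact ⟨R.add_mem h1.1 h2.1, rfl⟩
  | add_right x y z _ _ _ h1 h2 =>
    rw [mul_add, map_add, map_add, mul_add, h1.2, h2.2]
    exact ⟨R.add_mem h1.1 h2.1, rfl⟩
  | smul_left r x y _ _ h1 =>
    rw [smul_mul_assoc, map_smul, map_smul, h1.2, smul_mul_assoc]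
    exact ⟨R.smul_mem r h1.1, rfl⟩
  | smul_right r x y _ _ h1 =>
    rw [mul_smul_comm, map_smul, map_smul, h1.2, mul_smul_comm]
    exact ⟨R.smul_mem r h1.1, rfl⟩

/-- The words starting in `S ℓ`. -/
abbrev startSpan (ψ : A →ₗ[ℂ] ℂ) (S : ι → Subalgebra ℂ A) (ℓ : ι) : Submodule ℂ A :=
  wordSpan ψ S (fun _ => True) (· = ℓ)

/-- The words not starting in `S ℓ`. -/
abbrev otherSpan (ψ : A →ₗ[ℂ] ℂ) (S : ι → Subalgebra ℂ A) (ℓ : ι) : Submodule ℂ A :=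
  wordSpan ψ S (fun _ => True) (· ≠ ℓ)

/-- The algebra generated by the subalgebras other than `S ℓ`. -/
def otherAlg (S : ι → Subalgebra ℂ A) (ℓ : ι) : Subalgebra ℂ A :=
  Algebra.adjoin ℂ {a | ∃ i, i ≠ ℓ ∧ a ∈ S i}

lemma centered_mem (h1 : ψ 1 = 1) {i : ι} {a : A} (ha : a ∈ S i) :
    a - algebraMap ℂ A (ψ a) ∈ S i ∧ ψ (a - algebraMap ℂ A (ψ a)) = 0 := by
  refine ⟨(S i).sub_mem ha ((S i).algebraMap_mem _), ?_⟩
  rw [map_sub, Algebra.algebraMap_eq_smul_one, map_smul, h1]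
  simp

/-- Constants plus words in the subalgebras other than `S ℓ`. -/
abbrev constSpan (ψ : A →ₗ[ℂ] ℂ) (S : ι → Subalgebra ℂ A) (ℓ : ι) : Submodule ℂ A :=
  Submodule.span ℂ {1} ⊔ wordSpan ψ S (· ≠ ℓ) (· ≠ ℓ)

lemma algebraMap_mem_constSpan (c : ℂ) : algebraMap ℂ A c ∈ constSpan ψ S ℓ := by
  rw [Algebra.algebraMap_eq_smul_one]
  exact Submodule.smul_mem _ c (Submodule.mem_sup_left (Submodule.mem_span_singleton_self 1))

lemma mem_constSpan_of_mem (h1 : ψ 1 = 1) {i : ι} {a : A} (hi : i ≠ ℓ) (ha : a ∈ S i) :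
    a ∈ constSpan ψ S ℓ := by
  have h := centered_mem h1 ha
  rw [← sub_add_cancel a (algebraMap ℂ A (ψ a))]
  exact Submodule.add_mem _ (Submodule.mem_sup_right
    (AltWord.mem_wordSpan hi (.single hi h.1 h.2))) (algebraMap_mem_constSpan _)

lemma mul_word_mem_constSpan (h1 : ψ 1 = 1) {i j : ι} {a w : A} (hi : i ≠ ℓ) (ha : a ∈ S i)
    (hij : i ≠ j) (hw : AltWord ψ S (· ≠ ℓ) j w) : a * w ∈ constSpan ψ S ℓ := by
  have h := centered_mem h1 ha
  have e : a * w = (a - algebraMap ℂ A (ψ a)) * w + ψ a • w := by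
    rw [sub_mul, Algebra.smul_def, sub_add_cancel]
  rw [e]
  exact Submodule.mem_sup_right (Submodule.add_mem _
    (AltWord.mem_wordSpan hi (.cons hi h.1 h.2 hij hw))
    (Submodule.smul_mem _ _ (hw.mem_wordSpan hw.letter)))

/-- The new letter is either prepended or merged with the first letter from the same subalgebra.
Centering the result leaves a word, a shorter word, or a constant. -/
lemma mul_mem_constSpan (h1 : ψ 1 = 1) {i : ι} {a w : A} (hi : i ≠ ℓ) (ha : a ∈ S i)
    (hw : w ∈ constSpan ψ S ℓ) : a * w ∈ constSpan ψ S ℓ := by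
  have hle : constSpan ψ S ℓ ≤ (constSpan ψ S ℓ).comap (LinearMap.mulLeft ℂ a) := by
    refine sup_le ?_ ?_
    · rw [Submodule.span_le, Set.singleton_subset_iff]
      simpa using mem_constSpan_of_mem h1 hi ha
    · refine Submodule.span_le.2 fun w ⟨j, hj, hw⟩ => ?_
      simp only [SetLike.mem_coe, Submodule.mem_comap, LinearMap.mulLeft_apply]
      by_cases hij : i = j
      · subst hij
        cases hw with
        | single h2 h3 h4 => exact mem_constSpan_of_mem h1 hi ((S i).mul_mem ha h3)
        | cons h2 h3 h4 h5 h6 =>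
          rw [← mul_assoc]
          exact mul_word_mem_constSpan h1 hi ((S i).mul_mem ha h3) h5 h6
      · exact mul_word_mem_constSpan h1 hi ha hij hw
  exact hle hw

/-- Stability under left multiplication by generators extends to the whole algebra and is then
applied to 1. This is the step that makes the generated algebra as a whole free from `S ℓ`. -/
lemma mem_constSpan_of_mem_otherAlg (h1 : ψ 1 = 1) {b : A} (hb : b ∈ otherAlg S ℓ) :
    b ∈ constSpan ψ S ℓ := by
  have key : ∀ v ∈ constSpan ψ S ℓ, b * v ∈ constSpan ψ S ℓ := by
    induction hb using Algebra.adjoin_induction with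
    | mem x hx =>
      obtain ⟨i, hi, hx⟩ := hx
      exact fun v hv => mul_mem_constSpan h1 hi hx hv
    | algebraMap r =>
      intro v hv
      rw [← Algebra.smul_def]
      exact Submodule.smul_mem _ _ hv
    | add x y _ _ hx hy =>
      intro v hv
      rw [add_mul]
      exact Submodule.add_mem _ (hx v hv) (hy v hv)
    | mul x y _ _ hx hy =>
      intro v hv
      rw [mul_assoc]
      exact hx _ (hy v hv)
  have h : (1 : A) ∈ constSpan ψ S ℓ := by
    simpa using algebraMap_mem_constSpan (ψ := ψ) (S := S) (ℓ := ℓ) 1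
  simpa using key 1 h

lemma mem_wordSpan_of_mem_otherAlg (hS : TwoStateFreelyIndependent φ ψ S) (h1 : ψ 1 = 1) {b : A}
    (hb : b ∈ otherAlg S ℓ) (hb0 : ψ b = 0) : b ∈ wordSpan ψ S (· ≠ ℓ) (· ≠ ℓ) := by
  obtain ⟨x, hx, y, hy, rfl⟩ := Submodule.mem_sup.1 (mem_constSpan_of_mem_otherAlg h1 hb)
  obtain ⟨c, rfl⟩ := Submodule.mem_span_singleton.1 hx
  rw [map_add, psi_of_mem_wordSpan hS hy, map_smul, h1] at hb0
  have : c = 0 := by simpa using hb0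
  simpa [this] using hy

lemma centered_mul_startSpan (hS : TwoStateFreelyIndependent φ ψ S) (h1 : ψ 1 = 1) {b r : A}
    (hb : b ∈ otherAlg S ℓ) (hb0 : ψ b = 0) (hr : r ∈ startSpan ψ S ℓ) :
    b * r ∈ otherSpan ψ S ℓ ∧ φ (b * r) = φ b * φ r :=
  mul_mem_wordSpan_aux rfl rfl
    (by
      rintro a ⟨i, hi, ha⟩ w ⟨j, rfl, hw⟩
      have := ha.mul_of_ne hS hw
      exact ⟨this.1.mem_wordSpan hi, this.2⟩)
    (mem_wordSpan_of_mem_otherAlg hS h1 hb hb0) hr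

/-- After subtracting the constant ψ(b) the factorization is that of words, and for a constant
factor it is trivial; hence b itself need not be centered. -/
lemma phi_mul_startSpan (hS : TwoStateFreelyIndependent φ ψ S) (h1 : ψ 1 = 1) (hφ1 : φ 1 = 1)
    {b r : A} (hb : b ∈ otherAlg S ℓ) (hr : r ∈ startSpan ψ S ℓ) : φ (b * r) = φ b * φ r := by
  have h0 : ψ (b - algebraMap ℂ A (ψ b)) = 0 := by
    rw [map_sub, Algebra.algebraMap_eq_smul_one, map_smul, h1]
    simp
  have h := (centered_mul_startSpan hS h1
    ((otherAlg S ℓ).sub_mem hb ((otherAlg S ℓ).algebraMap_mem (ψ b))) h0 hr).2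
  rw [sub_mul, map_sub, map_sub, ← Algebra.smul_def, map_smul, Algebra.algebraMap_eq_smul_one,
    map_smul, hφ1] at h
  simp only [smul_eq_mul, mul_one] at h
  linear_combination h

lemma centered_mul_otherSpan (hS : TwoStateFreelyIndependent φ ψ S) {y r : A}
    (hy : y ∈ S ℓ) (hy0 : ψ y = 0) (hr : r ∈ otherSpan ψ S ℓ) :
    y * r ∈ startSpan ψ S ℓ ∧ φ (y * r) = φ y * φ r :=
  mul_mem_wordSpan_aux (s := {y}) (P := Submodule.span ℂ {y}) rfl rfl
    (by
      rintro _ rfl w ⟨j, hj, hw⟩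
      exact ⟨AltWord.mem_wordSpan rfl (.cons trivial hy hy0 hj.symm hw),
        AltWord.phi_mul hS hy hy0 hj.symm hw⟩)
    (Submodule.mem_span_singleton_self y) hr

lemma mem_startSpan {y : A} (hy : y ∈ S ℓ) (hy0 : ψ y = 0) : y ∈ startSpan ψ S ℓ :=
  AltWord.mem_wordSpan rfl (.single trivial hy hy0)

lemma psi_mul_startSpan (hS : TwoStateFreelyIndependent φ ψ S) (h1 : ψ 1 = 1) {b r : A}
    (hb : b ∈ otherAlg S ℓ) (hb0 : ψ b = 0) (hr : r ∈ startSpan ψ S ℓ) : ψ (b * r) = 0 :=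
  psi_of_mem_wordSpan hS (centered_mul_startSpan hS h1 hb hb0 hr).1

end Words

/-! ### Generating functions of sums of two-state free elements -/

section SumFree

variable {A : Type*} [Ring A] [Algebra ℂ A] {ι : Type*}
variable {φ ψ : A →ₗ[ℂ] ℂ} {S : ι → Subalgebra ℂ A} {ℓ : ι}

lemma aeval_mem_subalgebra {B : Subalgebra ℂ A} {x : A} (hx : x ∈ B) (p : Polynomial ℝ) :
    Polynomial.aeval x p ∈ B := by
  rw [Polynomial.aeval_eq_sum_range]
  exact B.sum_mem fun i _ => (B.restrictScalars ℝ).smul_mem (B.pow_mem hx i) _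

/-- The image of a power series under a functional, applied coefficientwise after left
multiplication by `w`. -/
noncomputable def mapSer (φ : A →ₗ[ℂ] ℂ) (w : A) (f : PowerSeries A) : PowerSeries ℂ :=
  PowerSeries.mk fun n => φ (w * PowerSeries.coeff n f)

lemma coeff_mapSer (w : A) (f : PowerSeries A) (n : ℕ) :
    PowerSeries.coeff n (mapSer φ w f) = φ (w * PowerSeries.coeff n f) := by
  simp [mapSer]

lemma mapSer_add (w : A) (f g : PowerSeries A) :
    mapSer φ w (f + g) = mapSer φ w f + mapSer φ w g := by
  ext n; simp [coeff_mapSer, mul_add]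

lemma mapSer_sub (w : A) (f g : PowerSeries A) :
    mapSer φ w (f - g) = mapSer φ w f - mapSer φ w g := by
  ext n; simp [coeff_mapSer, mul_sub]

lemma mapSer_one (h1 : φ 1 = 1) : mapSer φ 1 1 = 1 := by
  ext n
  rw [coeff_mapSer, PowerSeries.coeff_one, PowerSeries.coeff_one]
  split_ifs <;> simp [h1]

lemma mapSer_mul (w : A) (f g : PowerSeries A)
    (h : ∀ i j, φ (w * (PowerSeries.coeff i f * PowerSeries.coeff j g)) =
      φ (w * PowerSeries.coeff i f) * φ (PowerSeries.coeff j g)) :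
    mapSer φ w (f * g) = mapSer φ w f * mapSer φ 1 g := by
  ext n
  rw [coeff_mapSer, PowerSeries.coeff_mul, PowerSeries.coeff_mul, Finset.mul_sum, map_sum]
  exact Finset.sum_congr rfl fun ij _ => by rw [h, coeff_mapSer, coeff_mapSer, one_mul]

variable (hS : TwoStateFreelyIndependent φ ψ S) (h1 : ψ 1 = 1) (hφ1 : φ 1 = 1)
  {a b a' b' : ℝ} {x y : A} (hx : x ∈ otherAlg S ℓ) (hy : y ∈ S ℓ) {n : ℕ}

lemma coeff_zero_serU_sub_one (a b : ℝ) (x : A) :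
    PowerSeries.coeff 0 (serU a b x - 1) = 0 := by
  simp [serU, polyU]

lemma coeff_serU_sub_one (a b : ℝ) (x : A) {k : ℕ} (hk : 1 ≤ k) :
    PowerSeries.coeff k (serU a b x - 1) = Polynomial.aeval x (polyU a b k) := by
  rw [map_sub, coeff_serU, PowerSeries.coeff_one, if_neg (by omega), sub_zero]

lemma coeff_zero_serT (a b a' b' : ℝ) (x y : A) :
    PowerSeries.coeff 0 (serT a b a' b' x y) = 0 := by
  rw [serT_eq, PowerSeries.coeff_mul]
  simp [serU, polyU]

/-- The part of the generating function of the `polyU` at `x + y` which does not start with `y`. -/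
noncomputable def serZ (a b a' b' : ℝ) (x y : A) : PowerSeries A :=
  1 + (serU a b x - 1) * (1 + serT a b a' b' x y)

lemma coeff_zero_serZ (a b a' b' : ℝ) (x y : A) :
    PowerSeries.coeff 0 (serZ a b a' b' x y) = 1 := by
  rw [serZ, map_add, PowerSeries.coeff_mul]
  simp [serU, polyU]

include hS h1 hx in
-- Each nonzero summand is a centered polynomial in x, followed by 1 or by a combination of words
-- starting in `S ℓ`. The bounds on the orders allow use inside the induction for `serT`.
lemma coeff_serZ_mem {j : ℕ} (hj : 1 ≤ j)
    (hxc : ∀ k, 1 ≤ k → k ≤ j → ψ (Polynomial.aeval x (polyU a b k)) = 0)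
    (hT : ∀ k, 1 ≤ k → k < j →
      PowerSeries.coeff k (serT a b a' b' x y) ∈ startSpan ψ S ℓ) :
    PowerSeries.coeff j (serZ a b a' b' x y) ∈ otherSpan ψ S ℓ := by
  have hle : wordSpan ψ S (· ≠ ℓ) (· ≠ ℓ) ≤ otherSpan ψ S ℓ :=
    Submodule.span_mono fun w ⟨i, hi, hw⟩ => ⟨i, hi, hw.mono fun _ _ => trivial⟩
  rw [serZ, map_add, PowerSeries.coeff_one, if_neg (by omega), zero_add, PowerSeries.coeff_mul]
  refine Submodule.sum_mem _ fun ik hik => ?_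
  obtain ⟨i, k⟩ := ik
  rw [Finset.HasAntidiagonal.mem_antidiagonal] at hik
  simp only at hik ⊢
  rcases Nat.eq_zero_or_pos i with rfl | hi
  · rw [coeff_zero_serU_sub_one, zero_mul]
    exact Submodule.zero_mem _
  rw [coeff_serU_sub_one _ _ _ hi]
  have hm := aeval_mem_subalgebra hx (polyU a b i)
  rcases Nat.eq_zero_or_pos k with rfl | hk
  · rw [map_add, coeff_zero_serT, PowerSeries.coeff_one, if_pos rfl, add_zero, mul_one]
    exact hle (mem_wordSpan_of_mem_otherAlg hS h1 hm (hxc i hi (by omega)))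
  · rw [map_add, PowerSeries.coeff_one, if_neg (by omega), zero_add]
    exact (centered_mul_startSpan hS h1 hm (hxc i hi (by omega)) (hT k hk (by omega))).1

include hS h1 hx hy in
-- In `serT` = (`serU a' b' y` - 1) · `serZ` the polynomial of order n in y occurs only with the
-- constant term of `serZ`. Once it is removed, only orders below n remain, so centering at order n
-- itself is not presupposed.
lemma coeff_serT_sub_mem (hn : 1 ≤ n)
    (hxc : ∀ k, 1 ≤ k → k < n → ψ (Polynomial.aeval x (polyU a b k)) = 0)
    (hyc : ∀ k, 1 ≤ k → k < n → ψ (Polynomial.aeval y (polyU a' b' k)) = 0) :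
    PowerSeries.coeff n (serT a b a' b' x y) - Polynomial.aeval y (polyU a' b' n)
      ∈ startSpan ψ S ℓ := by
  induction n using Nat.strong_induction_on with
  | _ n ih =>
    have hT : ∀ k, 1 ≤ k → k < n →
        PowerSeries.coeff k (serT a b a' b' x y) ∈ startSpan ψ S ℓ := fun k hk hkn => by
      have := ih k hkn hk (fun m hm hmk => hxc m hm (by omega))
        (fun m hm hmk => hyc m hm (by omega))
      rw [← sub_add_cancel (PowerSeries.coeff k (serT a b a' b' x y))
        (Polynomial.aeval y (polyU a' b' k))]
      exact Submodule.add_mem _ this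
        (mem_startSpan (aeval_mem_subalgebra hy _) (hyc k hk hkn))
    rw [serT_eq]
    change PowerSeries.coeff n ((serU a' b' y - 1) * serZ a b a' b' x y) - _ ∈ _
    rw [PowerSeries.coeff_mul, ← Finset.sum_erase_add _ _
      (show (n, 0) ∈ Finset.HasAntidiagonal.antidiagonal n by simp)]
    simp only [coeff_zero_serZ, mul_one]
    rw [coeff_serU_sub_one _ _ _ hn, add_sub_cancel_right]
    refine Submodule.sum_mem _ fun ij hij => ?_
    obtain ⟨i, j⟩ := ij
    rw [Finset.mem_erase, Finset.HasAntidiagonal.mem_antidiagonal] at hij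
    simp only [ne_eq, Prod.mk.injEq, not_and] at hij ⊢
    rcases Nat.eq_zero_or_pos i with rfl | hi
    · rw [coeff_zero_serU_sub_one, zero_mul]
      exact Submodule.zero_mem _
    have hj : 1 ≤ j := by
      rcases Nat.eq_zero_or_pos j with rfl | hj
      · exact absurd rfl (hij.1 (by omega))
      · exact hj
    rw [coeff_serU_sub_one _ _ _ hi]
    exact (centered_mul_otherSpan hS (aeval_mem_subalgebra hy _) (hyc i hi (by omega))
      (coeff_serZ_mem hS h1 hx hj (fun k hk hkj => hxc k hk (by omega))
        fun k hk hkj => hT k hk (by omega))).1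

include hS h1 hx hy in
-- All mixed products of total order n use centered letters of lower order and vanish under ψ; only
-- the two pure terms survive.
lemma psi_polyU_add (hn : 1 ≤ n)
    (hxc : ∀ k, 1 ≤ k → k < n → ψ (Polynomial.aeval x (polyU a b k)) = 0)
    (hyc : ∀ k, 1 ≤ k → k < n → ψ (Polynomial.aeval y (polyU a' b' k)) = 0) :
    ψ (Polynomial.aeval (x + y) (polyU (a + a') (b + b') n)) =
      ψ (Polynomial.aeval x (polyU a b n)) + ψ (Polynomial.aeval y (polyU a' b' n)) := by
  have hT : ∀ k, 1 ≤ k → k < n →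
      PowerSeries.coeff k (serT a b a' b' x y) ∈ startSpan ψ S ℓ := fun k hk hkn => by
    rw [← sub_add_cancel (PowerSeries.coeff k (serT a b a' b' x y))
      (Polynomial.aeval y (polyU a' b' k))]
    exact Submodule.add_mem _ (coeff_serT_sub_mem hS h1 hx hy hk
      (fun m hm hmk => hxc m hm (by omega)) (fun m hm hmk => hyc m hm (by omega)))
      (mem_startSpan (aeval_mem_subalgebra hy _) (hyc k hk hkn))
  have hTn := psi_of_mem_wordSpan hS (coeff_serT_sub_mem hS h1 hx hy hn hxc hyc)
  rw [map_sub, sub_eq_zero] at hTn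
  rw [← coeff_serU, serU_add, mul_add, mul_one, map_add, map_add, coeff_serU]
  congr 1
  rw [PowerSeries.coeff_mul, map_sum, Finset.sum_eq_single (0, n)]
  · simp [coeff_serU, polyU, hTn]
  · rintro ⟨i, j⟩ hij hne
    rw [Finset.HasAntidiagonal.mem_antidiagonal] at hij
    simp only at hij ⊢
    rcases Nat.eq_zero_or_pos j with rfl | hj
    · rw [coeff_zero_serT, mul_zero, map_zero]
    have hi : 1 ≤ i := by
      rcases Nat.eq_zero_or_pos i with rfl | hi
      · exact absurd (by simp; omega) hne
      · exact hi
    rw [coeff_serU]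
    exact psi_mul_startSpan hS h1 (aeval_mem_subalgebra hx _) (hxc i hi (by omega))
      (hT j hj (by omega))
  · intro h
    simp at h

include hS h1 hφ1 hx hy in
-- With U, V the series of x and y, the relations D = U(1 + T), T = (V - 1)Z, Z = 1 + (U - 1)(1 + T)
-- pass to φ factor by factor. Eliminating T and Z from the scalar equations gives the formula; w is
-- absorbed into the algebra of x.
lemma mapSer_serU_add (hxc : ∀ k, 1 ≤ k → ψ (Polynomial.aeval x (polyU a b k)) = 0)
    (hyc : ∀ k, 1 ≤ k → ψ (Polynomial.aeval y (polyU a' b' k)) = 0) {w : A}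
    (hw : w ∈ otherAlg S ℓ) :
    mapSer φ w (serU (a + a') (b + b') (x + y)) *
        (1 - (mapSer φ 1 (serU a' b' y) - 1) * (mapSer φ 1 (serU a b x) - 1)) =
      mapSer φ w (serU a b x) * mapSer φ 1 (serU a' b' y) := by
  have hT : ∀ k, 1 ≤ k →
      PowerSeries.coeff k (serT a b a' b' x y) ∈ startSpan ψ S ℓ := fun k hk => by
    rw [← sub_add_cancel (PowerSeries.coeff k (serT a b a' b' x y))
      (Polynomial.aeval y (polyU a' b' k))]
    exact Submodule.add_mem _ (coeff_serT_sub_mem hS h1 hx hy hk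
      (fun m hm _ => hxc m hm) (fun m hm _ => hyc m hm))
      (mem_startSpan (aeval_mem_subalgebra hy _) (hyc k hk))
  have hmul : ∀ f : A, f ∈ otherAlg S ℓ → ∀ k,
      φ (f * PowerSeries.coeff k (1 + serT a b a' b' x y)) =
        φ f * φ (PowerSeries.coeff k (1 + serT a b a' b' x y)) := fun f hf k => by
    rcases Nat.eq_zero_or_pos k with rfl | hk
    · simp [coeff_zero_serT, hφ1, -PowerSeries.coeff_zero_eq_constantCoeff]
    · rw [map_add, PowerSeries.coeff_one, if_neg (by omega), zero_add]
      exact phi_mul_startSpan hS h1 hφ1 hf (hT k hk)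
  have e1 : mapSer φ w (serU (a + a') (b + b') (x + y)) =
      mapSer φ w (serU a b x) * mapSer φ 1 (1 + serT a b a' b' x y) := by
    rw [serU_add]
    refine mapSer_mul _ _ _ fun i k => ?_
    rw [← mul_assoc, hmul _ ?_ k]
    rw [coeff_serU]
    exact (otherAlg S ℓ).mul_mem hw (aeval_mem_subalgebra hx _)
  have e2 : mapSer φ 1 (serZ a b a' b' x y) =
      1 + (mapSer φ 1 (serU a b x) - 1) * mapSer φ 1 (1 + serT a b a' b' x y) := by
    rw [serZ, mapSer_add, mapSer_one hφ1, mapSer_mul, mapSer_sub, mapSer_one hφ1]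
    intro i k
    rw [one_mul, one_mul, hmul]
    rw [map_sub, coeff_serU, PowerSeries.coeff_one]
    refine (otherAlg S ℓ).sub_mem (aeval_mem_subalgebra hx _) ?_
    split_ifs
    · exact (otherAlg S ℓ).one_mem
    · exact (otherAlg S ℓ).zero_mem
  have e3 : mapSer φ 1 (serT a b a' b' x y) =
      (mapSer φ 1 (serU a' b' y) - 1) * mapSer φ 1 (serZ a b a' b' x y) := by
    rw [serT_eq]
    change mapSer φ 1 ((serU a' b' y - 1) * serZ a b a' b' x y) = _
    rw [mapSer_mul, mapSer_sub, mapSer_one hφ1]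
    intro i j
    rw [one_mul, one_mul]
    rcases Nat.eq_zero_or_pos i with rfl | hi
    · rw [coeff_zero_serU_sub_one]
      simp
    rcases Nat.eq_zero_or_pos j with rfl | hj
    · rw [coeff_zero_serZ, hφ1]
      simp
    rw [coeff_serU_sub_one _ _ _ hi]
    exact (centered_mul_otherSpan hS (aeval_mem_subalgebra hy _) (hyc i hi)
      (coeff_serZ_mem hS h1 hx hj (fun k hk _ => hxc k hk) fun k hk _ => hT k hk)).2
  rw [mapSer_add, mapSer_one hφ1] at e1 e2
  rw [e2] at e3
  rw [e1]
  linear_combination (mapSer φ w (serU a b x)) * e3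

end SumFree

/-! ### Martingale polynomials of the process -/

/-- Additivity gives f(t) = N f(t/N), and the right-hand side tends to 0 as N grows. -/
lemma eq_zero_of_additive_isLittleO {f : ℝ → ℂ} {T : ℝ}
    (hadd : ∀ s t, 0 ≤ s → s < t → t ≤ T → f t = f s + f (t - s))
    (ho : f =o[𝓝[>] 0] (id : ℝ → ℝ)) {t : ℝ} (ht : 0 ≤ t) (htT : t ≤ T) (hT : 0 < T) :
    f t = 0 := by
  have hpos : ∀ t, 0 < t → t ≤ T → f t = 0 := by
    intro t ht htT
    have hmul : ∀ (k : ℕ) (h : ℝ), 0 < h → (k + 1) * h ≤ T →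
        f ((k + 1) * h) = (k + 1) * f h := by
      intro k h hh
      induction k with
      | zero => intro; simp
      | succ k ih =>
        intro hk
        push_cast at hk ⊢
        rw [hadd ((k + 1) * h) ((k + 1 + 1) * h) (by positivity) (by nlinarith) hk,
          ih (by nlinarith), show (k + 1 + 1) * h - (k + 1) * h = h by ring]
        ring
    by_contra hne
    have hn : 0 < ‖f t‖ := norm_pos_iff.2 hne
    have hc : 0 < ‖f t‖ / (2 * t) := by positivity
    have h1 := (Asymptotics.isLittleO_iff.1 ho) hc
    have h2 : Tendsto (fun N : ℕ => t / ((N : ℝ) + 1)) atTop (𝓝[>] 0) := by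
      refine tendsto_nhdsWithin_iff.2 ⟨?_, Eventually.of_forall fun N => ?_⟩
      · simpa [div_eq_mul_inv] using (tendsto_one_div_add_atTop_nhds_zero_nat).const_mul t
      · exact div_pos ht (by positivity)
    obtain ⟨N, hN⟩ := (h2.eventually h1).exists
    have hN0 : (0 : ℝ) < (N : ℝ) + 1 := by positivity
    have e : ((N : ℝ) + 1) * (t / ((N : ℝ) + 1)) = t := by field_simp
    have h3 := hmul N (t / ((N : ℝ) + 1)) (div_pos ht hN0) (by rw [e]; exact htT)
    rw [e] at h3
    have h4 : ‖f t‖ = ((N : ℝ) + 1) * ‖f (t / ((N : ℝ) + 1))‖ := by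
      rw [h3, norm_mul]
      congr 1
      have : ((N : ℂ) + 1) = (((N : ℝ) + 1 : ℝ) : ℂ) := by push_cast; rfl
      rw [this, Complex.norm_real, Real.norm_of_nonneg hN0.le]
    have h5 : ‖f t‖ ≤ ‖f t‖ / 2 := by
      calc ‖f t‖ = ((N : ℝ) + 1) * ‖f (t / ((N : ℝ) + 1))‖ := h4
        _ ≤ ((N : ℝ) + 1) * (‖f t‖ / (2 * t) * ‖id (t / ((N : ℝ) + 1))‖) := by gcongr
        _ = ‖f t‖ / 2 := by
          rw [id, Real.norm_of_nonneg (div_pos ht hN0).le]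
          field_simp
    linarith
  rcases ht.eq_or_lt with rfl | ht
  · have := hadd 0 T le_rfl hT le_rfl
    rw [sub_zero] at this
    simpa using this
  · exact hpos t ht htT

section Increments

variable {A : Type*} [Ring A] [Algebra ℂ A] {φ ψ : A →ₗ[ℂ] ℂ} {α T : ℝ} {X : ℝ → A}

/-- The algebra generated by the process up to time `s`. -/
def pastAlg (X : ℝ → A) (s : ℝ) : Subalgebra ℂ A := Algebra.adjoin ℂ (X '' Set.Icc 0 s)

lemma mem_pastAlg (X : ℝ → A) {r s : ℝ} (hr : 0 ≤ r) (hrs : r ≤ s) : X r ∈ pastAlg X s :=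
  Algebra.subset_adjoin ⟨r, ⟨hr, hrs⟩, rfl⟩

lemma pastAlg_mono (X : ℝ → A) {r s : ℝ} (hrs : r ≤ s) : pastAlg X r ≤ pastAlg X s :=
  Algebra.adjoin_mono (Set.image_mono (Set.Icc_subset_Icc_right hrs))

lemma exists_finset_of_mem_pastAlg {s : ℝ} {w : A} (hw : w ∈ pastAlg X s) :
    ∃ F : Finset ℝ, (∀ r ∈ F, r ∈ Set.Icc 0 s) ∧ w ∈ Algebra.adjoin ℂ (X '' (F : Set ℝ)) := by
  classical
  have hmono : ∀ {F G : Finset ℝ}, F ⊆ G →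
      Algebra.adjoin ℂ (X '' (F : Set ℝ)) ≤ Algebra.adjoin ℂ (X '' (G : Set ℝ)) := fun h =>
    Algebra.adjoin_mono (Set.image_mono (by exact_mod_cast h))
  induction hw using Algebra.adjoin_induction with
  | mem x hx =>
    obtain ⟨r, hr, rfl⟩ := hx
    exact ⟨{r}, by simpa using hr, Algebra.subset_adjoin ⟨r, by simp, rfl⟩⟩
  | algebraMap r => exact ⟨∅, by simp, Subalgebra.algebraMap_mem _ r⟩
  | add x y _ _ hx hy =>
    obtain ⟨F, hF, hx⟩ := hx
    obtain ⟨G, hG, hy⟩ := hy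
    refine ⟨F ∪ G, fun r hr => (Finset.mem_union.1 hr).elim (hF r) (hG r), ?_⟩
    exact Subalgebra.add_mem _ (hmono Finset.subset_union_left hx)
      (hmono Finset.subset_union_right hy)
  | mul x y _ _ hx hy =>
    obtain ⟨F, hF, hx⟩ := hx
    obtain ⟨G, hG, hy⟩ := hy
    refine ⟨F ∪ G, fun r hr => (Finset.mem_union.1 hr).elim (hF r) (hG r), ?_⟩
    exact Subalgebra.mul_mem _ (hmono Finset.subset_union_left hx)
      (hmono Finset.subset_union_right hy)

lemma map_aeval_congr {χ : A →ₗ[ℂ] ℂ} {x y : A} (h : ∀ n : ℕ, χ (x ^ n) = χ (y ^ n))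
    (p : Polynomial ℝ) : χ (Polynomial.aeval x p) = χ (Polynomial.aeval y p) := by
  rw [Polynomial.aeval_eq_sum_range, Polynomial.aeval_eq_sum_range, map_sum, map_sum]
  refine Finset.sum_congr rfl fun i _ => ?_
  rw [LinearMap.map_smul_of_tower, LinearMap.map_smul_of_tower, h]

variable (hφ1 : φ 1 = 1)

/-- The inverse of the `φ`-expectation of the generating function of the `polyU`. -/
noncomputable def invSer (φ : A →ₗ[ℂ] ℂ) (α : ℝ) (X : ℝ → A) (t : ℝ) : PowerSeries ℂ :=
  (mapSer φ 1 (serU (α * t) t (X t)))⁻¹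

include hφ1 in
lemma constantCoeff_mapSer_serU (t : ℝ) :
    PowerSeries.constantCoeff (mapSer φ 1 (serU (α * t) t (X t))) = 1 := by
  rw [← PowerSeries.coeff_zero_eq_constantCoeff_apply, coeff_mapSer, coeff_serU]
  simp [polyU, hφ1]

include hφ1 in
lemma mapSer_mul_invSer (t : ℝ) : mapSer φ 1 (serU (α * t) t (X t)) * invSer φ α X t = 1 :=
  PowerSeries.mul_inv_cancel _ (by rw [constantCoeff_mapSer_serU hφ1]; exact one_ne_zero)

include hφ1 in
lemma coeff_zero_invSer (t : ℝ) : PowerSeries.coeff 0 (invSer φ α X t) = 1 := by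
  rw [PowerSeries.coeff_zero_eq_constantCoeff_apply, invSer, PowerSeries.constantCoeff_inv,
    constantCoeff_mapSer_serU hφ1, inv_one]

variable [StarRing A]

/-- An element of the past involves finitely many times. Together with 0 and s they cut [0, s] into
intervals, and [s, t] is added as the last one. Since X 0 = 0, positions up to time s at these times
are sums of the earlier increments. -/
lemma HasTwoStateFreeIncrements.exists_free_family (hX : HasTwoStateFreeIncrements φ ψ T X)
    {s t : ℝ} (hs : 0 ≤ s) (hst : s < t) (htT : t ≤ T) {w : A} (hw : w ∈ pastAlg X s) :
    ∃ (k : ℕ) (S : Fin (k + 1) → Subalgebra ℂ A), TwoStateFreelyIndependent φ ψ S ∧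
      w ∈ otherAlg S (Fin.last k) ∧ X s ∈ otherAlg S (Fin.last k) ∧
      X t - X s ∈ S (Fin.last k) := by
  classical
  obtain ⟨F, hF, hw⟩ := exists_finset_of_mem_pastAlg hw
  set G : Finset ℝ := insert 0 (insert s F) with hG
  have h0G : (0 : ℝ) ∈ G := by simp [hG]
  have hsG : s ∈ G := by simp [hG]
  have hGs : ∀ r ∈ G, r ∈ Set.Icc 0 s := by
    intro r hr
    simp only [hG, Finset.mem_insert] at hr
    rcases hr with rfl | rfl | hr
    · exact ⟨le_rfl, hs⟩
    · exact ⟨hs, le_rfl⟩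
    · exact hF r hr
  obtain ⟨k, hk⟩ : ∃ k, G.card = k + 1 :=
    ⟨G.card - 1, by have := Finset.card_pos.2 ⟨0, h0G⟩; omega⟩
  set g := G.orderEmbOfFin hk with hg
  have hgG : ∀ i, g i ∈ G := fun i => Finset.orderEmbOfFin_mem G hk i
  have hrange : ∀ r ∈ G, ∃ i, g i = r := fun r hr => by
    have := Finset.range_orderEmbOfFin G hk
    have hr' : r ∈ Set.range (G.orderEmbOfFin hk) := by rw [this]; exact hr
    exact hr'
  have hg0 : g 0 = 0 := by
    obtain ⟨i, hi⟩ := hrange 0 h0G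
    have h1 : g 0 ≤ g i := g.monotone (Fin.zero_le i)
    exact le_antisymm (hi ▸ h1) (hGs _ (hgG 0)).1
  have hgl : g (Fin.last k) = s := by
    obtain ⟨i, hi⟩ := hrange s hsG
    have h1 : g i ≤ g (Fin.last k) := g.monotone (Fin.le_last i)
    exact le_antisymm (hGs _ (hgG _)).2 (hi ▸ h1)
  set τ : Fin (k + 1) → ℝ := Fin.snoc (fun i : Fin k => g i.succ) t with hτ
  have hτl : τ (Fin.last k) = t := by simp [hτ]
  have hτc : ∀ i : Fin k, τ i.castSucc = g i.succ := fun i => by simp [hτ]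
  set S : Fin (k + 1) → Subalgebra ℂ A := fun i => Algebra.adjoin ℂ {X (τ i) - X (g i)} with hS
  have hord : ∀ i j : Fin (k + 1), i < j → τ i ≤ g j := by
    intro i j hij
    refine Fin.lastCases (fun h => absurd h (not_lt.2 (Fin.le_last j))) (fun i hij => ?_) i hij
    rw [hτc]
    exact g.monotone (Fin.castSucc_lt_iff_succ_le.1 hij)
  have hfree : TwoStateFreelyIndependent φ ψ S := by
    refine hX.free (k + 1) g τ (fun i => ⟨(hGs _ (hgG i)).1, ?_, ?_⟩) fun i j hij => ?_
    · refine Fin.lastCases ?_ (fun i => ?_) i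
      · rw [hτl, hgl]; exact hst
      · rw [hτc]; exact g.strictMono i.castSucc_lt_succ
    · refine Fin.lastCases ?_ (fun i => ?_) i
      · rw [hτl]; exact htT
      · rw [hτc]; exact ((hGs _ (hgG _)).2.trans hst.le).trans htT
    · rcases lt_or_gt_of_ne hij with h | h
      · exact Set.disjoint_left.2 fun x hx hx' =>
          absurd (hx.2.trans_le (hord i j h)) (not_lt.2 hx'.1)
      · exact Set.disjoint_left.2 fun x hx hx' =>
          absurd (hx'.2.trans_le (hord j i h)) (not_lt.2 hx.1)
  have hmem : ∀ i, X (g i) ∈ otherAlg S (Fin.last k) := by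
    intro i
    induction i using Fin.induction with
    | zero => rw [hg0, hX.zero]; exact Subalgebra.zero_mem _
    | succ i ih =>
      have h1 : X (τ i.castSucc) - X (g i.castSucc) ∈ otherAlg S (Fin.last k) :=
        Algebra.subset_adjoin ⟨i.castSucc, (Fin.castSucc_lt_last i).ne,
          Algebra.subset_adjoin rfl⟩
      rw [hτc] at h1
      simpa using Subalgebra.add_mem _ h1 ih
  refine ⟨k, S, hfree, ?_, hgl ▸ hmem (Fin.last k), ?_⟩
  · refine (Algebra.adjoin_le ?_ : Algebra.adjoin ℂ (X '' (F : Set ℝ)) ≤ _) hw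
    rintro _ ⟨r, hr, rfl⟩
    obtain ⟨i, hi⟩ := hrange r (by simp [hG, Finset.mem_coe.1 hr])
    exact hi ▸ hmem i
  · have h1 : X (τ (Fin.last k)) - X (g (Fin.last k)) ∈ S (Fin.last k) :=
      Algebra.subset_adjoin rfl
    rwa [hτl, hgl] at h1

variable (hT : 0 < T) (hX : IsTwoStateFBM φ ψ α T X) (hψ1 : ψ 1 = 1)

include hT hX hψ1 in
-- Once all lower orders vanish at all times, the expectation of order n is additive in t by
-- freeness and stationarity. It is o(t) at 0, in order one because the ψ-mean matches the Jacobi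
-- parameter αt.
lemma psi_polyU_eq_zero {n : ℕ} (hn : 1 ≤ n) {t : ℝ} (ht : t ∈ Set.Icc 0 T) :
    ψ (Polynomial.aeval (X t) (polyU (α * t) t n)) = 0 := by
  induction n using Nat.strong_induction_on generalizing t with
  | _ n ih =>
    refine eq_zero_of_additive_isLittleO
      (f := fun t => ψ (Polynomial.aeval (X t) (polyU (α * t) t n))) (T := T) ?_ ?_ ht.1 ht.2 hT
    · intro s t hs hst htT
      obtain ⟨k, S, hS, -, hx, hy⟩ := hX.exists_free_family hs hst htT (Subalgebra.one_mem _)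
      have hstat := fun n => (hX.stationary s t hs hst.le htT n).2
      have h := psi_polyU_add (a := α * s) (b := s) (a' := α * (t - s)) (b' := t - s) hS hψ1 hx hy
        hn (fun k hk hkn => ih k hkn hk ⟨hs, hst.le.trans htT⟩)
        (fun k hk hkn => by
          rw [map_aeval_congr hstat]
          exact ih k hkn hk ⟨by linarith, by linarith⟩)
      rw [map_aeval_congr hstat] at h
      simpa [← mul_add] using h
    · have hsm := hX.smallMoments_psi hT
      match n, hn with
      | 1, _ => simpa using hsm.polyU_one (α := α) hψ1
      | n + 2, _ => exact hsm.polyU_add_two (α := α) hψ1 n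

include hX hψ1 hφ1 hT in
lemma mapSer_serU_increment {s t : ℝ} (hs : 0 ≤ s) (hst : s < t) (htT : t ≤ T) {w : A}
    (hw : w ∈ pastAlg X s) :
    mapSer φ w (serU (α * t) t (X t)) *
        (1 - (mapSer φ 1 (serU (α * (t - s)) (t - s) (X (t - s))) - 1) *
          (mapSer φ 1 (serU (α * s) s (X s)) - 1)) =
      mapSer φ w (serU (α * s) s (X s)) *
        mapSer φ 1 (serU (α * (t - s)) (t - s) (X (t - s))) := by
  obtain ⟨k, S, hS, hw, hx, hy⟩ := hX.exists_free_family hs hst htT hw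
  have h := mapSer_serU_add (a := α * s) (b := s) (a' := α * (t - s)) (b' := t - s) hS hψ1 hφ1 hx
    hy (fun k hk => psi_polyU_eq_zero hT hX hψ1 hk ⟨hs, hst.le.trans htT⟩)
    (fun k hk => by
      rw [map_aeval_congr fun n => (hX.stationary s t hs hst.le htT n).2]
      exact psi_polyU_eq_zero hT hX hψ1 hk ⟨by linarith, by linarith⟩) hw
  have e : mapSer φ 1 (serU (α * (t - s)) (t - s) (X t - X s)) =
      mapSer φ 1 (serU (α * (t - s)) (t - s) (X (t - s))) := by
    ext n
    rw [coeff_mapSer, coeff_mapSer, one_mul, one_mul, coeff_serU, coeff_serU,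
      map_aeval_congr fun n => (hX.stationary s t hs hst.le htT n).1]
  rw [e] at h
  simpa [← mul_add] using h

include hX hψ1 hφ1 hT in
-- Dividing D(1 - (Q - 1)(P - 1)) = PQ by DPQ gives 1/D = 1/P + 1/Q - 1.
lemma invSer_add {s t : ℝ} (hs : 0 ≤ s) (hst : s < t) (htT : t ≤ T) :
    invSer φ α X t = invSer φ α X s + invSer φ α X (t - s) - 1 := by
  have h := mapSer_serU_increment hφ1 hT hX hψ1 hs hst htT (Subalgebra.one_mem _)
  have h1 := mapSer_mul_invSer (φ := φ) (α := α) (X := X) hφ1 t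
  have h2 := mapSer_mul_invSer (φ := φ) (α := α) (X := X) hφ1 s
  have h3 := mapSer_mul_invSer (φ := φ) (α := α) (X := X) hφ1 (t - s)
  set D := mapSer φ 1 (serU (α * t) t (X t))
  set P := mapSer φ 1 (serU (α * s) s (X s))
  set Q := mapSer φ 1 (serU (α * (t - s)) (t - s) (X (t - s)))
  set d := invSer φ α X t
  set p := invSer φ α X s
  set q := invSer φ α X (t - s)
  -- The relation times dpq, with each series grouped with its inverse so that the pairs can be
  -- replaced by 1.
  have h4 : d * (P * p) * (Q * q) = (D * d) * ((P * p) * q + (Q * q) * p - (P * p) * (Q * q)) := by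
    linear_combination (-d * p * q) * h
  rw [h1, h2, h3] at h4
  linear_combination h4

include hX hφ1 hT in
-- The coefficients of the series itself are -αh + o(h) in order one and o(h) above. Inversion
-- changes the sign to first order, the other terms being products of two small factors.
lemma coeff_invSer_isLittleO {n : ℕ} (hn : 1 ≤ n) :
    (fun h => PowerSeries.coeff n (invSer φ α X h) - (((if n = 1 then α else 0) * h : ℝ) : ℂ))
      =o[𝓝[>] 0] (id : ℝ → ℝ) := by
  have hsm := hX.smallMoments_phi hT
  have hD : ∀ i, 1 ≤ i → (fun h => PowerSeries.coeff i (mapSer φ 1 (serU (α * h) h (X h)))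
      + (((if i = 1 then α else 0) * h : ℝ) : ℂ)) =o[𝓝[>] 0] (id : ℝ → ℝ) := by
    intro i hi
    simp only [coeff_mapSer, one_mul, coeff_serU]
    match i, hi with
    | 1, _ => simpa using hsm.polyU_one (α := α) hφ1
    | i + 2, _ => simpa using hsm.polyU_add_two (α := α) hφ1 i
  have hDO : ∀ i, 1 ≤ i → (fun h => PowerSeries.coeff i (mapSer φ 1 (serU (α * h) h (X h))))
      =O[𝓝[>] 0] (id : ℝ → ℝ) := fun i hi => by
    simpa using (hD i hi).isBigO.sub (ofReal_mul_isBigO (if i = 1 then α else 0))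
  induction n using Nat.strong_induction_on with
  | _ n ih =>
    have hβ : ∀ j, 1 ≤ j → j < n → (fun h => PowerSeries.coeff j (invSer φ α X h))
        =o[𝓝[>] 0] (fun _ => (1 : ℝ)) := fun j hj hjn => by
      have := (ih j hjn hj).isBigO.add (ofReal_mul_isBigO (if j = 1 then α else 0))
      exact tendsto_of_isBigO_id (by simpa using this)
    have hrec : ∀ h, PowerSeries.coeff n (invSer φ α X h) =
        - PowerSeries.coeff n (mapSer φ 1 (serU (α * h) h (X h)))
        - ∑ ij ∈ ((Finset.HasAntidiagonal.antidiagonal n).erase (0, n)).erase (n, 0),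
          PowerSeries.coeff ij.1 (mapSer φ 1 (serU (α * h) h (X h))) *
            PowerSeries.coeff ij.2 (invSer φ α X h) := by
      intro h
      have h1 := congrArg (PowerSeries.coeff n)
        (mapSer_mul_invSer (φ := φ) (α := α) (X := X) hφ1 h)
      rw [PowerSeries.coeff_mul, PowerSeries.coeff_one, if_neg (by omega),
        ← Finset.sum_erase_add _ _
          (show (0, n) ∈ Finset.HasAntidiagonal.antidiagonal n by simp),
        ← Finset.sum_erase_add _ _ (show (n, 0) ∈
          (Finset.HasAntidiagonal.antidiagonal n).erase (0, n) by simp; omega)] at h1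
      simp only [coeff_zero_invSer hφ1, mul_one] at h1
      rw [PowerSeries.coeff_zero_eq_constantCoeff_apply, constantCoeff_mapSer_serU hφ1] at h1
      linear_combination h1
    have hsum : (fun h => ∑ ij ∈ ((Finset.HasAntidiagonal.antidiagonal n).erase (0, n)).erase (n, 0),
          PowerSeries.coeff ij.1 (mapSer φ 1 (serU (α * h) h (X h))) *
            PowerSeries.coeff ij.2 (invSer φ α X h)) =o[𝓝[>] 0] (id : ℝ → ℝ) := by
      refine Asymptotics.IsLittleO.fun_sum fun ij hij => ?_
      obtain ⟨i, j⟩ := ij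
      simp only [Finset.mem_erase, ne_eq, Prod.mk.injEq, not_and,
        Finset.HasAntidiagonal.mem_antidiagonal] at hij
      have hi : 1 ≤ i := by
        rcases Nat.eq_zero_or_pos i with rfl | hi
        · exact absurd (by omega) (hij.2.1 rfl)
        · exact hi
      have hj : 1 ≤ j := by
        rcases Nat.eq_zero_or_pos j with rfl | hj
        · exact absurd rfl (hij.1 (by omega))
        · exact hj
      exact isBigO_mul_isLittleO_one (hDO i hi) (hβ j hj (by omega))
    refine ((hD n hn).neg_left.sub hsum).congr_left fun h => ?_
    rw [hrec h]
    ring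

include hX hψ1 hφ1 hT in
-- In each positive order the difference between the reciprocal and 1 + αtz is additive in t and
-- o(t), hence zero.
lemma mapSer_serU_eq {t : ℝ} (ht : t ∈ Set.Icc 0 T) :
    (1 + PowerSeries.C ((α * t : ℝ) : ℂ) * PowerSeries.X) *
      mapSer φ 1 (serU (α * t) t (X t)) = 1 := by
  have h : invSer φ α X t = 1 + PowerSeries.C ((α * t : ℝ) : ℂ) * PowerSeries.X := by
    ext n
    rcases Nat.eq_zero_or_pos n with rfl | hn
    · rw [coeff_zero_invSer hφ1]
      simp
    have h0 := eq_zero_of_additive_isLittleO (T := T) (f := fun h =>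
        PowerSeries.coeff n (invSer φ α X h) - (((if n = 1 then α else 0) * h : ℝ) : ℂ)) ?_
      (coeff_invSer_isLittleO hφ1 hT hX hn) ht.1 ht.2 hT
    · simp only [sub_eq_zero] at h0
      have hn0 : n ≠ 0 := hn.ne'
      rw [h0, map_add, PowerSeries.coeff_one, if_neg hn0, PowerSeries.coeff_C_mul,
        PowerSeries.coeff_X]
      split_ifs <;> simp
    · intro s t hs hst htT
      simp only [invSer_add hφ1 hT hX hψ1 hs hst htT, map_add, map_sub, PowerSeries.coeff_one,
        if_neg (show n ≠ 0 by omega)]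
      push_cast
      ring
  rw [← h, mul_comm, mapSer_mul_invSer hφ1]

include hX hψ1 hφ1 hT in
-- With a = αsz and b = α(t - s)z, the formula for an increment becomes φ(w D_t) = φ(w D_s)(1 +
-- a)/(1 + a + b). Hence (1 + αtz) φ(w D_t) does not depend on t, and its coefficients are those of
-- the Q_n.
lemma phi_mul_polyQ {s t : ℝ} (hs : 0 ≤ s) (hst : s < t) (htT : t ≤ T) {w : A}
    (hw : w ∈ pastAlg X s) (n : ℕ) :
    φ (w * Polynomial.aeval (X t) (polyQ (α * t) t n)) =
      φ (w * Polynomial.aeval (X s) (polyQ (α * s) s n)) := by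
  have h := mapSer_serU_increment hφ1 hT hX hψ1 hs hst htT hw
  have h2 := mapSer_serU_eq hφ1 hT hX hψ1 (t := s) ⟨hs, hst.le.trans htT⟩
  have h3 := mapSer_serU_eq hφ1 hT hX hψ1 (t := t - s) ⟨by linarith, by linarith⟩
  have hC : PowerSeries.C ((α * t : ℝ) : ℂ) = PowerSeries.C ((α * s : ℝ) : ℂ) +
      PowerSeries.C ((α * (t - s) : ℝ) : ℂ) := by
    rw [← map_add]
    congr 1
    push_cast
    ring
  have key : (1 + PowerSeries.C ((α * t : ℝ) : ℂ) * PowerSeries.X) *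
        mapSer φ w (serU (α * t) t (X t)) =
      (1 + PowerSeries.C ((α * s : ℝ) : ℂ) * PowerSeries.X) *
        mapSer φ w (serU (α * s) s (X s)) := by
    rw [hC]
    set a := PowerSeries.C ((α * s : ℝ) : ℂ) * PowerSeries.X
    set b := PowerSeries.C ((α * (t - s) : ℝ) : ℂ) * PowerSeries.X
    set D := mapSer φ w (serU (α * t) t (X t))
    set E := mapSer φ w (serU (α * s) s (X s))
    set P := mapSer φ 1 (serU (α * s) s (X s))
    set Q := mapSer φ 1 (serU (α * (t - s)) (t - s) (X (t - s)))
    linear_combination ((1 + a) * (1 + b)) * h - (D * (1 + b - (1 + b) * Q)) * h2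
      - (D * a - E * (1 + a)) * h3
  have hcoef : ∀ (r : ℝ) (y : A) (b : ℝ) (n : ℕ),
      PowerSeries.coeff (n + 1) ((1 + PowerSeries.C (r : ℂ) * PowerSeries.X) *
        mapSer φ w (serU r b y)) = φ (w * Polynomial.aeval y (polyQ r b (n + 1))) := by
    intro r y b n
    rw [add_mul, one_mul, map_add, mul_assoc, PowerSeries.coeff_C_mul,
      PowerSeries.coeff_succ_X_mul, coeff_mapSer, coeff_mapSer, coeff_serU, coeff_serU,
      polyQ_succ, map_add (Polynomial.aeval y), map_mul (Polynomial.aeval y), Polynomial.aeval_C,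
      mul_add, map_add φ, Algebra.left_comm, map_algebraMap_mul]
  match n with
  | 0 => simp [polyQ]
  | n + 1 => rw [← hcoef, ← hcoef, key]

include hX hψ1 hφ1 hT in
/-- The Markov property, with the transition operator on polynomials. -/
lemma phi_mul_aeval {s t : ℝ} (hs : 0 ≤ s) (hst : s < t) (htT : t ≤ T) {w : A}
    (hw : w ∈ pastAlg X s) (p : Polynomial ℝ) :
    φ (w * Polynomial.aeval (X t) p) = φ (w * Polynomial.aeval (X s) (transOp α s t p)) := by
  let f : Polynomial ℝ →ₗ[ℝ] ℂ := (φ.restrictScalars ℝ) ∘ₗ (LinearMap.mulLeft ℝ w) ∘ₗ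
    (Polynomial.aeval (X t)).toLinearMap
  let g : Polynomial ℝ →ₗ[ℝ] ℂ := (φ.restrictScalars ℝ) ∘ₗ (LinearMap.mulLeft ℝ w) ∘ₗ
    (Polynomial.aeval (X s)).toLinearMap ∘ₗ transOp α s t
  have : f = g := polyQ_ext (α * t) t fun n => by
    simpa [f, g, transOp_polyQ] using phi_mul_polyQ hφ1 hT hX hψ1 hs hst htT hw n
  exact LinearMap.congr_fun this p

end Increments

/-! ### Spectral measures -/

section Spectral

variable {E : Type*} [NormedAddCommGroup E] [InnerProductSpace ℂ E] [CompleteSpace E]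

/-- The state of the algebra of continuous functions on the spectrum of `J` given by `e`. -/
noncomputable def spectralFunctional {J : E →L[ℂ] E} (hJ : IsSelfAdjoint J) (e : E) :
    C(spectrum ℝ J, ℝ) →ₗ[ℝ] ℝ where
  toFun f := (inner ℂ e (cfcHom hJ f e)).re
  map_add' f g := by simp
  map_smul' c f := by
    simp only [map_smul, smul_apply, RingHom.id_apply, smul_eq_mul]
    rw [← Complex.coe_smul, inner_smul_right]
    simp

lemma spectralFunctional_nonneg {J : E →L[ℂ] E} (hJ : IsSelfAdjoint J) (e : E)
    {f : C(spectrum ℝ J, ℝ)} (hf : 0 ≤ f) : 0 ≤ spectralFunctional hJ e f := by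
  have h := (ContinuousLinearMap.nonneg_iff_isPositive _).1 ((cfcHom_nonneg_iff hJ).2 hf)
  exact (Complex.nonneg_iff.1 (h.inner_nonneg_right e)).1

lemma cfcHom_toContinuousMapOn {J : E →L[ℂ] E} (hJ : IsSelfAdjoint J) (p : Polynomial ℝ) :
    cfcHom hJ (p.toContinuousMapOn (spectrum ℝ J)) = Polynomial.aeval J p := by
  have h1 : p.toContinuousMapOn (spectrum ℝ J) =
      Polynomial.aeval ((ContinuousMap.id ℝ).restrict (spectrum ℝ J)) p := by
    ext x
    simp [Polynomial.aeval_continuousMap_apply]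
  rw [h1, ← Polynomial.aeval_algHom_apply, cfcHom_id]

/-- The Riesz–Markov–Kakutani theorem is applied to the positive functional f ↦ ⟨e, f(J)e⟩ on the
continuous functions on the compact spectrum. -/
lemma exists_spectral_measure {J : E →L[ℂ] E} (hJ : IsSelfAdjoint J) {e : E} (he : ‖e‖ = 1) :
    ∃ μ : Measure ℝ, IsProbabilityMeasure μ ∧ μ (spectrum ℝ J)ᶜ = 0 ∧
      ∀ p : Polynomial ℝ, ∫ x, p.eval x ∂μ = (inner ℂ e (Polynomial.aeval J p e)).re := by
  have hc : CompactSpace (spectrum ℝ J) := isCompact_iff_compactSpace.1 (spectrum.isCompact J)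
  let Λ : CompactlySupportedContinuousMap (spectrum ℝ J) ℝ →ₚ[ℝ] ℝ :=
    PositiveLinearMap.mk₀
      { toFun := fun f => spectralFunctional hJ e f.toContinuousMap
        map_add' := fun f g => (spectralFunctional hJ e).map_add _ _
        map_smul' := fun c f => (spectralFunctional hJ e).map_smul c _ }
      fun f hf => spectralFunctional_nonneg hJ e hf
  set ρ := RealRMK.rieszMeasure Λ with hρ
  have hint : ∀ p : Polynomial ℝ, ∫ x : spectrum ℝ J, p.eval (x : ℝ) ∂ρ =
      (inner ℂ e (Polynomial.aeval J p e)).re := fun p => by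
    have := RealRMK.integral_rieszMeasure Λ
      (CompactlySupportedContinuousMap.continuousMapEquiv (p.toContinuousMapOn (spectrum ℝ J)))
    rw [← cfcHom_toContinuousMapOn hJ]
    exact this
  have hfin : IsFiniteMeasure ρ := inferInstance
  have hprob : IsProbabilityMeasure ρ := by
    have := hint 1
    simp only [Polynomial.eval_one, integral_const, smul_eq_mul, mul_one, map_one,
      one_apply_eq_self, inner_self_eq_norm_sq_to_K, he] at this
    simpa [measureReal_def, ENNReal.toReal_eq_one_iff, isProbabilityMeasure_iff] using this
  have hm : MeasurableSet (spectrum ℝ J) := (spectrum.isCompact J).measurableSet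
  have hval : Measurable (Subtype.val : spectrum ℝ J → ℝ) := measurable_subtype_coe
  refine ⟨ρ.map Subtype.val, Measure.isProbabilityMeasure_map hval.aemeasurable, ?_, fun p => ?_⟩
  · rw [Measure.map_apply hval hm.compl]
    have : (Subtype.val : spectrum ℝ J → ℝ) ⁻¹' (spectrum ℝ J)ᶜ = ∅ := by
      ext x; simp
    rw [this, measure_empty]
  · rw [integral_map hval.aemeasurable p.continuous.aestronglyMeasurable, hint]

end Spectral

/-! ### Jacobi operators -/

/-- A Cholesky factorization. For the shift, 1 - SS' is the projection onto the initial vector, and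
the right factor is bidiagonal with diagonal d, 1, 1, … and superdiagonal αu, αt, αt, …. It is used
with t, u, d replaced by the square roots of t, t - s and 1 + αx. -/
lemma jacobi_factorization {R : Type*} [Ring R] [Algebra ℝ R] {S S' : R} (h : S' * S = 1)
    (α t u d : ℝ) :
    (1 + (α * t) • S + (d - 1) • (1 - S * S') + (α * (u - t)) • (S * (1 - S * S'))) *
        (1 + (α * t) • S' + (d - 1) • (1 - S * S') + (α * (u - t)) • ((1 - S * S') * S')) =
      (1 + α ^ 2 * t ^ 2) • 1 + (α * t) • (S + S') + (d ^ 2 - 1 - α ^ 2 * t ^ 2) • (1 - S * S') +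
        (α ^ 2 * (u ^ 2 - t ^ 2)) • (S * (1 - S * S') * S') +
        (α * (u * d - t)) • (S * (1 - S * S') + (1 - S * S') * S') := by
  have h' : ∀ z, S' * (S * z) = z := fun z => by rw [← mul_assoc, h, one_mul]
  simp only [mul_add, add_mul, mul_sub, sub_mul, smul_mul_assoc, mul_smul_comm, mul_assoc, h',
    mul_one, one_mul]
  module

section Shift

lemma orthonormal_single : Orthonormal ℂ fun i : ℕ =>
    (lp.single 2 i (1 : ℂ) : lp (fun _ : ℕ => ℂ) 2) := by
  rw [orthonormal_iff_ite]
  intro i j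
  rw [lp.inner_single_left, lp.single_apply]
  by_cases h : i = j
  · subst h; simp
  · simp [h]

/-- The unilateral shift. -/
lemma exists_shift : ∃ (S : lp (fun _ : ℕ => ℂ) 2 →L[ℂ] lp (fun _ : ℕ => ℂ) 2)
    (e : lp (fun _ : ℕ => ℂ) 2), ‖e‖ = 1 ∧ star S * S = 1 ∧ star S e = 0 := by
  have hV := (orthonormal_single.comp _ Nat.succ_injective).orthogonalFamily
  refine ⟨hV.linearIsometry.toContinuousLinearMap, lp.single 2 0 (1 : ℂ),
    orthonormal_single.1 0, ?_, ?_⟩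
  · exact (ContinuousLinearMap.norm_map_iff_adjoint_comp_self _).1 fun x => by simp
  · refine ext_inner_right ℂ fun f => ?_
    rw [ContinuousLinearMap.star_eq_adjoint, ContinuousLinearMap.adjoint_inner_left,
      inner_zero_left]
    have h := (hV.hasSum_linearIsometry f).mapL (innerSL ℂ (lp.single 2 0 (1 : ℂ)))
    refine h.unique ?_
    convert hasSum_zero with i
    have := (orthonormal_iff_ite.1 orthonormal_single) 0 (i + 1)
    simp [this]

end Shift

/-! ### Orthogonal polynomials evaluated at a Jacobi operator -/

section Jacobi

variable {E : Type*} [NormedAddCommGroup E] [InnerProductSpace ℂ E]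

lemma re_inner_real_smul (e v : E) (r : ℝ) :
    (inner ℂ e (r • v)).re = r * (inner ℂ e v).re := by
  rw [inner_smul_right_eq_smul]
  simp

lemma polyU_rec_apply (a b : ℝ) (J : E →L[ℂ] E) (n : ℕ) (v : E) :
    Polynomial.aeval J (polyU a b (n + 2)) v =
      J (Polynomial.aeval J (polyU a b (n + 1)) v) - a • Polynomial.aeval J (polyU a b (n + 1)) v
        - b • Polynomial.aeval J (polyU a b n) v := by
  rw [polyU]
  simp [ContinuousLinearMap.algebraMap_apply]

lemma polyQ_rec_apply (a b : ℝ) (J : E →L[ℂ] E) (n : ℕ) (v : E) :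
    Polynomial.aeval J (polyQ a b (n + 2)) v =
      J (Polynomial.aeval J (polyQ a b (n + 1)) v) - a • Polynomial.aeval J (polyQ a b (n + 1)) v
        - b • Polynomial.aeval J (polyQ a b n) v := by
  rw [polyQ]
  simp [ContinuousLinearMap.algebraMap_apply]

variable [CompleteSpace E]

/-- The operator with the Jacobi parameters of the transition probabilities. -/
noncomputable def jacobiOp (S : E →L[ℂ] E) (x a b r c : ℝ) : E →L[ℂ] E :=
  a • 1 + r • (S + star S) + (x - a) • (1 - S * star S) - b • (S * (1 - S * star S) * star S) +
    (c - r) • (S * (1 - S * star S) + (1 - S * star S) * star S)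

lemma isSelfAdjoint_jacobiOp (S : E →L[ℂ] E) (x a b r c : ℝ) :
    IsSelfAdjoint (jacobiOp S x a b r c) := by
  simp only [jacobiOp, IsSelfAdjoint, star_add, star_sub, star_smul, star_mul, star_star, star_one,
    star_trivial, mul_assoc]
  congr 2
  · rw [add_comm (star S)]
  · rw [add_comm ((1 - S * star S) * star S)]

variable {S : E →L[ℂ] E} {e : E}

lemma shift_apply (hS : star S * S = 1) (v : E) : star S (S v) = v := by
  have := congrArg (fun f : E →L[ℂ] E => f v) hS
  simpa using this

lemma jacobiOp_apply_zero (he : star S e = 0) (x a b r c : ℝ) :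
    jacobiOp S x a b r c e = x • e + c • S e := by
  simp only [jacobiOp, add_apply, sub_apply, smul_apply, mul_apply_eq_comp, one_apply_eq_self,
    he, map_zero, map_sub]
  module

lemma jacobiOp_apply_one (hS : star S * S = 1) (he : star S e = 0) (x a b r c : ℝ) :
    jacobiOp S x a b r c (S e) = c • e + (a - b) • S e + r • S (S e) := by
  simp only [jacobiOp, add_apply, sub_apply, smul_apply, mul_apply_eq_comp, one_apply_eq_self,
    he, map_zero, map_sub, shift_apply hS]
  module

lemma jacobiOp_apply_shift (hS : star S * S = 1) {v : E} (hv : S (star S v) = v)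
    (x a b r c : ℝ) :
    jacobiOp S x a b r c (S v) = a • S v + r • (S (S v) + v) := by
  simp only [jacobiOp, add_apply, sub_apply, smul_apply, mul_apply_eq_comp, one_apply_eq_self,
    map_sub, shift_apply hS, hv]
  module

/-- The component of the orthogonal polynomials of `jacobiOp` off the initial vector. -/
noncomputable def shiftPart (S : E →L[ℂ] E) (e : E) (a b r x : ℝ) : ℕ → E
  | 0 => 0
  | n + 1 => (polyU a b n).eval x • S e + r • S (shiftPart S e a b r x n)

lemma shift_star_shiftPart (hS : star S * S = 1) (a b r x : ℝ) (n : ℕ) :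
    S (star S (shiftPart S e a b r x n)) = shiftPart S e a b r x n := by
  have key : ∀ w, S (star S (S w)) = S w := fun w => by rw [shift_apply hS]
  cases n with
  | zero => simp [shiftPart]
  | succ n =>
    have : shiftPart S e a b r x (n + 1) =
        S ((polyU a b n).eval x • e + r • shiftPart S e a b r x n) := by
      simp [shiftPart]
    rw [this, key]

lemma inner_shiftPart (hS : star S * S = 1) (he : star S e = 0) (a b r x : ℝ) (n : ℕ) :
    inner ℂ e (shiftPart S e a b r x n) = 0 := by
  rw [← shift_star_shiftPart hS, ← ContinuousLinearMap.adjoint_inner_left,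
    ← ContinuousLinearMap.star_eq_adjoint, he, inner_zero_left]

/-- This identity is the source of the factor 1 + αx, both in the Jacobi parameter (t - s)(1 + αx)
of the transition probabilities and in the generator. -/
lemma polyQ_add_smul (α s x : ℝ) (n : ℕ) :
    (polyQ (α * s) s n).eval x + α * (polyQ (α * s) s (n + 1)).eval x =
      (1 + α * x) * (polyU (α * s) s n).eval x := by
  cases n with
  | zero => simp [polyQ, polyU]
  | succ n =>
    rw [polyQ_succ, polyQ_succ, polyU]
    simp only [Polynomial.eval_add, Polynomial.eval_sub, Polynomial.eval_mul, Polynomial.eval_X,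
      Polynomial.eval_C]
    ring

/-- The recursions at times t and s differ along e by (t - s)(Q_n + αQ_{n+1}), which
`polyQ_add_smul` turns into c²U_n, exactly what returns from the first off-diagonal entry. The other
component is orthogonal to e, so pairing with e leaves Q_n(x;s). -/
lemma aeval_polyQ_jacobiOp (hS : star S * S = 1) (he : star S e = 0) {α s t x r c : ℝ}
    (hr : r ^ 2 = t) (hc : c ^ 2 = (t - s) * (1 + α * x)) (n : ℕ) :
    Polynomial.aeval (jacobiOp S x (α * t) (α * s) r c) (polyQ (α * t) t n) e =
      (polyQ (α * s) s n).eval x • e + c • shiftPart S e (α * s) s r x n := by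
  induction n using Nat.strong_induction_on with
  | _ n ih =>
    match n with
    | 0 => simp [polyQ, shiftPart]
    | 1 => simp [polyQ, shiftPart, polyU, jacobiOp_apply_zero he]
    | n + 2 =>
      have hq := polyQ_add_smul α s x n
      have h2 : (polyQ (α * s) s (n + 1)).eval x - α * s * (polyU (α * s) s n).eval x =
          (polyU (α * s) s (n + 1)).eval x := by
        rw [polyQ_succ]
        simp
      have h3 : (polyQ (α * s) s (n + 2)).eval x = (x - α * s) * (polyQ (α * s) s (n + 1)).eval x
          - s * (polyQ (α * s) s n).eval x := by
        rw [polyQ]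
        simp
      have h1 : (polyQ (α * s) s (n + 1)).eval x * x + c ^ 2 * (polyU (α * s) s n).eval x
          - α * t * (polyQ (α * s) s (n + 1)).eval x - t * (polyQ (α * s) s n).eval x =
          (polyQ (α * s) s (n + 2)).eval x := by
        rw [h3, hc]
        linear_combination (s - t) * hq
      rw [polyQ_rec_apply, ih (n + 1) (by omega), ih n (by omega)]
      simp only [shiftPart, map_add, ContinuousLinearMap.map_smul_of_tower, jacobiOp_apply_zero he,
        jacobiOp_apply_one hS he, jacobiOp_apply_shift hS (shift_star_shiftPart hS _ _ _ _ n)]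
      linear_combination (norm := module) h1 • e + (c * h2) • S e +
        (c * hr) • shiftPart S e (α * s) s r x n

end Jacobi

/-- A probability measure on the line with bounded support. -/
structure BoundedProb (μ : Measure ℝ) : Prop where
  prob : IsProbabilityMeasure μ
  bounded : ∃ R : ℝ, ∀ᵐ x ∂μ, |x| ≤ R

lemma exists_spectral_boundedProb {E : Type*} [NormedAddCommGroup E] [InnerProductSpace ℂ E]
    [CompleteSpace E] {J : E →L[ℂ] E} (hJ : IsSelfAdjoint J) {e : E} (he : ‖e‖ = 1) :
    ∃ μ : Measure ℝ, BoundedProb μ ∧ (∀ᵐ x ∂μ, x ∈ spectrum ℝ J) ∧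
      ∀ p : Polynomial ℝ, ∫ x, p.eval x ∂μ = (inner ℂ e (Polynomial.aeval J p e)).re := by
  obtain ⟨μ, hμ, hspec, hp⟩ := exists_spectral_measure hJ he
  have hae : ∀ᵐ x ∂μ, x ∈ spectrum ℝ J := hspec
  obtain ⟨R, hR⟩ := (spectrum.isCompact (𝕜 := ℝ) J).isBounded.subset_closedBall 0
  refine ⟨μ, ⟨hμ, R, ?_⟩, hae, hp⟩
  filter_upwards [hae] with x hx
  simpa using hR hx

/-! ### Spectral measures with prescribed polynomial integrals -/

section Existence

variable {E : Type*} [NormedAddCommGroup E] [InnerProductSpace ℂ E] [CompleteSpace E]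
  {S : E →L[ℂ] E} {e : E}

lemma exists_transition_measure_of_shift (he1 : ‖e‖ = 1) (hS : star S * S = 1) (he : star S e = 0)
    {α s t x : ℝ} (hs : 0 ≤ s) (hst : s ≤ t) (hx : 0 ≤ 1 + α * x) :
    ∃ μ : Measure ℝ, BoundedProb μ ∧ (∀ᵐ y ∂μ, 0 ≤ 1 + α * y) ∧
      ∀ n, ∫ y, (polyQ (α * t) t n).eval y ∂μ = (polyQ (α * s) s n).eval x := by
  have hr : √t ^ 2 = t := Real.sq_sqrt (hs.trans hst)
  have hu : √(t - s) ^ 2 = t - s := Real.sq_sqrt (by linarith)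
  have hd : √(1 + α * x) ^ 2 = 1 + α * x := Real.sq_sqrt hx
  have hc : (√(t - s) * √(1 + α * x)) ^ 2 = (t - s) * (1 + α * x) := by rw [mul_pow, hu, hd]
  set J := jacobiOp S x (α * t) (α * s) √t (√(t - s) * √(1 + α * x)) with hJ
  obtain ⟨μ, hμ, hspec, hp⟩ := exists_spectral_boundedProb
    (isSelfAdjoint_jacobiOp S x (α * t) (α * s) √t (√(t - s) * √(1 + α * x))) he1
  refine ⟨μ, hμ, ?_, fun n => ?_⟩
  -- Since 1 + αJ = B*B is positive, the spectrum of J lies where 1 + αy ≥ 0. Almost every endpoint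
  -- is thus again an admissible starting point.
  · have hfac := jacobi_factorization hS α √t √(t - s) √(1 + α * x)
    rw [hr, hu, hd] at hfac
    set B : E →L[ℂ] E := 1 + (α * √t) • star S +
      (√(1 + α * x) - 1) • (1 - S * star S) +
      (α * (√(t - s) - √t)) • ((1 - S * star S) * star S) with hB
    have hstar : star B = 1 + (α * √t) • S + (√(1 + α * x) - 1) • (1 - S * star S) +
      (α * (√(t - s) - √t)) • (S * (1 - S * star S)) := by
      simp only [hB, star_add, star_sub, star_smul, star_mul, star_star, star_one, star_trivial]
    have hJB : Polynomial.aeval J (1 + Polynomial.C α * Polynomial.X) = star B * B := by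
      rw [hstar, hfac]
      simp only [map_add, map_one, map_mul, Polynomial.aeval_C, Polynomial.aeval_X,
        ← Algebra.smul_def, hJ, jacobiOp]
      module
    filter_upwards [hspec] with y hy
    have h1 : (1 + Polynomial.C α * Polynomial.X).eval y ∈ spectrum ℝ (star B * B) := by
      rw [← hJB]
      exact spectrum.subset_polynomial_aeval J _ ⟨y, hy, rfl⟩
    have h2 := spectrum_nonneg_of_nonneg (star_mul_self_nonneg B) h1
    simpa using h2
  · rw [hp, aeval_polyQ_jacobiOp hS he hr hc, inner_add_right, Complex.add_re,
      re_inner_real_smul, re_inner_real_smul, inner_shiftPart hS he, inner_self_eq_norm_sq_to_K,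
      he1]
    simp

/-- For J = a + √b(S + S*) the polynomials give U_n(J)e = √bⁿ Sⁿe, which is orthogonal to e for n ≥
1. -/
lemma exists_polyU_measure_of_shift (he1 : ‖e‖ = 1) (hS : star S * S = 1) (he : star S e = 0)
    (a : ℝ) {b : ℝ} (hb : 0 ≤ b) :
    ∃ μ : Measure ℝ, BoundedProb μ ∧ ∀ n, 1 ≤ n → ∫ y, (polyU a b n).eval y ∂μ = 0 := by
  have hr : √b ^ 2 = b := Real.sq_sqrt hb
  have hJ : IsSelfAdjoint (a • 1 + √b • (S + star S)) := by
    simp only [IsSelfAdjoint, star_add, star_smul, star_star, star_one, star_trivial]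
    rw [add_comm (star S)]
  obtain ⟨μ, hμ, -, hp⟩ := exists_spectral_boundedProb hJ he1
  have key : ∀ n, Polynomial.aeval (a • 1 + √b • (S + star S)) (polyU a b n) e =
      √b ^ n • (S ^ n) e := by
    intro n
    induction n using Nat.strong_induction_on with
    | _ n ih =>
      match n with
      | 0 => simp [polyU]
      | 1 =>
        simp [polyU, ContinuousLinearMap.algebraMap_apply, he]
      | n + 2 =>
        rw [polyU_rec_apply, ih (n + 1) (by omega), ih n (by omega)]
        simp only [ContinuousLinearMap.map_smul_of_tower, add_apply, smul_apply, one_apply_eq_self, pow_succ' S,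
          mul_apply_eq_comp, shift_apply hS]
        linear_combination (norm := module) (√b ^ n * hr) • (S ^ n) e
  refine ⟨μ, hμ, fun n hn => ?_⟩
  obtain ⟨n, rfl⟩ := Nat.exists_eq_add_of_le' hn
  rw [hp, key, re_inner_real_smul, pow_succ' S, mul_apply_eq_comp,
    ← ContinuousLinearMap.adjoint_inner_left, ← ContinuousLinearMap.star_eq_adjoint, he,
    inner_zero_left]
  simp

end Existence

/-- The existence of transition probabilities. -/
lemma exists_transition_measure {α s t x : ℝ} (hs : 0 ≤ s) (hst : s ≤ t) (hx : 0 ≤ 1 + α * x) :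
    ∃ μ : Measure ℝ, BoundedProb μ ∧ (∀ᵐ y ∂μ, 0 ≤ 1 + α * y) ∧
      ∀ n, ∫ y, (polyQ (α * t) t n).eval y ∂μ = (polyQ (α * s) s n).eval x := by
  obtain ⟨S, e, he1, hS, he⟩ := exists_shift
  exact exists_transition_measure_of_shift he1 hS he hs hst hx

/-- The existence of the measures with constant Jacobi parameters. -/
lemma exists_polyU_measure (a : ℝ) {b : ℝ} (hb : 0 ≤ b) :
    ∃ μ : Measure ℝ, BoundedProb μ ∧ ∀ n, 1 ≤ n → ∫ y, (polyU a b n).eval y ∂μ = 0 := by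
  obtain ⟨S, e, he1, hS, he⟩ := exists_shift
  exact exists_polyU_measure_of_shift he1 hS he a hb

/-! ### Measures with bounded support -/

section Bounded

variable {μ ν : Measure ℝ}

lemma BoundedProb.integrable (hμ : BoundedProb μ) {f : ℝ → ℝ} (hf : Continuous f) :
    Integrable f μ := by
  have := hμ.prob
  obtain ⟨R, hR⟩ := hμ.bounded
  obtain ⟨C, hC⟩ := (isCompact_Icc (a := -R) (b := R)).exists_bound_of_continuousOn hf.continuousOn
  refine Integrable.of_bound hf.aestronglyMeasurable C ?_
  filter_upwards [hR] with x hx using hC x (abs_le.1 hx)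

lemma BoundedProb.memLp (hμ : BoundedProb μ) {f : ℝ → ℝ} (hf : Continuous f) :
    MemLp f 2 μ := by
  refine (memLp_two_iff_integrable_sq hf.aestronglyMeasurable).2 (hμ.integrable (by fun_prop))

/-- The windows [-k, k] grow, so that one sequence serves all boundedly supported measures at once,
as needed for measurability of a kernel. -/
lemma exists_poly_seq {f : ℝ → ℝ} (hf : Continuous f) :
    ∃ p : ℕ → Polynomial ℝ, ∀ k : ℕ, ∀ x : ℝ, |x| ≤ k → |(p k).eval x - f x| < 1 / ((k : ℝ) + 1) := by
  choose p hp using fun k : ℕ => exists_polynomial_near_of_continuousOn (-(k : ℝ)) k f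
    hf.continuousOn (1 / ((k : ℝ) + 1)) (by positivity)
  exact ⟨p, fun k x hx => hp k x (abs_le.1 hx)⟩

lemma BoundedProb.tendsto_integral (hμ : BoundedProb μ) {f : ℝ → ℝ} (hf : Continuous f)
    {p : ℕ → Polynomial ℝ}
    (hp : ∀ k : ℕ, ∀ x : ℝ, |x| ≤ k → |(p k).eval x - f x| < 1 / ((k : ℝ) + 1)) :
    Tendsto (fun k => ∫ x, (p k).eval x ∂μ) atTop (𝓝 (∫ x, f x ∂μ)) := by
  have := hμ.prob
  obtain ⟨R, hR⟩ := hμ.bounded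
  rw [tendsto_iff_dist_tendsto_zero]
  refine squeeze_zero' (Eventually.of_forall fun _ => dist_nonneg) ?_
    (tendsto_one_div_add_atTop_nhds_zero_nat (𝕜 := ℝ))
  filter_upwards [eventually_ge_atTop ⌈R⌉₊] with k hk
  rw [Real.dist_eq, ← integral_sub (hμ.integrable (p k).continuous) (hμ.integrable hf)]
  have h := norm_integral_le_of_norm_le_const (μ := μ) (f := fun x => (p k).eval x - f x)
    (C := 1 / ((k : ℝ) + 1)) (by
      filter_upwards [hR] with x hx
      exact (hp k x (hx.trans ((Nat.le_ceil R).trans (by exact_mod_cast hk)))).le)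
  simpa using h

lemma integral_eval_eq (hν : ∀ n : ℕ, Integrable (fun x : ℝ => x ^ n) ν) (p : Polynomial ℝ) :
    Integrable (fun x => p.eval x) ν ∧
      ∫ x, p.eval x ∂ν = ∑ i ∈ Finset.range (p.natDegree + 1), p.coeff i * ∫ x, x ^ i ∂ν := by
  simp only [Polynomial.eval_eq_sum_range]
  refine ⟨integrable_finsetSum _ fun i _ => (hν i).const_mul _, ?_⟩
  rw [integral_finsetSum _ fun i _ => (hν i).const_mul _]
  simp only [integral_const_mul]

/-- Markov's inequality for the power 2n bounds the mass of {|x| > r} by (|R|/r)^(2n), which tends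
to 0 since r = |R| + 1. -/
lemma BoundedProb.of_moments [IsProbabilityMeasure ν] (hμ : BoundedProb μ)
    (hi : ∀ p : Polynomial ℝ, Integrable (fun x => p.eval x) ν)
    (he : ∀ p : Polynomial ℝ, ∫ x, p.eval x ∂ν = ∫ x, p.eval x ∂μ) : BoundedProb ν := by
  have := hμ.prob
  obtain ⟨R, hR⟩ := hμ.bounded
  set r := |R| + 1 with hr
  have hr0 : 0 < r := by positivity
  refine ⟨inferInstance, r, ?_⟩
  have hbound : ∀ n : ℕ, ν.real {x | r < |x|} ≤ (|R| / r) ^ (2 * n) := by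
    intro n
    have h1 := mul_meas_ge_le_integral_of_nonneg (μ := ν) (f := fun x : ℝ => x ^ (2 * n))
      (Eventually.of_forall fun x => by simpa using (even_two_mul n).pow_nonneg x)
      (by simpa using hi (Polynomial.X ^ (2 * n))) (r ^ (2 * n))
    have h2 : ∫ x, x ^ (2 * n) ∂ν ≤ |R| ^ (2 * n) := by
      have := he (Polynomial.X ^ (2 * n))
      simp only [Polynomial.eval_pow, Polynomial.eval_X] at this
      rw [this]
      calc ∫ x, x ^ (2 * n) ∂μ ≤ ∫ _, |R| ^ (2 * n) ∂μ := by
            refine integral_mono_ae (hμ.integrable (by fun_prop)) (integrable_const _) ?_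
            filter_upwards [hR] with x hx
            rw [← (even_two_mul n).pow_abs]
            exact pow_le_pow_left₀ (abs_nonneg x) (hx.trans (le_abs_self R)) _
        _ = |R| ^ (2 * n) := by simp
    have h3 : ν.real {x | r < |x|} ≤ ν.real {x | r ^ (2 * n) ≤ x ^ (2 * n)} := by
      refine measureReal_mono fun x hx => ?_
      simp only [Set.mem_ofPred_eq] at hx ⊢
      rw [← (even_two_mul n).pow_abs x]
      exact pow_le_pow_left₀ hr0.le hx.le _
    rw [div_pow, le_div_iff₀ (by positivity), mul_comm]
    calc r ^ (2 * n) * ν.real {x | r < |x|}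
        ≤ r ^ (2 * n) * ν.real {x | r ^ (2 * n) ≤ x ^ (2 * n)} := by gcongr
      _ ≤ _ := h1.trans h2
  have hlim : Tendsto (fun n : ℕ => (|R| / r) ^ (2 * n)) atTop (𝓝 0) := by
    simp only [pow_mul]
    refine tendsto_pow_atTop_nhds_zero_of_lt_one (by positivity) ?_
    have : |R| / r < 1 := by rw [div_lt_one hr0]; linarith
    exact pow_lt_one₀ (by positivity) this (by norm_num)
  have h0 : ν.real {x | r < |x|} = 0 :=
    le_antisymm (ge_of_tendsto' hlim hbound) measureReal_nonneg
  rw [ae_iff]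
  simp only [not_le]
  simpa [measureReal_def, ENNReal.toReal_eq_zero_iff] using h0

lemma BoundedProb.ext (hμ : BoundedProb μ) (hν : BoundedProb ν)
    (he : ∀ p : Polynomial ℝ, ∫ x, p.eval x ∂ν = ∫ x, p.eval x ∂μ) : ν = μ := by
  have := hμ.prob
  have := hν.prob
  refine ext_of_forall_integral_eq_of_IsFiniteMeasure fun f => ?_
  obtain ⟨p, hp⟩ := exists_poly_seq f.continuous
  have h1 := hμ.tendsto_integral f.continuous hp
  have h2 := hν.tendsto_integral f.continuous hp
  simp only [he] at h2
  exact tendsto_nhds_unique h2 h1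

lemma BoundedProb.dirac (x : ℝ) : BoundedProb (Measure.dirac x) :=
  ⟨inferInstance, |x|, by simp [ae_dirac_eq]⟩

/-- Measurability passes from polynomials to continuous functions by approximation with a sequence
independent of x. Piecewise linear functions decreasing to the indicators of closed half-lines then
reach a π-system. -/
lemma measurable_of_forall_poly {κ : ℝ → Measure ℝ} (hκ : ∀ x, BoundedProb (κ x))
    (hp : ∀ p : Polynomial ℝ, Measurable fun x => ∫ y, p.eval y ∂κ x) : Measurable κ := by
  have := fun x => (hκ x).prob
  have hcont : ∀ f : ℝ → ℝ, Continuous f → Measurable fun x => ∫ y, f y ∂κ x := by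
    intro f hf
    obtain ⟨p, hpf⟩ := exists_poly_seq hf
    exact measurable_of_tendsto_metrizable (fun k => hp (p k))
      (tendsto_pi_nhds.2 fun x => (hκ x).tendsto_integral hf hpf)
  refine Measurable.measure_of_isPiSystem_of_isProbabilityMeasure (borel_eq_generateFrom_Iic ℝ)
    isPiSystem_Iic ?_
  rintro _ ⟨a, rfl⟩
  set f : ℕ → ℝ → ℝ := fun n y => max 0 (1 - n * max 0 (y - a)) with hf
  have hfc : ∀ n, Continuous (f n) := fun n => by fun_prop
  have hlim : ∀ x, Tendsto (fun n => ∫ y, f n y ∂κ x) atTop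
      (𝓝 (∫ y, (Set.Iic a).indicator (fun _ => (1 : ℝ)) y ∂κ x)) := by
    intro x
    refine tendsto_integral_of_dominated_convergence (fun _ => 1)
      (fun n => (hfc n).aestronglyMeasurable) (integrable_const _)
      (fun n => Eventually.of_forall fun y => ?_) (Eventually.of_forall fun y => ?_)
    · simp only [hf]
      rw [Real.norm_of_nonneg (le_max_left _ _)]
      have : 0 ≤ (n : ℝ) * max 0 (y - a) := by positivity
      exact max_le zero_le_one (by linarith)
    · by_cases hy : y ≤ a
      · have h1 : ∀ n, f n y = 1 := fun n => by
          simp [hf, max_eq_left (sub_nonpos.2 hy)]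
        simp [h1, Set.indicator_of_mem (Set.mem_Iic.2 hy)]
      · rw [not_le] at hy
        rw [Set.indicator_of_notMem (by simpa using hy)]
        refine tendsto_const_nhds.congr' ?_
        obtain ⟨N, hN⟩ := exists_nat_gt (1 / (y - a))
        filter_upwards [eventually_ge_atTop N] with n hn
        have h0 : 0 < y - a := sub_pos.2 hy
        have h1 : 1 ≤ (n : ℝ) * (y - a) := by
          rw [← div_le_iff₀ h0]
          exact hN.le.trans (by exact_mod_cast hn)
        simp only [hf]
        rw [max_eq_right h0.le, max_eq_left (by linarith)]
  have hm := measurable_of_tendsto_metrizable (fun n => hcont (f n) (hfc n))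
    (tendsto_pi_nhds.2 hlim)
  have e : (fun x => κ x (Set.Iic a)) = fun x =>
      ENNReal.ofReal (∫ y, (Set.Iic a).indicator (fun _ => (1 : ℝ)) y ∂κ x) := by
    funext x
    rw [integral_indicator_const _ measurableSet_Iic]
    simp [measureReal_def]
  rw [e]
  exact ENNReal.measurable_ofReal.comp hm

end Bounded

/-! ### The transition functions -/

/-- The times and positions for which the transition probability is not trivial. -/
def GoodPoint (α s t x : ℝ) : Prop := (0 ≤ s ∧ s ≤ t) ∧ 0 ≤ 1 + α * x

open Classical in
/-- The transition probabilities. -/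
noncomputable def transMeas (α s t x : ℝ) : Measure ℝ :=
  if h : GoodPoint α s t x then (exists_transition_measure h.1.1 h.1.2 h.2).choose
  -- Off the half-line the kernels are frozen, which keeps them Markov and preserves
  -- Chapman–Kolmogorov at points that the process started at 0 does not visit.
  else Measure.dirac x

lemma transMeas_boundedProb (α s t x : ℝ) : BoundedProb (transMeas α s t x) := by
  unfold transMeas
  split_ifs with h
  · exact (exists_transition_measure h.1.1 h.1.2 h.2).choose_spec.1
  · exact BoundedProb.dirac x

lemma transMeas_of_not {α s t x : ℝ} (h : ¬ GoodPoint α s t x) :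
    transMeas α s t x = Measure.dirac x := dif_neg h

lemma transMeas_support {α s t x : ℝ} (h : GoodPoint α s t x) :
    ∀ᵐ y ∂transMeas α s t x, 0 ≤ 1 + α * y := by
  rw [transMeas, dif_pos h]
  exact (exists_transition_measure h.1.1 h.1.2 h.2).choose_spec.2.1

/-- Integration of polynomials with respect to a measure of bounded support. -/
lemma BoundedProb.exists_linearMap {μ : Measure ℝ} (hμ : BoundedProb μ) :
    ∃ L : Polynomial ℝ →ₗ[ℝ] ℝ, ∀ p, L p = ∫ y, p.eval y ∂μ :=
  ⟨{ toFun := fun p => ∫ y, p.eval y ∂μ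
     map_add' := fun p q => by
      simp only [Polynomial.eval_add]
      exact integral_add (hμ.integrable p.continuous) (hμ.integrable q.continuous)
     map_smul' := fun c p => by
      simp only [Polynomial.eval_smul, RingHom.id_apply, smul_eq_mul]
      exact integral_const_mul c _ }, fun _ => rfl⟩

lemma integral_transMeas {α s t x : ℝ} (h : GoodPoint α s t x) (p : Polynomial ℝ) :
    ∫ y, p.eval y ∂transMeas α s t x = (transOp α s t p).eval x := by
  obtain ⟨L, hL⟩ := (transMeas_boundedProb α s t x).exists_linearMap
  have : L = (Polynomial.leval x) ∘ₗ transOp α s t := polyQ_ext (α * t) t fun n => by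
    rw [hL, LinearMap.comp_apply, transOp_polyQ]
    simp only [transMeas, dif_pos h]
    exact (exists_transition_measure h.1.1 h.1.2 h.2).choose_spec.2.2 n
  rw [← hL, this]
  rfl

lemma measurable_transMeas (α s t : ℝ) : Measurable (transMeas α s t) := by
  refine measurable_of_forall_poly (transMeas_boundedProb α s t) fun p => ?_
  classical
  have e : (fun x => ∫ y, p.eval y ∂transMeas α s t x) =
      fun x => if GoodPoint α s t x then (transOp α s t p).eval x else p.eval x := by
    funext x
    split_ifs with h
    · exact integral_transMeas h p
    · rw [transMeas_of_not h, integral_dirac]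
  rw [e]
  refine Measurable.ite ?_ (Polynomial.continuous _).measurable (Polynomial.continuous _).measurable
  have hm : MeasurableSet {x : ℝ | 0 ≤ 1 + α * x} :=
    measurableSet_le measurable_const (by fun_prop)
  exact (MeasurableSet.const (0 ≤ s ∧ s ≤ t)).inter hm

/-- The transition functions. -/
noncomputable def transKernel (α s t : ℝ) : Kernel ℝ ℝ := ⟨transMeas α s t, measurable_transMeas α s t⟩

lemma transKernel_apply (α s t x : ℝ) : transKernel α s t x = transMeas α s t x := rfl

instance (α s t : ℝ) : IsMarkovKernel (transKernel α s t) :=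
  ⟨fun x => (transMeas_boundedProb α s t x).prob⟩

lemma ae_integral_transKernel {α r s t x : ℝ} (h : GoodPoint α r s x) (hst : s ≤ t)
    (p : Polynomial ℝ) : ∀ᵐ y ∂transKernel α r s x,
      ∫ z, p.eval z ∂transKernel α s t y = (transOp α s t p).eval y := by
  filter_upwards [transMeas_support h] with y hy
  exact integral_transMeas ⟨⟨h.1.1.trans h.1.2, hst⟩, hy⟩ p

lemma abs_le_one_add_sq (a : ℝ) : |a| ≤ 1 + a ^ 2 := by
  nlinarith [sq_nonneg (|a| - 1), sq_abs a, abs_nonneg a]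

/-- The polynomial integrals of both sides agree by `transOp_comp`. Bounded support of the
composition is not known beforehand and is inferred from its moments; then moments determine the
measure. -/
lemma transKernel_comp {α r s t : ℝ} (hr : 0 ≤ r) (hrs : r ≤ s) (hst : s ≤ t) :
    transKernel α s t ∘ₖ transKernel α r s = transKernel α r t := by
  ext1 x
  by_cases hx : 0 ≤ 1 + α * x
  · have h : GoodPoint α r s x := ⟨⟨hr, hrs⟩, hx⟩
    have h' : GoodPoint α r t x := ⟨⟨hr, hrs.trans hst⟩, hx⟩
    have hb := transMeas_boundedProb α r s x
    have hint : ∀ p : Polynomial ℝ,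
        Integrable (fun y => p.eval y) ((transKernel α s t ∘ₖ transKernel α r s) x) := by
      intro p
      refine (integrable_comp_iff p.continuous.aestronglyMeasurable).2
        ⟨Eventually.of_forall fun y => (transMeas_boundedProb α s t y).integrable p.continuous, ?_⟩
      have hm : StronglyMeasurable fun y => ∫ z, ‖p.eval z‖ ∂transKernel α s t y :=
        (p.continuous.stronglyMeasurable.norm).integral_kernel
      -- The absolute value is dominated by 1 + p², whose conditional integral is again a
      -- polynomial.
      refine (hb.integrable (transOp α s t (1 + p ^ 2)).continuous).mono' hm.aestronglyMeasurable ?_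
      filter_upwards [ae_integral_transKernel h hst (1 + p ^ 2)] with y hy
      rw [← hy, Real.norm_of_nonneg (integral_nonneg fun _ => norm_nonneg _)]
      refine integral_mono ((transMeas_boundedProb α s t y).integrable (by fun_prop))
        ((transMeas_boundedProb α s t y).integrable (by fun_prop)) fun z => ?_
      simpa using abs_le_one_add_sq (p.eval z)
    have heq : ∀ p : Polynomial ℝ,
        ∫ y, p.eval y ∂((transKernel α s t ∘ₖ transKernel α r s) x) =
          ∫ y, p.eval y ∂(transKernel α r t x) := by
      intro p
      rw [Kernel.integral_comp (hint p), integral_congr_ae (ae_integral_transKernel h hst p)]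
      rw [transKernel_apply, transKernel_apply, integral_transMeas h, integral_transMeas h',
        transOp_comp]
    exact (transMeas_boundedProb α r t x).ext
      ((transMeas_boundedProb α r t x).of_moments hint heq) heq
  · have h1 : ∀ r s, transKernel α r s x = Measure.dirac x := fun r s =>
      transMeas_of_not fun h => hx h.2
    rw [Kernel.comp_apply, h1, h1, Measure.dirac_bind (Kernel.measurable _), h1]

/-! ### Integrals along paths -/

section Paths

variable {K : ℝ → ℝ → Kernel ℝ ℝ}

lemma isMarkovKernel_pathKernel (hK : ∀ s t, IsMarkovKernel (K s t)) (n : ℕ) (s : ℝ)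
    (τ : Fin n → ℝ) : IsMarkovKernel (pathKernel K n s τ) := by
  induction n generalizing s with
  | zero => rw [pathKernel]; infer_instance
  | succ n ih =>
    have := hK s (τ 0)
    have := ih (τ 0) (Fin.tail τ)
    rw [pathKernel]
    exact Kernel.IsMarkovKernel.map _ (by fun_prop)

lemma measurable_cons_pair (n : ℕ) :
    Measurable fun p : ℝ × (Fin n → ℝ) => (Fin.cons p.1 p.2 : Fin (n + 1) → ℝ) := by
  fun_prop

lemma integrable_pathKernel_succ (hK : ∀ s t, IsMarkovKernel (K s t)) {n : ℕ} {s x : ℝ}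
    {τ : Fin (n + 1) → ℝ} {g : (Fin (n + 1) → ℝ) → ℝ} (hg : Continuous g) :
    Integrable g (pathKernel K (n + 1) s τ x) ↔
      (∀ᵐ y ∂K s (τ 0) x, Integrable (fun z : Fin n → ℝ => g (Fin.cons y z))
        (pathKernel K n (τ 0) (Fin.tail τ) y)) ∧
      Integrable (fun y => ∫ z, ‖g (Fin.cons y z)‖ ∂pathKernel K n (τ 0) (Fin.tail τ) y)
        (K s (τ 0) x) := by
  have := hK s (τ 0)
  have := isMarkovKernel_pathKernel hK n (τ 0) (Fin.tail τ)
  rw [pathKernel, Kernel.map_apply _ (measurable_cons_pair n),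
    integrable_map_measure hg.aestronglyMeasurable (measurable_cons_pair n).aemeasurable,
    integrable_compProd_iff
      (hg.measurable.comp (measurable_cons_pair n)).aestronglyMeasurable]
  rfl

lemma integral_pathKernel_succ (hK : ∀ s t, IsMarkovKernel (K s t)) {n : ℕ} {s x : ℝ}
    {τ : Fin (n + 1) → ℝ} {g : (Fin (n + 1) → ℝ) → ℝ} (hg : Continuous g)
    (hi : Integrable g (pathKernel K (n + 1) s τ x)) :
    ∫ z, g z ∂pathKernel K (n + 1) s τ x =
      ∫ y, ∫ z, g (Fin.cons y z) ∂pathKernel K n (τ 0) (Fin.tail τ) y ∂K s (τ 0) x := by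
  have := hK s (τ 0)
  have := isMarkovKernel_pathKernel hK n (τ 0) (Fin.tail τ)
  rw [pathKernel, Kernel.map_apply _ (measurable_cons_pair n)] at hi ⊢
  rw [integral_map (measurable_cons_pair n).aemeasurable hg.aestronglyMeasurable]
  rw [integrable_map_measure hg.aestronglyMeasurable (measurable_cons_pair n).aemeasurable] at hi
  exact integral_compProd hi

lemma pathKernel_zero_apply (s x : ℝ) (τ : Fin 0 → ℝ) :
    pathKernel K 0 s τ x = Measure.dirac Fin.elim0 := by
  rw [pathKernel, Kernel.const_apply]

/-- The conditional mixed moments of a path, as polynomials in the initial point. -/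
noncomputable def pathPoly (α : ℝ) : (n : ℕ) → ℝ → (Fin n → ℝ) → (Fin n → ℕ) → Polynomial ℝ
  | 0, _, _, _ => 1
  | n + 1, s, τ, k =>
    transOp α s (τ 0) (Polynomial.X ^ k 0 * pathPoly α n (τ 0) (Fin.tail τ) (Fin.tail k))

lemma prod_cons_pow {n : ℕ} (y : ℝ) (z : Fin n → ℝ) (k : Fin (n + 1) → ℕ) :
    ∏ i, (Fin.cons y z : Fin (n + 1) → ℝ) i ^ k i = y ^ k 0 * ∏ i, z i ^ Fin.tail k i := by
  rw [Fin.prod_univ_succ]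
  simp [Fin.tail]

/-- The induction runs over all starting points with 1 + αx ≥ 0, because the first step almost
surely stays in that half-line and the remaining path starts there. -/
lemma pathKernel_moments {α : ℝ} (n : ℕ) {s x : ℝ} {τ : Fin n → ℝ} (hs : 0 ≤ s)
    (hτ : StrictMono τ) (hsτ : ∀ i, s ≤ τ i) (hx : 0 ≤ 1 + α * x) (k : Fin n → ℕ) :
    Integrable (fun z => ∏ i, z i ^ k i) (pathKernel (transKernel α) n s τ x) ∧
      ∫ z, ∏ i, z i ^ k i ∂pathKernel (transKernel α) n s τ x =
        (pathPoly α n s τ k).eval x := by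
  have hK : ∀ s t, IsMarkovKernel (transKernel α s t) := fun s t => inferInstance
  induction n generalizing s x with
  | zero =>
    rw [pathKernel_zero_apply]
    simp [pathPoly]
  | succ n ih =>
    have hτ0 : 0 ≤ τ 0 := hs.trans (hsτ 0)
    have hτ' : StrictMono (Fin.tail τ) := fun i j hij => hτ (Fin.succ_lt_succ_iff.2 hij)
    have hτ0' : ∀ i, τ 0 ≤ Fin.tail τ i := fun i => hτ.monotone (Fin.zero_le _)
    have hgood : GoodPoint α s (τ 0) x := ⟨⟨hs, hsτ 0⟩, hx⟩
    have hb := transMeas_boundedProb α s (τ 0) x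
    have hM := isMarkovKernel_pathKernel hK n (τ 0) (Fin.tail τ)
    have hi : Integrable (fun z => ∏ i, z i ^ k i)
        (pathKernel (transKernel α) (n + 1) s τ x) := by
      refine (integrable_pathKernel_succ hK (by fun_prop)).2 ⟨?_, ?_⟩
      · filter_upwards [transMeas_support hgood] with y hy
        simp only [prod_cons_pow]
        exact (ih hτ0 hτ' hτ0' hy (Fin.tail k)).1.const_mul _
      · have hm : StronglyMeasurable fun y => ∫ z : Fin n → ℝ,
            ‖∏ i, (Fin.cons y z : Fin (n + 1) → ℝ) i ^ k i‖
              ∂pathKernel (transKernel α) n (τ 0) (Fin.tail τ) y := by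
          refine StronglyMeasurable.integral_kernel_prod_right'
            (f := fun p : ℝ × (Fin n → ℝ) => ‖∏ i, (Fin.cons p.1 p.2 : Fin (n + 1) → ℝ) i ^ k i‖) ?_
          simp only [prod_cons_pow]
          exact Continuous.stronglyMeasurable (by fun_prop)
        -- The inner absolute moment is bounded by one plus the moment with doubled exponents, which
        -- the induction hypothesis makes a polynomial in y.
        refine (hb.integrable (f := fun y => |y ^ k 0| *
          (1 + (pathPoly α n (τ 0) (Fin.tail τ) (fun i => 2 * Fin.tail k i)).eval y))
          (by fun_prop)).mono' hm.aestronglyMeasurable ?_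
        filter_upwards [transMeas_support hgood] with y hy
        rw [Real.norm_of_nonneg (integral_nonneg fun _ => norm_nonneg _)]
        simp only [prod_cons_pow, norm_mul, Real.norm_eq_abs]
        rw [integral_const_mul]
        refine mul_le_mul_of_nonneg_left ?_ (abs_nonneg _)
        have h2 := ih hτ0 hτ' hτ0' hy (fun i => 2 * Fin.tail k i)
        rw [← h2.2]
        have e1 : (1 : ℝ) = ∫ _, (1 : ℝ) ∂pathKernel (transKernel α) n (τ 0) (Fin.tail τ) y := by
          simp
        nth_rewrite 1 [e1]
        rw [← integral_add (integrable_const _) h2.1]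
        refine integral_mono (ih hτ0 hτ' hτ0' hy (Fin.tail k)).1.abs
          ((integrable_const _).add h2.1) fun z => ?_
        have := abs_le_one_add_sq (∏ i, z i ^ Fin.tail k i)
        simpa [← Finset.prod_pow, pow_mul', mul_comm] using this
    refine ⟨hi, ?_⟩
    rw [integral_pathKernel_succ hK (by fun_prop) hi, pathPoly, ← integral_transMeas hgood]
    refine integral_congr_ae ?_
    filter_upwards [transMeas_support hgood] with y hy
    simp only [prod_cons_pow]
    rw [integral_const_mul, (ih hτ0 hτ' hτ0' hy (Fin.tail k)).2]
    simp

end Paths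

/-! ### Distributions and the classical version -/

lemma polyU_ext {M : Type*} [AddCommGroup M] [Module ℝ M] (a b : ℝ)
    {f g : Polynomial ℝ →ₗ[ℝ] M} (h : ∀ n, f (polyU a b n) = g (polyU a b n)) : f = g :=
  polyQ_ext a b fun n => by
    cases n with
    | zero => exact h 0
    | succ n => rw [polyQ_succ, ← Polynomial.smul_eq_C_mul, map_add, map_add, map_smul, map_smul, h, h]

section Version

variable {A : Type*} [Ring A] [Algebra ℂ A] {φ ψ χ : A →ₗ[ℂ] ℂ} {α T : ℝ} {X : ℝ → A}

lemma map_aeval_zero (h1 : χ 1 = 1) (p : Polynomial ℝ) :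
    χ (Polynomial.aeval (0 : A) p) = ((p.eval 0 : ℝ) : ℂ) := by
  have : Polynomial.aeval (0 : A) p = algebraMap ℝ A (p.eval 0) * 1 := by
    rw [← map_zero (algebraMap ℝ A), Polynomial.aeval_algebraMap_apply, mul_one]
    simp
  rw [this, map_algebraMap_mul, h1, mul_one]

lemma transOp_self (α t : ℝ) (p : Polynomial ℝ) : transOp α t t p = p := by
  have : transOp α t t = LinearMap.id := polyQ_ext (α * t) t fun n => transOp_polyQ α t t n
  rw [this, LinearMap.id_apply]

/-- The functional on polynomials given by an element. -/
noncomputable def polyFunctional (χ : A →ₗ[ℂ] ℂ) (a : A) : Polynomial ℝ →ₗ[ℝ] ℂ :=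
  χ.restrictScalars ℝ ∘ₗ (Polynomial.aeval a).toLinearMap

lemma polyFunctional_apply (χ : A →ₗ[ℂ] ℂ) (a : A) (p : Polynomial ℝ) :
    polyFunctional χ a p = χ (Polynomial.aeval a p) := rfl

lemma isDistribution_of_poly {a : A} {μ : Measure ℝ} (hμ : BoundedProb μ)
    (h : ∀ p : Polynomial ℝ, ((∫ x, p.eval x ∂μ : ℝ) : ℂ) = χ (Polynomial.aeval a p)) :
    IsDistribution χ a μ where
  prob := hμ.prob
  integrable n := hμ.integrable (by fun_prop)
  moment n := by simpa using h (Polynomial.X ^ n)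

lemma IsDistribution.poly {a : A} {μ : Measure ℝ} (h : IsDistribution χ a μ) (p : Polynomial ℝ) :
    Integrable (fun x => p.eval x) μ ∧
      ((∫ x, p.eval x ∂μ : ℝ) : ℂ) = χ (Polynomial.aeval a p) := by
  obtain ⟨h1, h2⟩ := integral_eval_eq h.integrable p
  refine ⟨h1, ?_⟩
  rw [h2, Polynomial.aeval_eq_sum_range, map_sum]
  push_cast
  refine Finset.sum_congr rfl fun i _ => ?_
  rw [Algebra.smul_def, map_algebraMap_mul, h.moment]

lemma IsDistribution.boundedProb {a : A} {μ μ' : Measure ℝ} (h : IsDistribution χ a μ)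
    (h' : IsDistribution χ a μ') (hμ' : BoundedProb μ') : BoundedProb μ := by
  have := h.prob
  exact hμ'.of_moments (fun p => (h.poly p).1) fun p => by
    exact_mod_cast (h.poly p).2.trans (h'.poly p).2.symm

variable [StarRing A] (hφ1 : φ 1 = 1) (hT : 0 < T) (hX : IsTwoStateFBM φ ψ α T X) (hψ1 : ψ 1 = 1)

include hφ1 hT hX hψ1 in
lemma phi_aeval {t : ℝ} (ht : t ∈ Set.Icc 0 T) (p : Polynomial ℝ) :
    φ (Polynomial.aeval (X t) p) = (((transOp α 0 t p).eval 0 : ℝ) : ℂ) := by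
  rcases ht.1.eq_or_lt with rfl | h0
  · rw [transOp_self, hX.zero, map_aeval_zero hφ1]
  · have := phi_mul_aeval hφ1 hT hX hψ1 le_rfl h0 ht.2 (one_mem (pastAlg X 0)) p
    rwa [one_mul, one_mul, hX.zero, map_aeval_zero hφ1] at this

include hφ1 hT hX hψ1 in
lemma isDistribution_transMeas {t : ℝ} (ht : t ∈ Set.Icc 0 T) :
    IsDistribution φ (X t) (transMeas α 0 t 0) :=
  isDistribution_of_poly (transMeas_boundedProb α 0 t 0) fun p => by
    rw [integral_transMeas ⟨⟨le_rfl, ht.1⟩, by simp⟩, phi_aeval hφ1 hT hX hψ1 ht]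

include hT hX hψ1 in
lemma exists_isDistribution_psi {t : ℝ} (ht : t ∈ Set.Icc 0 T) :
    ∃ ν : Measure ℝ, IsDistribution ψ (X t) ν := by
  obtain ⟨ν, hν, h⟩ := exists_polyU_measure (α * t) ht.1
  have := hν.prob
  obtain ⟨L, hL⟩ := hν.exists_linearMap
  refine ⟨ν, isDistribution_of_poly hν fun p => ?_⟩
  have key : Complex.ofRealCLM.toLinearMap ∘ₗ L = polyFunctional ψ (X t) :=
    polyU_ext (α * t) t fun n => by
      cases n with
      | zero => simp [polyU, hL, polyFunctional_apply, hψ1]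
      | succ n =>
        rw [polyFunctional_apply, psi_polyU_eq_zero hT hX hψ1 (by omega) ht]
        simp [hL, h (n + 1) (by omega)]
  rw [← polyFunctional_apply, ← key, ← hL]
  rfl

include hφ1 hT hX hψ1 in
-- The first factor is absorbed into w, which then lies in the past of τ 0. The later factors reduce
-- by induction to a polynomial in X (τ 0), and the Markov property moves it down to time s.
lemma phi_mul_path (n : ℕ) {s : ℝ} {τ : Fin n → ℝ} (hs : 0 ≤ s) (hτ : StrictMono τ)
    (hsτ : ∀ i, s < τ i) (hτT : ∀ i, τ i ≤ T) (k : Fin n → ℕ) {w : A} (hw : w ∈ pastAlg X s) :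
    φ (w * (List.ofFn fun i => X (τ i) ^ k i).prod) =
      φ (w * Polynomial.aeval (X s) (pathPoly α n s τ k)) := by
  induction n generalizing s w with
  | zero => simp [pathPoly]
  | succ n ih =>
    have hτ0 : 0 ≤ τ 0 := hs.trans (hsτ 0).le
    have hw' : w * X (τ 0) ^ k 0 ∈ pastAlg X (τ 0) :=
      mul_mem (pastAlg_mono X (hsτ 0).le hw) (pow_mem (mem_pastAlg X hτ0 le_rfl) _)
    have h := ih (τ := Fin.tail τ) hτ0 (fun i j hij => hτ (Fin.succ_lt_succ_iff.2 hij))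
      (fun i => hτ (Fin.succ_pos i)) (fun i => hτT _) (Fin.tail k) hw'
    rw [List.ofFn_succ, List.prod_cons, ← mul_assoc]
    refine h.trans ?_
    rw [pathPoly, ← phi_mul_aeval hφ1 hT hX hψ1 hs (hsτ 0) (hτT 0) hw,
      map_mul (Polynomial.aeval (X (τ 0))), map_pow, Polynomial.aeval_X, mul_assoc]

include hφ1 hT hX hψ1 in
lemma isClassicalMarkovVersion_transKernel : IsClassicalMarkovVersion φ T X (transKernel α) where
  markov s t := inferInstance
  chapman_kolmogorov r s t hr hrs hst _ := transKernel_comp hr hrs.le hst.le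
  integrable n τ k hτ h := (pathKernel_moments n le_rfl hτ (fun i => (h i).1.le) (by simp) k).1
  moment n τ k hτ h := by
    rw [(pathKernel_moments (α := α) n le_rfl hτ (fun i => (h i).1.le) (by simp) k).2]
    have := phi_mul_path hφ1 hT hX hψ1 n le_rfl hτ (fun i => (h i).1) (fun i => (h i).2) k
      (one_mem (pastAlg X 0))
    rw [one_mul, one_mul, hX.zero, map_aeval_zero hφ1] at this
    exact this.symm

end Version

/-! ### The transition functions of an arbitrary classical version -/

section Paths

variable {K : ℝ → ℝ → Kernel ℝ ℝ}

lemma integrable_pathKernel_one (hK : ∀ s t, IsMarkovKernel (K s t)) {s x : ℝ} {τ : Fin 1 → ℝ}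
    {f : ℝ → ℝ} (hf : Continuous f) :
    Integrable (fun z => f (z 0)) (pathKernel K 1 s τ x) ↔ Integrable f (K s (τ 0) x) := by
  rw [integrable_pathKernel_succ hK (by fun_prop)]
  simp only [pathKernel_zero_apply, integral_dirac, Fin.cons_zero]
  rw [integrable_norm_iff hf.aestronglyMeasurable]
  exact and_iff_right (Eventually.of_forall fun y => integrable_dirac (by simp))

lemma integral_pathKernel_one (hK : ∀ s t, IsMarkovKernel (K s t)) {s x : ℝ} {τ : Fin 1 → ℝ}
    {f : ℝ → ℝ} (hf : Continuous f) (hi : Integrable f (K s (τ 0) x)) :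
    ∫ z, f (z 0) ∂pathKernel K 1 s τ x = ∫ y, f y ∂K s (τ 0) x := by
  rw [integral_pathKernel_succ hK (by fun_prop) ((integrable_pathKernel_one hK hf).2 hi)]
  simp only [pathKernel_zero_apply, integral_dirac, Fin.cons_zero]

end Paths

/-- A function which is orthogonal to all polynomials vanishes. -/
lemma BoundedProb.ae_eq_zero {μ : Measure ℝ} (hμ : BoundedProb μ) {d : ℝ → ℝ} (hd : Integrable d μ)
    (h : ∀ p : Polynomial ℝ, ∫ x, p.eval x * d x ∂μ = 0) : ∀ᵐ x ∂μ, d x = 0 := by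
  have := hμ.prob
  refine ae_eq_zero_of_integral_contDiff_smul_eq_zero hd.locallyIntegrable fun g hg _ => ?_
  obtain ⟨p, hp⟩ := exists_poly_seq hg.continuous
  obtain ⟨R, hR⟩ := hμ.bounded
  obtain ⟨C, hC⟩ := (isCompact_Icc (a := -R) (b := R)).exists_bound_of_continuousOn
    hg.continuous.continuousOn
  have hlim : Tendsto (fun k => ∫ x, (p k).eval x * d x ∂μ) atTop (𝓝 (∫ x, g x * d x ∂μ)) := by
    refine tendsto_integral_filter_of_dominated_convergence (fun x => (C + 1) * ‖d x‖)
      (Eventually.of_forall fun k =>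
        ((p k).continuous.aestronglyMeasurable.mul hd.aestronglyMeasurable)) ?_
      (hd.norm.const_mul _) ?_
    · filter_upwards [eventually_ge_atTop ⌈R⌉₊] with k hk
      filter_upwards [hR] with x hx
      have h1 := hp k x (hx.trans ((Nat.le_ceil R).trans (by exact_mod_cast hk)))
      have h2 : 1 / ((k : ℝ) + 1) ≤ 1 := by
        rw [div_le_one (by positivity)]
        linarith [(Nat.cast_nonneg k : (0 : ℝ) ≤ k)]
      have h3 := hC x (abs_le.1 hx)
      rw [norm_mul]
      refine mul_le_mul_of_nonneg_right ?_ (norm_nonneg _)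
      rw [Real.norm_eq_abs] at h3 ⊢
      have h4 := abs_sub_abs_le_abs_sub ((p k).eval x) (g x)
      linarith
    · filter_upwards [hR] with x hx
      refine Tendsto.mul_const _ ?_
      rw [tendsto_iff_dist_tendsto_zero]
      refine squeeze_zero' (Eventually.of_forall fun _ => dist_nonneg) ?_
        (tendsto_one_div_add_atTop_nhds_zero_nat (𝕜 := ℝ))
      filter_upwards [eventually_ge_atTop ⌈R⌉₊] with k hk
      exact (hp k x (hx.trans ((Nat.le_ceil R).trans (by exact_mod_cast hk)))).le
  simp only [h] at hlim
  simpa using (tendsto_nhds_unique hlim tendsto_const_nhds)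

section Version

variable {A : Type*} [Ring A] [Algebra ℂ A] {φ ψ : A →ₗ[ℂ] ℂ} {α T : ℝ} {X : ℝ → A}
  {K : ℝ → ℝ → Kernel ℝ ℝ}

lemma IsClassicalMarkovVersion.isDistribution (hK : IsClassicalMarkovVersion φ T X K) {t : ℝ}
    (ht : t ∈ Set.Ioc 0 T) : IsDistribution φ (X t) (K 0 t 0) := by
  have hm : StrictMono ![t] := Subsingleton.strictMono _
  have hi : ∀ n : ℕ, Integrable (fun x : ℝ => x ^ n) (K 0 t 0) := fun n => by
    have := hK.integrable 1 ![t] ![n] hm (by simpa using ht)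
    simp only [Fin.prod_univ_one] at this
    exact (integrable_pathKernel_one (f := fun x => x ^ n) hK.markov (by fun_prop)).1 this
  refine ⟨(hK.markov 0 t).isProbabilityMeasure 0, hi, fun n => ?_⟩
  have := hK.moment 1 ![t] ![n] hm (by simpa using ht)
  simp only [Fin.prod_univ_one] at this
  have h1 := integral_pathKernel_one hK.markov (τ := ![t]) (f := fun x => x ^ n) (by fun_prop) (hi n)
  simpa using (congrArg _ h1).symm.trans this

lemma IsClassicalMarkovVersion.two_steps (hK : IsClassicalMarkovVersion φ T X K) {t u : ℝ}
    (ht : 0 < t) (htu : t < u) (hu : u ≤ T) (i j : ℕ) :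
    (∀ᵐ y ∂K 0 t 0, Integrable (fun z => y ^ i * z ^ j) (K t u y)) ∧
      Integrable (fun y => y ^ i * ∫ z, z ^ j ∂K t u y) (K 0 t 0) ∧
      ((∫ y, y ^ i * ∫ z, z ^ j ∂K t u y ∂K 0 t 0 : ℝ) : ℂ) = φ (X t ^ i * X u ^ j) := by
  have := hK.markov t u
  have hm : StrictMono ![t, u] := by
    intro a b hab
    fin_cases a <;> fin_cases b <;> simp_all
  have hI : ∀ a, ![t, u] a ∈ Set.Ioc 0 T := by
    intro a
    fin_cases a
    · exact ⟨ht, (htu.trans_le hu).le⟩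
    · exact ⟨ht.trans htu, hu⟩
  have e : ∀ (y : ℝ) (z : Fin 1 → ℝ),
      ∏ a, (Fin.cons y z : Fin 2 → ℝ) a ^ (![i, j] a) = y ^ i * z 0 ^ j := by
    intro y z
    rw [prod_cons_pow, Fin.prod_univ_one]
    rfl
  have hint := hK.integrable 2 ![t, u] ![i, j] hm hI
  have h1 := (integrable_pathKernel_succ hK.markov (by fun_prop)).1 hint
  have h2 := integral_pathKernel_succ hK.markov (by fun_prop) hint
  simp only [e] at h1 h2
  have h3 : ∀ᵐ y ∂K 0 t 0, Integrable (fun z => y ^ i * z ^ j) (K t u y) := by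
    filter_upwards [h1.1] with y hy
    exact (integrable_pathKernel_one (τ := Fin.tail ![t, u]) hK.markov
      (f := fun z => y ^ i * z ^ j) (by fun_prop)).1 hy
  have h4 : ∀ᵐ y ∂K 0 t 0, ∫ z, y ^ i * z 0 ^ j ∂pathKernel K 1 t (Fin.tail ![t, u]) y =
      y ^ i * ∫ z, z ^ j ∂K t u y := by
    filter_upwards [h3] with y hy
    rw [← integral_const_mul]
    exact integral_pathKernel_one (τ := Fin.tail ![t, u]) hK.markov
      (f := fun z => y ^ i * z ^ j) (by fun_prop) hy
  refine ⟨h3, ?_, ?_⟩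
  · have hms : StronglyMeasurable fun y => ∫ z, z ^ j ∂K t u y :=
      StronglyMeasurable.integral_kernel (by fun_prop)
    refine h1.2.mono' ((by fun_prop : Continuous fun y : ℝ => y ^ i).aestronglyMeasurable.mul
      hms.aestronglyMeasurable) ?_
    filter_upwards [h4] with y hy
    rw [← hy]
    exact norm_integral_le_integral_norm _
  · rw [← integral_congr_ae h4]
    have := hK.moment 2 ![t, u] ![i, j] hm hI
    rw [h2] at this
    simpa using this

variable [StarRing A] (hφ1 : φ 1 = 1) (hT : 0 < T) (hX : IsTwoStateFBM φ ψ α T X) (hψ1 : ψ 1 = 1)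

include hφ1 hT hX hψ1 in
-- Two-time moments and the Markov property of φ show that the difference of the two sides is
-- orthogonal to all polynomials. Since μ has bounded support, it vanishes almost everywhere.
lemma ae_integral_pow (hK : IsClassicalMarkovVersion φ T X K) {t u : ℝ}
    (ht : 0 ≤ t) (htu : t < u) (hu : u ≤ T) {μ : Measure ℝ} (hμ : IsDistribution φ (X t) μ) (j : ℕ) :
    ∀ᵐ y ∂μ, Integrable (fun z => z ^ j) (K t u y) ∧
      ∫ z, z ^ j ∂K t u y = (transOp α t u (Polynomial.X ^ j)).eval y := by
  have htT : t ∈ Set.Icc 0 T := ⟨ht, htu.le.trans hu⟩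
  have hb := transMeas_boundedProb α 0 t 0
  have hd := isDistribution_transMeas hφ1 hT hX hψ1 htT
  have huniq : ∀ {μ' μ'' : Measure ℝ}, IsDistribution φ (X t) μ' → IsDistribution φ (X t) μ'' →
      μ' = μ'' := by
    intro μ' μ'' h' h''
    refine (h''.boundedProb hd hb).ext (h'.boundedProb hd hb) fun p => ?_
    exact_mod_cast (h'.poly p).2.trans (h''.poly p).2.symm
  have hbμ := hμ.boundedProb hd hb
  rcases ht.eq_or_lt with rfl | h0
  -- At t = 0 the law is concentrated at 0, and the one-time moments at u already determine the
  -- integral.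
  · have : μ = Measure.dirac 0 := huniq hμ <| isDistribution_of_poly (BoundedProb.dirac 0) fun p => by
      rw [integral_dirac, hX.zero, map_aeval_zero hφ1]
    rw [this, ae_dirac_eq, eventually_pure]
    have hdu := hK.isDistribution ⟨htu, hu⟩
    refine ⟨hdu.integrable j, ?_⟩
    have := (hdu.poly (Polynomial.X ^ j)).2.trans (phi_aeval hφ1 hT hX hψ1 ⟨htu.le, hu⟩ _)
    simpa using Complex.ofReal_injective this
  · have hμK : K 0 t 0 = μ := huniq (hK.isDistribution ⟨h0, htT.2⟩) hμ
    have h2 := hK.two_steps h0 htu hu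
    rw [hμK] at h2
    have hi1 := (h2 0 j).1
    have hi2 : ∀ i, Integrable (fun y => y ^ i * (transOp α t u (Polynomial.X ^ j)).eval y) μ :=
      fun i => hbμ.integrable (by fun_prop)
    have hz := hbμ.ae_eq_zero (d := fun y => (∫ z, z ^ j ∂K t u y) -
      (transOp α t u (Polynomial.X ^ j)).eval y) ?_ ?_
    · filter_upwards [hi1, hz] with y hy1 hy2
      exact ⟨by simpa using hy1, sub_eq_zero.1 hy2⟩
    · have := (h2 0 j).2.1.sub (hi2 0)
      simp only [pow_zero, one_mul] at this
      exact this
    · intro p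
      simp only [Polynomial.eval_eq_sum_range (p := p), Finset.sum_mul, mul_assoc]
      have hint : ∀ i, Integrable (fun y => y ^ i * ((∫ z, z ^ j ∂K t u y) -
          (transOp α t u (Polynomial.X ^ j)).eval y)) μ := fun i => by
        simp only [mul_sub]
        exact (h2 i j).2.1.sub (hi2 i)
      rw [integral_finsetSum _ fun i _ => (hint i).const_mul _]
      refine Finset.sum_eq_zero fun i _ => ?_
      rw [integral_const_mul]
      simp only [mul_sub]
      rw [integral_sub (h2 i j).2.1 (hi2 i), mul_eq_zero, sub_eq_zero]
      right
      apply Complex.ofReal_injective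
      rw [(h2 i j).2.2]
      have hw : X t ^ i ∈ pastAlg X t := pow_mem (mem_pastAlg X ht le_rfl) _
      have h3 := phi_mul_aeval hφ1 hT hX hψ1 ht htu hu hw (Polynomial.X ^ j)
      have h4 := (hμ.poly (Polynomial.X ^ i * transOp α t u (Polynomial.X ^ j))).2
      simp only [map_pow, map_mul, Polynomial.aeval_X, Polynomial.eval_mul, Polynomial.eval_pow,
        Polynomial.eval_X] at h3 h4
      rw [h3, h4]

include hφ1 hT hX hψ1 in
lemma ae_integral_poly (hK : IsClassicalMarkovVersion φ T X K) {t u : ℝ}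
    (ht : 0 ≤ t) (htu : t < u) (hu : u ≤ T) {μ : Measure ℝ} (hμ : IsDistribution φ (X t) μ)
    (p : Polynomial ℝ) :
    ∀ᵐ y ∂μ, Integrable (fun z => p.eval z) (K t u y) ∧
      ∫ z, p.eval z ∂K t u y = (transOp α t u p).eval y := by
  have h := ae_all_iff.2 fun j => ae_integral_pow hφ1 hT hX hψ1 hK ht htu hu hμ j
  filter_upwards [h] with y hy
  obtain ⟨h1, h2⟩ := integral_eval_eq (fun n => (hy n).1) p
  refine ⟨h1, ?_⟩
  rw [h2]
  conv_rhs => rw [p.as_sum_range_C_mul_X_pow]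
  simp only [map_sum, ← Polynomial.smul_eq_C_mul, map_smul, Polynomial.eval_finsetSum,
    Polynomial.eval_smul, smul_eq_mul, (hy _).2]

end Version

/-! ### The generator on polynomials -/

section DiffQuot

variable {μ ν : Measure ℝ}

/-- The Leibniz rule for difference quotients. Integrated in y, it computes the operators L
recursively in the degree. -/
lemma dslope_X_mul (p : Polynomial ℝ) (x y : ℝ) :
    dslope (fun z => (Polynomial.X * p).eval z) x y =
      x * dslope (fun z => p.eval z) x y + p.eval y := by
  rcases eq_or_ne y x with rfl | h
  · rw [dslope_same, dslope_same, Polynomial.deriv, Polynomial.deriv]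
    simp
    ring
  · rw [dslope_of_ne _ h, dslope_of_ne _ h, slope_def_field, slope_def_field]
    have : y - x ≠ 0 := sub_ne_zero.2 h
    simp only [Polynomial.eval_mul, Polynomial.eval_X]
    field_simp
    ring

lemma dslope_C (a x y : ℝ) : dslope (fun z => (Polynomial.C a).eval z) x y = 0 := by
  simp only [Polynomial.eval_C]
  rcases eq_or_ne y x with rfl | h
  · simp
  · simp [dslope_of_ne _ h, slope_def_field]

lemma dslope_add_poly (p q : Polynomial ℝ) (x y : ℝ) :
    dslope (fun z => (p + q).eval z) x y =
      dslope (fun z => p.eval z) x y + dslope (fun z => q.eval z) x y := by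
  rcases eq_or_ne y x with rfl | h
  · rw [dslope_same, dslope_same, dslope_same, Polynomial.deriv, Polynomial.deriv, Polynomial.deriv,
      map_add, Polynomial.eval_add]
  · simp only [dslope_of_ne _ h, slope_def_field, Polynomial.eval_add]
    ring

lemma dslope_smul_poly (c : ℝ) (p : Polynomial ℝ) (x y : ℝ) :
    dslope (fun z => (c • p).eval z) x y = c * dslope (fun z => p.eval z) x y := by
  rcases eq_or_ne y x with rfl | h
  · rw [dslope_same, dslope_same, Polynomial.deriv, Polynomial.deriv, map_smul,
      Polynomial.eval_smul, smul_eq_mul]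
  · simp only [dslope_of_ne _ h, slope_def_field, Polynomial.eval_smul, smul_eq_mul]
    ring

/-- Induction on polynomials by sums, constants and multiplication with the variable. -/
lemma poly_induction {P : Polynomial ℝ → Prop} (hC : ∀ a, P (Polynomial.C a))
    (hadd : ∀ p q, P p → P q → P (p + q)) (hX : ∀ p, P p → P (Polynomial.X * p))
    (p : Polynomial ℝ) : P p := by
  induction p using Polynomial.induction_on' with
  | add p q hp hq => exact hadd p q hp hq
  | monomial n a =>
    induction n with
    | zero => exact hC a
    | succ n ih => rw [← Polynomial.X_mul_monomial]; exact hX _ ih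

lemma integrable_dslope (hν : ∀ p : Polynomial ℝ, Integrable (fun x => p.eval x) ν)
    (p : Polynomial ℝ) (x : ℝ) : Integrable (fun y => dslope (fun z => p.eval z) x y) ν := by
  induction p using poly_induction with
  | hC a => simp only [dslope_C]; exact integrable_zero _ _ _
  | hadd p q hp hq => simp only [dslope_add_poly]; exact hp.add hq
  | hX p hp => simp only [dslope_X_mul]; exact (hp.const_mul x).add (hν p)

lemma exists_diffQuot_poly (hν : ∀ p : Polynomial ℝ, Integrable (fun x => p.eval x) ν) :
    ∃ Λ : Polynomial ℝ →ₗ[ℝ] Polynomial ℝ,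
      (∀ p, diffQuot ν (fun z => p.eval z) = fun x => (Λ p).eval x) ∧ Λ 1 = 0 ∧
      ∀ p, Λ (Polynomial.X * p) = Polynomial.X * Λ p + Polynomial.C (∫ y, p.eval y ∂ν) := by
  have hadd : ∀ p q : Polynomial ℝ, ∀ x, diffQuot ν (fun z => (p + q).eval z) x =
      diffQuot ν (fun z => p.eval z) x + diffQuot ν (fun z => q.eval z) x := fun p q x => by
    simp only [diffQuot, dslope_add_poly]
    exact integral_add (integrable_dslope hν p x) (integrable_dslope hν q x)
  have hsmul : ∀ (c : ℝ) (p : Polynomial ℝ), ∀ x, diffQuot ν (fun z => (c • p).eval z) x =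
      c * diffQuot ν (fun z => p.eval z) x := fun c p x => by
    simp only [diffQuot, dslope_smul_poly]
    exact integral_const_mul _ _
  have hC : ∀ a x, diffQuot ν (fun z => (Polynomial.C a).eval z) x = 0 := fun a x => by
    simp only [diffQuot, dslope_C, integral_zero]
  have hX : ∀ (p : Polynomial ℝ) (x : ℝ), diffQuot ν (fun z => (Polynomial.X * p).eval z) x =
      x * diffQuot ν (fun z => p.eval z) x + ∫ y, p.eval y ∂ν := fun p x => by
    simp only [diffQuot, dslope_X_mul]
    rw [integral_add ((integrable_dslope hν p x).const_mul x) (hν p), integral_const_mul]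
  have hex : ∀ p : Polynomial ℝ, ∃ q : Polynomial ℝ, ∀ x,
      q.eval x = diffQuot ν (fun z => p.eval z) x := by
    intro p
    induction p using poly_induction with
    | hC a => exact ⟨0, fun x => by rw [hC, Polynomial.eval_zero]⟩
    | hadd p q hp hq =>
      obtain ⟨p', hp⟩ := hp
      obtain ⟨q', hq⟩ := hq
      exact ⟨p' + q', fun x => by rw [hadd, Polynomial.eval_add, hp, hq]⟩
    | hX p hp =>
      obtain ⟨p', hp⟩ := hp
      exact ⟨Polynomial.X * p' + Polynomial.C (∫ y, p.eval y ∂ν), fun x => by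
        rw [hX, Polynomial.eval_add, Polynomial.eval_mul, hp, Polynomial.eval_X,
          Polynomial.eval_C]⟩
  choose Λ hΛ using hex
  refine ⟨⟨⟨Λ, fun p q => Polynomial.funext fun x => ?_⟩, fun c p => Polynomial.funext fun x => ?_⟩,
    fun p => funext fun x => (hΛ p x).symm, Polynomial.funext fun x => ?_,
    fun p => Polynomial.funext fun x => ?_⟩
  · rw [Polynomial.eval_add, hΛ, hΛ, hΛ, hadd]
  · simp only [RingHom.id_apply]
    rw [Polynomial.eval_smul, hΛ, hΛ, hsmul, smul_eq_mul]
  · refine (hΛ 1 x).trans ?_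
    rw [← Polynomial.C_1, hC, Polynomial.eval_zero]
  · simp only [LinearMap.coe_mk, AddHom.coe_mk]
    rw [Polynomial.eval_add, Polynomial.eval_mul, hΛ, hΛ, hX, Polynomial.eval_X, Polynomial.eval_C]

/-- Applying Λ to the three-term recursion leaves the same recursion with the index lowered by one,
since the means in positive degree vanish. -/
lemma diffQuot_polyU {Λ : Polynomial ℝ →ₗ[ℝ] Polynomial ℝ} {m : Polynomial ℝ → ℝ} (h1 : Λ 1 = 0)
    (hX : ∀ p, Λ (Polynomial.X * p) = Polynomial.X * Λ p + Polynomial.C (m p)) (hm : m 1 = 1)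
    {a b : ℝ} (hU : ∀ n, m (polyU a b (n + 1)) = 0) (n : ℕ) :
    Λ (polyU a b (n + 1)) = polyU a b n := by
  have hC : ∀ c : ℝ, Λ (Polynomial.C c) = 0 := fun c => by
    rw [← mul_one (Polynomial.C c), ← Polynomial.smul_eq_C_mul, map_smul, h1, smul_zero]
  induction n using Nat.strong_induction_on with
  | _ n ih =>
    match n with
    | 0 =>
      have := hX 1
      rw [mul_one, h1, hm] at this
      simp [polyU, hC, this]
    | 1 =>
      rw [polyU.eq_3, sub_mul, map_sub, map_sub, hX, ← Polynomial.smul_eq_C_mul,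
        ← Polynomial.smul_eq_C_mul, map_smul, map_smul, ih 0 (by omega), hU]
      simp [polyU, h1, Polynomial.smul_eq_C_mul]
    | n + 2 =>
      rw [polyU.eq_3, sub_mul, map_sub, map_sub, hX, ← Polynomial.smul_eq_C_mul,
        ← Polynomial.smul_eq_C_mul, map_smul, map_smul, ih (n + 1) (by omega), ih n (by omega), hU]
      rw [polyU.eq_3 a b n]
      simp only [map_zero, Polynomial.smul_eq_C_mul]
      ring

/-- The images obey the recursion with the first Jacobi parameters stripped off. The exceptional
first parameter disappears, and the result is `polyU`. -/
lemma diffQuot_polyQ {Λ : Polynomial ℝ →ₗ[ℝ] Polynomial ℝ} {m : Polynomial ℝ → ℝ} (h1 : Λ 1 = 0)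
    (hX : ∀ p, Λ (Polynomial.X * p) = Polynomial.X * Λ p + Polynomial.C (m p)) (hm : m 1 = 1)
    {a b : ℝ} (hQ : ∀ n, m (polyQ a b (n + 1)) = 0) (n : ℕ) :
    Λ (polyQ a b (n + 1)) = polyU a b n := by
  induction n using Nat.strong_induction_on with
  | _ n ih =>
    match n with
    | 0 =>
      have := hX 1
      rw [mul_one, h1, hm] at this
      simp [polyU, polyQ, this]
    | 1 =>
      rw [polyQ, sub_mul, map_sub, map_sub, hX, ← Polynomial.smul_eq_C_mul,
        ← Polynomial.smul_eq_C_mul, map_smul, map_smul, ih 0 (by omega), hQ]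
      simp [polyU, polyQ, h1, Polynomial.smul_eq_C_mul]
    | n + 2 =>
      rw [polyQ, sub_mul, map_sub, map_sub, hX, ← Polynomial.smul_eq_C_mul,
        ← Polynomial.smul_eq_C_mul, map_smul, map_smul, ih (n + 1) (by omega), ih n (by omega), hQ]
      rw [polyU.eq_3 a b n]
      simp only [map_zero, Polynomial.smul_eq_C_mul]
      ring

/-- The generator on polynomials. -/
lemma exists_genOp_poly {α t : ℝ} [IsProbabilityMeasure μ] [IsProbabilityMeasure ν]
    (hμ : ∀ p : Polynomial ℝ, Integrable (fun x => p.eval x) μ)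
    (hν : ∀ p : Polynomial ℝ, Integrable (fun x => p.eval x) ν)
    (hμQ : ∀ n, ∫ x, (polyQ (α * t) t (n + 1)).eval x ∂μ = 0)
    (hνU : ∀ n, ∫ x, (polyU (α * t) t (n + 1)).eval x ∂ν = 0) :
    ∃ G : Polynomial ℝ →ₗ[ℝ] Polynomial ℝ,
      (∀ p, genOp α μ ν (fun z => p.eval z) = fun x => (G p).eval x) ∧ G 1 = 0 ∧
      ∀ n, G (polyQ (α * t) t (n + 1)) =
        (1 + Polynomial.C α * Polynomial.X) * Polynomial.derivative (polyU (α * t) t n) := by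
  obtain ⟨M, hM, hM1, hMX⟩ := exists_diffQuot_poly hμ
  obtain ⟨N, hN, hN1, hNX⟩ := exists_diffQuot_poly hν
  have hMQ := diffQuot_polyQ (m := fun p => ∫ y, p.eval y ∂μ) hM1 hMX (by simp) hμQ
  have hNU := diffQuot_polyU (m := fun p => ∫ y, p.eval y ∂ν) hN1 hNX (by simp) hνU
  refine ⟨α • (Polynomial.derivative - M) + Polynomial.derivative ∘ₗ N, fun p => funext fun x => ?_,
    ?_, fun n => ?_⟩
  · simp [genOp, hM, hN, Polynomial.deriv]
  · simp [hM1, hN1]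
  -- The value is α(Q_{n+1}' - U_n) + (U_n + αtU_{n-1})', the last term being absent for n = 0.
  -- Differentiating U_{n+1} = (x - αt)U_n - tU_{n-1} cancels all but (1 + αx)U_n'.
  · simp only [LinearMap.add_apply, LinearMap.smul_apply, LinearMap.sub_apply,
      LinearMap.comp_apply, hMQ]
    rw [polyQ_succ, ← Polynomial.smul_eq_C_mul, map_add, map_add, map_smul, map_smul, hNU]
    cases n with
    | zero => simp [polyU, hN1]
    | succ n =>
      rw [hNU, polyU.eq_3 (α * t) t n]
      simp only [Polynomial.derivative_sub, Polynomial.derivative_mul, Polynomial.derivative_X,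
        Polynomial.derivative_C, Polynomial.smul_eq_C_mul, map_add, map_mul,
        zero_mul, zero_add]
      ring

end DiffQuot

/-! ### Dependence on time -/

/-- Differentiating the recursion in t adds the term -(αQ_{n+1} + Q_n) = -(1 + αx)U_n, just as
differentiating that of `polyU` in x adds a term U_{n+1}. This is the backward equation ∂_t Q = -A_t
Q. -/
lemma hasDerivAt_polyQ (α x t : ℝ) (n : ℕ) :
    HasDerivAt (fun t => (polyQ (α * t) t (n + 1)).eval x)
      (-((1 + α * x) * (Polynomial.derivative (polyU (α * t) t n)).eval x)) t := by
  have h0 : HasDerivAt (fun t => (polyQ (α * t) t 0).eval x) 0 t := by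
    simpa [polyQ] using hasDerivAt_const t (1 : ℝ)
  have step : ∀ n : ℕ, ∀ d d' : ℝ, HasDerivAt (fun t => (polyQ (α * t) t n).eval x) d t →
      HasDerivAt (fun t => (polyQ (α * t) t (n + 1)).eval x) d' t →
      HasDerivAt (fun t => (polyQ (α * t) t (n + 2)).eval x)
        ((x - α * t) * d' - t * d - (1 + α * x) * (polyU (α * t) t n).eval x) t := by
    intro n d d' h h'
    have h1 : HasDerivAt (fun t : ℝ => x - α * t) (-α) t := by
      simpa using ((hasDerivAt_id t).const_mul α).const_sub x
    have h2 := (h1.mul h').sub ((hasDerivAt_id t).mul h)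
    rw [← polyQ_add_smul]
    simp only [polyQ, Polynomial.eval_sub, Polynomial.eval_mul, Polynomial.eval_X,
      Polynomial.eval_C]
    refine h2.congr_deriv ?_
    simp only [id]
    ring
  have h1 : HasDerivAt (fun t => (polyQ (α * t) t 1).eval x) 0 t := by
    simpa [polyQ] using hasDerivAt_const t x
  induction n using Nat.strong_induction_on with
  | _ n ih =>
    match n with
    | 0 => simpa [polyU] using h1
    | 1 =>
      refine (step 0 _ _ h0 h1).congr_deriv ?_
      simp [polyU]
    | n + 2 =>
      refine (step (n + 1) _ _ (ih n (by omega)) (ih (n + 1) (by omega))).congr_deriv ?_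
      rw [polyU.eq_3 (α * t) t n]
      simp only [Polynomial.derivative_sub, Polynomial.derivative_mul, Polynomial.derivative_X,
        Polynomial.derivative_C, sub_zero, one_mul, zero_mul, zero_add, Polynomial.eval_add,
        Polynomial.eval_sub, Polynomial.eval_mul, Polynomial.eval_X, Polynomial.eval_C]
      ring

/-- The combination of the `polyQ` at time `t` with coefficients which depend on time. -/
noncomputable def timeComb (α t : ℝ) (c : ℕ →₀ Polynomial ℝ) : Polynomial ℝ :=
  c.sum fun k q => q.eval t • polyQ (α * t) t k

lemma timeComb_add (α t : ℝ) (c d : ℕ →₀ Polynomial ℝ) :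
    timeComb α t (c + d) = timeComb α t c + timeComb α t d :=
  Finsupp.sum_add_index' (by simp) fun k p q => by rw [Polynomial.eval_add, add_smul]

lemma timeComb_single (α t : ℝ) (k : ℕ) (q : Polynomial ℝ) :
    timeComb α t (Finsupp.single k q) = q.eval t • polyQ (α * t) t k :=
  Finsupp.sum_single_index (by simp)

/-- From X Q_{k+1} = Q_{k+2} + αtQ_{k+1} + tQ_k and X Q_0 = Q_1, multiplication by X keeps the
coefficients polynomial in t, hence differentiable. -/
lemma exists_timeComb_X_mul (α : ℝ) (c : ℕ →₀ Polynomial ℝ) :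
    ∃ d, ∀ t, timeComb α t d = Polynomial.X * timeComb α t c := by
  induction c using Finsupp.induction_linear with
  | zero => exact ⟨0, fun t => by simp [timeComb]⟩
  | add c c' hc hc' =>
    obtain ⟨d, hd⟩ := hc
    obtain ⟨d', hd'⟩ := hc'
    exact ⟨d + d', fun t => by rw [timeComb_add, timeComb_add, hd, hd', mul_add]⟩
  | single k q =>
    cases k with
    | zero => exact ⟨Finsupp.single 1 q, fun t => by simp [timeComb_single, polyQ]⟩
    | succ k =>
      refine ⟨Finsupp.single (k + 2) q +
        (Finsupp.single (k + 1) (Polynomial.C α * Polynomial.X * q) +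
          Finsupp.single k (Polynomial.X * q)), fun t => ?_⟩
      simp only [timeComb_add, timeComb_single]
      rw [polyQ]
      simp only [Polynomial.eval_mul, Polynomial.eval_X, Polynomial.eval_C,
        Polynomial.smul_eq_C_mul, map_mul]
      ring

lemma exists_timeComb (α : ℝ) (p : Polynomial ℝ) : ∃ c, ∀ t, timeComb α t c = p := by
  induction p using poly_induction with
  | hC a => exact ⟨Finsupp.single 0 (Polynomial.C a), fun t => by
      simp [timeComb_single, polyQ, Polynomial.smul_eq_C_mul]⟩
  | hadd p q hp hq =>
    obtain ⟨c, hc⟩ := hp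
    obtain ⟨d, hd⟩ := hq
    exact ⟨c + d, fun t => by rw [timeComb_add, hc, hd]⟩
  | hX p hp =>
    obtain ⟨c, hc⟩ := hp
    obtain ⟨d, hd⟩ := exists_timeComb_X_mul α c
    exact ⟨d, fun t => by rw [hd, hc]⟩

/-- The right difference quotients of the transition operators converge to the generator, with
respect to a basis. -/
lemma exists_generator_expansion {α t : ℝ} {G : Polynomial ℝ →ₗ[ℝ] Polynomial ℝ} (h1 : G 1 = 0)
    (hG : ∀ n, G (polyQ (α * t) t (n + 1)) =
      (1 + Polynomial.C α * Polynomial.X) * Polynomial.derivative (polyU (α * t) t n))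
    (p : Polynomial ℝ) : ∃ c : ℕ →₀ Polynomial ℝ,
      (∀ u, transOp α t u p = c.sum fun k q => q.eval u • polyQ (α * t) t k) ∧
      p = (c.sum fun k q => q.eval t • polyQ (α * t) t k) ∧
      G p = c.sum fun k q => (Polynomial.derivative q).eval t • polyQ (α * t) t k := by
  obtain ⟨c, hc⟩ := exists_timeComb α p
  refine ⟨c, fun u => ?_, (hc t).symm, Polynomial.funext fun x => ?_⟩
  · conv_lhs => rw [← hc u]
    rw [timeComb, map_finsuppSum]
    simp only [map_smul, transOp_polyQ]
  · have hQ : ∀ k, HasDerivAt (fun t => (polyQ (α * t) t k).eval x)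
        (-((G (polyQ (α * t) t k)).eval x)) t := by
      intro k
      cases k with
      | zero =>
        have : polyQ (α * t) t 0 = 1 := rfl
        rw [this, h1]
        simpa [polyQ] using hasDerivAt_const t (1 : ℝ)
      | succ k => simpa [hG] using hasDerivAt_polyQ α x t k
    have hd : HasDerivAt (fun t => ∑ k ∈ c.support, (c k).eval t * (polyQ (α * t) t k).eval x)
        (∑ k ∈ c.support, ((Polynomial.derivative (c k)).eval t * (polyQ (α * t) t k).eval x +
          (c k).eval t * -((G (polyQ (α * t) t k)).eval x))) t :=
      HasDerivAt.fun_sum fun k _ => ((c k).hasDerivAt t).mul (hQ k)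
    -- The combination is p at every time, so its derivative is zero. This exchanges the derivatives
    -- of the Q_k, which give -G p, for those of the coefficients.
    have hconst : (fun t => ∑ k ∈ c.support, (c k).eval t * (polyQ (α * t) t k).eval x) =
        fun _ => p.eval x := by
      funext s
      rw [← hc s, timeComb, Finsupp.sum, Polynomial.eval_finsetSum]
      simp only [Polynomial.eval_smul, smul_eq_mul]
    rw [hconst] at hd
    have h0 := hd.unique (hasDerivAt_const t _)
    rw [Finset.sum_add_distrib] at h0
    have hGp : (G p).eval x = ∑ k ∈ c.support, (c k).eval t * (G (polyQ (α * t) t k)).eval x := by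
      rw [← hc t, timeComb, map_finsuppSum, Finsupp.sum, Polynomial.eval_finsetSum]
      simp only [map_smul, Polynomial.eval_smul, smul_eq_mul]
    simp only [mul_neg, Finset.sum_neg_distrib] at h0
    rw [hGp, Finsupp.sum, Polynomial.eval_finsetSum]
    simp only [Polynomial.eval_smul, smul_eq_mul]
    linarith

/-! ### The generator of the process -/

/-- Bounded continuous functions are dense in L², and on the bounded support they are uniform limits
of polynomials. -/
lemma BoundedProb.exists_poly_eLpNorm_lt {μ : Measure ℝ} (hμ : BoundedProb μ) {g : ℝ → ℝ}
    (hg : MemLp g 2 μ) {ε : ENNReal} (hε : 0 < ε) :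
    ∃ p : Polynomial ℝ, eLpNorm (g - fun x => p.eval x) 2 μ < ε := by
  have := hμ.prob
  rcases eq_or_ne ε ⊤ with rfl | htop
  · exact ⟨0, (hg.sub (hμ.memLp (Polynomial.continuous 0))).2⟩
  obtain ⟨f, hf, hfm⟩ := hg.exists_boundedContinuous_eLpNorm_sub_le ENNReal.ofNat_ne_top
    (ENNReal.half_pos hε.ne').ne'
  obtain ⟨p, hp⟩ := exists_poly_seq f.continuous
  obtain ⟨R, hR⟩ := hμ.bounded
  have hlim : Tendsto (fun k : ℕ => ENNReal.ofReal (1 / ((k : ℝ) + 1))) atTop (𝓝 0) := by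
    simpa using ENNReal.tendsto_ofReal (tendsto_one_div_add_atTop_nhds_zero_nat (𝕜 := ℝ))
  obtain ⟨k, hk1, hk2⟩ := ((eventually_ge_atTop ⌈R⌉₊).and
    (hlim.eventually_lt_const (ENNReal.half_pos hε.ne'))).exists
  have h1 : eLpNorm (⇑f - fun x => (p k).eval x) 2 μ ≤ ENNReal.ofReal (1 / ((k : ℝ) + 1)) := by
    refine (eLpNorm_le_of_ae_bound (C := 1 / ((k : ℝ) + 1)) ?_).trans_eq (by simp)
    filter_upwards [hR] with x hx
    have := hp k x (hx.trans ((Nat.le_ceil R).trans (by exact_mod_cast hk1)))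
    rw [Pi.sub_apply, norm_sub_rev]
    exact this.le
  refine ⟨p k, ?_⟩
  have e : g - (fun x => (p k).eval x) = (g - ⇑f) + (⇑f - fun x => (p k).eval x) := by abel
  rw [e]
  calc eLpNorm ((g - ⇑f) + (⇑f - fun x => (p k).eval x)) 2 μ
      ≤ eLpNorm (g - ⇑f) 2 μ + eLpNorm (⇑f - fun x => (p k).eval x) 2 μ :=
        eLpNorm_add_le (hg.1.sub hfm.1) (hfm.1.sub (p k).continuous.aestronglyMeasurable)
          (by norm_num)
    _ ≤ ε / 2 + ENNReal.ofReal (1 / ((k : ℝ) + 1)) :=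
        add_le_add hf h1
    _ < ε := by
      conv_rhs => rw [← ENNReal.add_halves ε]
      exact ENNReal.add_lt_add_left (ENNReal.div_lt_top htop (by norm_num)).ne hk2

/-- Polynomial combinations with convergent coefficients converge in `L²`. -/
lemma BoundedProb.tendsto_eLpNorm_sum {μ : Measure ℝ} (hμ : BoundedProb μ) (s : Finset ℕ)
    (Q : ℕ → Polynomial ℝ) {d : ℕ → ℝ → ℝ} {l : Filter ℝ}
    (hd : ∀ k ∈ s, Tendsto (d k) l (𝓝 0)) :
    Tendsto (fun h => eLpNorm (fun x => ∑ k ∈ s, d k h * (Q k).eval x) 2 μ) l (𝓝 0) := by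
  have hb : Tendsto (fun h => ∑ k ∈ s, ‖d k h‖ₑ * eLpNorm (fun x => (Q k).eval x) 2 μ) l (𝓝 0) := by
    have h0 : (0 : ENNReal) = ∑ _k ∈ s, 0 := by simp
    rw [h0]
    refine tendsto_finsetSum _ fun k hk => ?_
    have h1 := zero_mul (eLpNorm (fun x => (Q k).eval x) 2 μ)
    refine h1 ▸ ENNReal.Tendsto.mul_const ?_ (Or.inr (hμ.memLp (Q k).continuous).2.ne)
    simpa using (hd k hk).enorm
  refine tendsto_of_tendsto_of_tendsto_of_le_of_le tendsto_const_nhds hb (fun _ => zero_le)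
    fun h => ?_
  have e : (fun x => ∑ k ∈ s, d k h * (Q k).eval x) =
      ∑ k ∈ s, d k h • fun x => (Q k).eval x := by
    funext x
    simp
  rw [e]
  refine (eLpNorm_sum_le (fun k _ => ((Q k).continuous.aestronglyMeasurable.const_smul _))
    (by norm_num)).trans (Finset.sum_le_sum fun k _ => eLpNorm_const_smul_le)

section Version

variable {A : Type*} [Ring A] [Algebra ℂ A] {φ ψ : A →ₗ[ℂ] ℂ} {α T : ℝ} {X : ℝ → A}
  {K : ℝ → ℝ → Kernel ℝ ℝ}
variable [StarRing A] (hφ1 : φ 1 = 1) (hT : 0 < T) (hX : IsTwoStateFBM φ ψ α T X) (hψ1 : ψ 1 = 1)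

include hφ1 hT hX hψ1 in
lemma exists_genOp {t : ℝ} (ht : t ∈ Set.Icc 0 T) {μ ν : Measure ℝ}
    (hμ : IsDistribution φ (X t) μ) (hν : IsDistribution ψ (X t) ν) :
    ∃ G : Polynomial ℝ →ₗ[ℝ] Polynomial ℝ,
      (∀ p, genOp α μ ν (fun z => p.eval z) = fun x => (G p).eval x) ∧ G 1 = 0 ∧
      ∀ n, G (polyQ (α * t) t (n + 1)) =
        (1 + Polynomial.C α * Polynomial.X) * Polynomial.derivative (polyU (α * t) t n) := by
  have := hμ.prob
  have := hν.prob
  refine exists_genOp_poly (fun p => (hμ.poly p).1) (fun p => (hν.poly p).1) (fun n => ?_)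
    fun n => ?_
  · apply Complex.ofReal_injective
    rw [(hμ.poly _).2, phi_aeval hφ1 hT hX hψ1 ht, transOp_polyQ]
    cases n <;> simp [polyQ]
  · apply Complex.ofReal_injective
    rw [(hν.poly _).2, psi_polyU_eq_zero hT hX hψ1 (by omega) ht, Complex.ofReal_zero]

include hφ1 hT hX hψ1 in
lemma isGeneratorAt_genOp (hK : IsClassicalMarkovVersion φ T X K) {t : ℝ}
    (ht : t ∈ Set.Ico 0 T) {μ ν : Measure ℝ} (hμ : IsDistribution φ (X t) μ)
    (hν : IsDistribution ψ (X t) ν) :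
    IsGeneratorAt K t μ polynomialFunctions (genOp α μ ν) := by
  have ht' : t ∈ Set.Icc 0 T := ⟨ht.1, ht.2.le⟩
  have hb : BoundedProb μ := hμ.boundedProb (isDistribution_transMeas hφ1 hT hX hψ1 ht')
    (transMeas_boundedProb α 0 t 0)
  obtain ⟨G, hG, hG1, hGQ⟩ := exists_genOp hφ1 hT hX hψ1 ht' hμ hν
  have hsmall : ∀ᶠ h in 𝓝[>] (0 : ℝ), ∀ p : Polynomial ℝ, ∀ᵐ y ∂μ,
      Integrable (fun z => p.eval z) (K t (t + h) y) ∧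
        ∫ z, p.eval z ∂K t (t + h) y = (transOp α t (t + h) p).eval y := by
    filter_upwards [Ioo_mem_nhdsGT (sub_pos.2 ht.2)] with h hh p
    exact ae_integral_poly hφ1 hT hX hψ1 hK ht.1 (by linarith [hh.1]) (by linarith [hh.2]) hμ p
  refine ⟨?_, ?_, ?_, ?_, ?_⟩
  · rintro _ ⟨p, rfl⟩
    exact hb.memLp p.continuous
  · intro g hg ε hε
    obtain ⟨p, hp⟩ := hb.exists_poly_eLpNorm_lt hg hε
    exact ⟨_, ⟨p, rfl⟩, hp⟩
  · rintro _ ⟨p, rfl⟩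
    rw [hG]
    exact hb.memLp (G p).continuous
  · rintro _ ⟨p, rfl⟩
    filter_upwards [hsmall] with h hh
    refine ⟨(hh p).mono fun y hy => hy.1, ?_⟩
    exact (hb.memLp (transOp α t (t + h) p).continuous).ae_eq
      ((hh p).mono fun y hy => hy.2.symm)
  · rintro _ ⟨p, rfl⟩
    obtain ⟨c, hc1, hc2, hc3⟩ := exists_generator_expansion hG1 hGQ p
    -- Only scalar coefficients depend on h: the error is a finite combination of the fixed
    -- Q_k(·;t), weighted by the error of the difference quotient of each coefficient.
    refine (hb.tendsto_eLpNorm_sum c.support (fun k => polyQ (α * t) t k)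
      (d := fun k h => h⁻¹ * ((c k).eval (t + h) - (c k).eval t) -
        (Polynomial.derivative (c k)).eval t) fun k _ => ?_).congr' ?_
    · have h1 := ((c k).hasDerivAt t).tendsto_slope_zero.mono_left
        (nhdsWithin_mono (0 : ℝ) fun x (hx : x ∈ Set.Ioi 0) => (Set.mem_Ioi.1 hx).ne')
      simpa using h1.sub_const ((Polynomial.derivative (c k)).eval t)
    · filter_upwards [hsmall] with h hh
      refine eLpNorm_congr_ae ?_
      filter_upwards [hh p] with x hx
      rw [hx.2, hG, hc1, hc3]
      conv_rhs => enter [1, 2, 2]; rw [hc2]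
      simp only [Finsupp.sum, Polynomial.eval_finsetSum, Polynomial.eval_smul, smul_eq_mul]
      rw [← Finset.sum_sub_distrib, Finset.mul_sum, ← Finset.sum_sub_distrib]
      exact Finset.sum_congr rfl fun k _ => by ring

end Version

end TwoStateFree

theorem mainTheorem10 {A : Type*} [Ring A] [StarRing A] [Algebra ℂ A] [StarModule ℂ A]
    (φ ψ : A →ₗ[ℂ] ℂ) (hφ : TwoStateFree.IsState φ) (hψ : TwoStateFree.IsState ψ)
    (α T : ℝ) (hT : 0 < T) (X : ℝ → A) (hX : TwoStateFree.IsTwoStateFBM φ ψ α T X) :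
    (∀ t ∈ Set.Icc 0 T, (∃ μ : Measure ℝ, TwoStateFree.IsDistribution φ (X t) μ) ∧
      ∃ ν : Measure ℝ, TwoStateFree.IsDistribution ψ (X t) ν) ∧
    (∃ K : ℝ → ℝ → Kernel ℝ ℝ, TwoStateFree.IsClassicalMarkovVersion φ T X K) ∧
    ∀ K : ℝ → ℝ → Kernel ℝ ℝ, TwoStateFree.IsClassicalMarkovVersion φ T X K →
      ∀ t ∈ Set.Ico 0 T, ∀ μ ν : Measure ℝ,
        TwoStateFree.IsDistribution φ (X t) μ → TwoStateFree.IsDistribution ψ (X t) ν →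
        TwoStateFree.IsGeneratorAt K t μ TwoStateFree.polynomialFunctions
          (TwoStateFree.genOp α μ ν) :=
  ⟨fun _ ht =>
    ⟨⟨_, TwoStateFree.isDistribution_transMeas hφ.map_one hT hX hψ.map_one ht⟩,
      TwoStateFree.exists_isDistribution_psi hT hX hψ.map_one ht⟩,
    ⟨_, TwoStateFree.isClassicalMarkovVersion_transKernel hφ.map_one hT hX hψ.map_one⟩,
    fun _ hK _ ht _ _ hμ hν =>
      TwoStateFree.isGeneratorAt_genOp hφ.map_one hT hX hψ.map_one hK ht hμ hν⟩
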